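/- **Setting.** Consider a Markov decision process with state space $\mathcal S$, action space $\mathcal A$, initial density $\rho$, transition density $\mathcal P(s'\mid s,a)$ (densities with respect to $\sigma$-finite reference measures), cost function $r$ and discount factor $\gamma\in[0,1)$; let $H\ge 1$ be the horizon and $d\ge 2$. Let $\pi_\theta(a\mid s)>0$, $\theta\in\mathbb R^d$, be a policy density that is twice continuously differentiable in $\theta$. A trajectory $\tau=(s_0,a_0,\dots,s_{H-1},a_{H-1})$ has density $p(\tau;\theta)=\rho(s_0)\prod_{h=0}^{H-2}\mathcal P(s_{h+1}\mid s_h,a_h)\prod_{h=0}^{H-1}\pi_\theta(a_h\mid s_h)$. Put $$J(\theta)=\mathbb E_{\tau\sim p(\cdot;\theta)}\Big[\sum_{h=0}^{H-1}\gamma^h r(s_h,a_h)\Big],\qquad J^*=\inf_\theta J(\theta),$$ $$g(\theta;\tau)=\sum_{h=0}^{H-1}\Big(\sum_{i=h}^{H-1}\gamma^i r(s_i,a_i)\Big)\nabla\log\pi_\theta(a_h\mid s_h),\qquad H(\theta;\tau)=\nabla g(\theta;\tau)+g(\theta;\tau)\,\nabla\log p(\tau;\theta)^{\top}.$$ For a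 finite batch $\mathcal M$ of trajectories, $g(\theta;\mathcal M)$ is the average of the $g(\theta;\tau)$, $\tau\in\mathcal M$, and $H(\theta;\mathcal M)$ is the symmetric part of the average of the $H(\theta;\tau)$, $\tau\in\mathcal M$. Vector norms are Euclidean, matrix norms are operator norms. **Assumptions.** There are constants $R,G,L,M,C,\Delta_J>0$ such that 1. $|r(s,a)|\le R$ for all $s,a$; 2. $\mathbb E_{\tau\sim p(\cdot;\theta)}\|\nabla\log\pi_\theta(a_h\mid s_h)\|^4\le G^4$ and $\mathbb E_{\tau\sim p(\cdot;\theta)}\|\nabla^2\log\pi_\theta(a_h\mid s_h)\|^2\le L^2$ for all $\theta$ and all $0\le h<H$; 3. $\|\nabla^2J(\theta_1)-\nabla^2J(\theta_2)\|\le M\|\theta_1-\theta_2\|$ for all $\theta_1,\theta_2$; 4. the initial point $\theta_0\in\mathbb R^d$ satisfies $J(\theta_0)-J^*\le\Delta_J$; and Assumption 5 below holds along the run. Put $$G_g^2=\frac{G^2R^2}{(1-\gamma)^3},\qquad G_H^2=\frac{2H^4G^4R^2(1-\gamma)^2+4L^2R^2}{(1-\gamma)^4},\qquad \tilde C=C+\tfrac1{24}.$$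 **Algorithm (DR-SOPO)** with accuracy $\epsilon>0$. Let $$\Delta=\frac{2\sqrt\epsilon}{M},\quad T=\Big\lceil\frac{24M^2\Delta_J}{\epsilon^{3/2}}\Big\rceil,\quad |\mathcal M_g|=\Big\lceil\frac{144M^2G_g^2}{\epsilon^2}\Big\rceil,\quad |\mathcal M_H|=\Big\lceil\frac{22\cdot24^2\,G_H^2\log d}{\epsilon}\Big\rceil .$$ Put $d_0=0$ and $d_t=\theta_t-\theta_{t-1}$ for $t\ge1$. In iteration $t=0,\dots,T-1$, draw batches $\mathcal M_g$, $\mathcal M_H$, each consisting, conditionally on the past, of i.i.d. trajectories from $p(\cdot;\theta_t)$; set $g_t=g(\theta_t;\mathcal M_g)$, $H_t=H(\theta_t;\mathcal M_H)$; let $\alpha_t=(\alpha_t^1,\alpha_t^2)$ be a global minimizer over $\{\alpha\in\mathbb R^2:\sqrt{\alpha^\top G_t\alpha}\le\Delta\}$ of $J(\theta_t)+c_t^\top\alpha+\frac12\alpha^\top Q_t\alpha$, where $$Q_t=\begin{pmatrix}g_t^\top H_tg_t&-d_t^\top H_tg_t\\-d_t^\top H_tg_t&d_t^\top H_td_t\end{pmatrix},\quad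 c_t=\begin{pmatrix}-\|g_t\|^2\\g_t^\top d_t\end{pmatrix},\quad G_t=\begin{pmatrix}g_t^\top g_t&-g_t^\top d_t\\-g_t^\top d_t&d_t^\top d_t\end{pmatrix};$$ and set $\theta_{t+1}=\theta_t-\alpha_t^1g_t+\alpha_t^2d_t$. One more gradient batch at $\theta_T$ gives $g_T$. Let $P_t$ be the orthogonal projection onto $\operatorname{span}\{g_t,d_t\}$ and $\tilde\nabla^2J(\theta_t)=P_t\nabla^2J(\theta_t)P_t$. The algorithm returns $\hat x=\theta_{\bar t}$, where $\bar t$ is uniform on $\{1,\dots,T\}$ and independent of the run; correspondingly $\tilde\nabla^2J(\hat x)=\tilde\nabla^2J(\theta_{\bar t})$. 5. Almost surely, $\|(\nabla^2J(\theta_t)-\tilde\nabla^2J(\theta_t))d_{t+1}\|\le MC\|d_{t+1}\|^2$ for all $0\le t<T$. **Claim.** For every $\epsilon>0$ the random variables $\|\nabla J(\hat x)\|$ and $\lambda_{\min}(\tilde\nabla^2J(\hat x))$ are integrable, and $$\mathbb E\|\nabla J(\hat x)\|\le\frac{3+4\tilde C}{M}\,\epsilon,\qquad \mathbb E\big[\lambda_{\min}(\tilde\nabla^2J(\hat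 x))\big]\ge-3\sqrt\epsilon .$$ Count one query for each evaluation of a stochastic gradient $g(\theta;\tau)$ and one for each stochastic Hessian-vector product (two per trajectory of $\mathcal M_H$, with the vectors $g_t$ and $d_t$), so that the total number of queries is $T(|\mathcal M_g|+2|\mathcal M_H|)+|\mathcal M_g|$. There is a universal constant $K$ such that, whenever $\epsilon$ is so small that the three quantities inside the ceilings above are at least $1$, this number is at most $$K\left(\frac{\Delta_JM^4G_g^2}{\epsilon^{3.5}}+\frac{\Delta_JM^2G_H^2\log d}{\epsilon^{2.5}}\right);$$ in particular, for fixed problem constants it is $O(\epsilon^{-3.5})$ as $\epsilon\to0^+$. -/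

import Mathlib

open MeasureTheory ProbabilityTheory Filter Topology Asymptotics

noncomputable section

namespace DRSOPO

/-- The parameter space `ℝ^d` with its Euclidean norm. -/
abbrev Param (d : ℕ) : Type := EuclideanSpace ℝ (Fin d)

/-- A discounted Markov decision process given by densities with respect to reference measures on
the state space and the action space (counting measure for discrete spaces, Lebesgue measure for
continuous ones). `cost` is the cost function `r`, and `disc` the discount factor `γ ∈ [0,1)`. -/
structure MDP (S A : Type*) [MeasurableSpace S] [MeasurableSpace A] where
  refS : Measure S
  refA : Measure A
  sigmaFinite_refS : SigmaFinite refS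
  sigmaFinite_refA : SigmaFinite refA
  /-- the density `ρ` of the initial state -/
  init : S → ℝ
  measurable_init : Measurable init
  init_nonneg : ∀ s, 0 ≤ init s
  lintegral_init : ∫⁻ s, ENNReal.ofReal (init s) ∂refS = 1
  /-- the transition density: `trans s a s'` is `𝒫(s' ∣ s, a)` -/
  trans : S → A → S → ℝ
  measurable_trans : Measurable (fun x : S × A × S => trans x.1 x.2.1 x.2.2)
  trans_nonneg : ∀ s a s', 0 ≤ trans s a s'
  lintegral_trans : ∀ s a, ∫⁻ s', ENNReal.ofReal (trans s a s') ∂refS = 1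
  cost : S → A → ℝ
  measurable_cost : Measurable (fun x : S × A => cost x.1 x.2)
  disc : ℝ
  disc_nonneg : 0 ≤ disc
  disc_lt_one : disc < 1

/-- A parametrized policy: `dens θ s a` is the density `π_θ(a ∣ s)`, positive and twice
continuously differentiable in `θ`, so that `∇ log π_θ` and `∇² log π_θ` make sense. -/
structure Policy {S A : Type*} [MeasurableSpace S] [MeasurableSpace A] (𝔐 : MDP S A) (d : ℕ) where
  dens : Param d → S → A → ℝ
  measurable_dens : ∀ θ, Measurable (fun x : S × A => dens θ x.1 x.2)
  dens_pos : ∀ θ s a, 0 < dens θ s a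
  lintegral_dens : ∀ θ s, ∫⁻ a, ENNReal.ofReal (dens θ s a) ∂𝔐.refA = 1
  contDiff_dens : ∀ s a, ContDiff ℝ 2 (fun θ => dens θ s a)

/-- Trajectories `τ = (s_0, a_0, …, s_{H-1}, a_{H-1})`. -/
abbrev Traj (S A : Type*) (H : ℕ) : Type _ := Fin H → S × A

namespace Policy

variable {S A : Type*} [MeasurableSpace S] [MeasurableSpace A] {𝔐 : MDP S A} {d : ℕ}
variable (π : Policy 𝔐 d) (H : ℕ) [NeZero H]

/-- The density `p(τ; θ) = ρ(s_0) ∏_{h < H-1} 𝒫(s_{h+1} ∣ s_h, a_h) ∏_{h < H} π_θ(a_h ∣ s_h)`. -/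
def trajDensity (θ : Param d) (τ : Traj S A H) : ℝ :=
  𝔐.init (τ 0).1 *
    (∏ h : Fin H, if hh : (h : ℕ) + 1 < H then
      𝔐.trans (τ h).1 (τ h).2 (τ ⟨(h : ℕ) + 1, hh⟩).1 else 1) *
    ∏ h : Fin H, π.dens θ (τ h).1 (τ h).2

/-- The law of a trajectory under `π_θ`. -/
def law (θ : Param d) : Measure (Traj S A H) :=
  (Measure.pi (fun _ : Fin H => 𝔐.refS.prod 𝔐.refA)).withDensity
    (fun τ => ENNReal.ofReal (π.trajDensity H θ τ))

/-- The objective `J(θ) = E_{τ ∼ p(·;θ)} [∑_{h < H} γ^h r(s_h, a_h)]`. -/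
def J (θ : Param d) : ℝ :=
  ∫ τ, (∑ h : Fin H, 𝔐.disc ^ (h : ℕ) * 𝔐.cost (τ h).1 (τ h).2) ∂(π.law H θ)

/-- The gradient `∇J`. -/
def gradJ (θ : Param d) : Param d := gradient (π.J H) θ

/-- The Hessian `∇²J`, as an operator on `ℝ^d`. -/
def hessJ (θ : Param d) : Param d →L[ℝ] Param d := fderiv ℝ (π.gradJ H) θ

/-- `∇_θ log π_θ(a ∣ s)`. -/
def score (θ : Param d) (s : S) (a : A) : Param d :=
  gradient (fun θ' => Real.log (π.dens θ' s a)) θ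

/-- `∇²_θ log π_θ(a ∣ s)`. -/
def scoreDeriv (θ : Param d) (s : S) (a : A) : Param d →L[ℝ] Param d :=
  fderiv ℝ (fun θ' => π.score θ' s a) θ

variable {H}

/-- The stochastic gradient `g(θ; τ) = ∑_h Ψ_h(τ) ∇ log π_θ(a_h ∣ s_h)` with the costs-to-go
`Ψ_h(τ) = ∑_{i ≥ h} γ^i r(s_i, a_i)`. -/
def gradEst (θ : Param d) (τ : Traj S A H) : Param d :=
  ∑ h : Fin H, (∑ i ∈ Finset.Ici h, 𝔐.disc ^ (i : ℕ) * 𝔐.cost (τ i).1 (τ i).2) •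
    π.score θ (τ h).1 (τ h).2

/-- The stochastic Hessian `H(θ; τ) = ∇g(θ; τ) + g(θ; τ) ∇ log p(τ; θ)ᵀ`. -/
def hessEst (θ : Param d) (τ : Traj S A H) : Param d →L[ℝ] Param d :=
  fderiv ℝ (fun θ' => π.gradEst θ' τ) θ +
    (innerSL ℝ (gradient (fun θ' => Real.log (π.trajDensity H θ' τ)) θ)).smulRight
      (π.gradEst θ τ)

/-- The mini-batch gradient `g(θ; ℳ)`. -/
def gradBatch {n : ℕ} (θ : Param d) (ℳ : Fin n → Traj S A H) : Param d :=
  (n : ℝ)⁻¹ • ∑ i, π.gradEst θ (ℳ i)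

/-- The mini-batch Hessian `H(θ; ℳ)`; the symmetric part of the average is taken, because
`g ∇ log pᵀ` need not be symmetric whereas the model Hessian of a trust region problem is. -/
def hessBatch {n : ℕ} (θ : Param d) (ℳ : Fin n → Traj S A H) : Param d →L[ℝ] Param d :=
  let B : Param d →L[ℝ] Param d := (n : ℝ)⁻¹ • ∑ i, π.hessEst θ (ℳ i)
  (2 : ℝ)⁻¹ • (B + ContinuousLinearMap.adjoint B)

end Policy

section TrustRegion

variable {d : ℕ}

/-- The matrix `Q` of the two-dimensional model. -/
def matQ (g v : Param d) (B : Param d →L[ℝ] Param d) : Matrix (Fin 2) (Fin 2) ℝ :=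
  !![inner ℝ g (B g), -inner ℝ v (B g); -inner ℝ v (B g), inner ℝ v (B v)]

/-- The linear term `c` of the two-dimensional model. -/
def vecC (g v : Param d) : Fin 2 → ℝ := ![-‖g‖ ^ 2, inner ℝ g v]

/-- The matrix `G` of the norm `‖α‖_G = √(αᵀ G α)`. -/
def matG (g v : Param d) : Matrix (Fin 2) (Fin 2) ℝ :=
  !![inner ℝ g g, -inner ℝ g v; -inner ℝ g v, inner ℝ v v]

/-- The model `m(α) = J₀ + cᵀ α + ½ αᵀ Q α`. -/
def model (J₀ : ℝ) (g v : Param d) (B : Param d →L[ℝ] Param d) (α : Fin 2 → ℝ) : ℝ :=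
  J₀ + vecC g v ⬝ᵥ α + 1 / 2 * (α ⬝ᵥ (matQ g v B).mulVec α)

/-- `α` is a global solution of: minimize `m(α)` subject to `‖α‖_G ≤ Δ`. -/
def IsDRTRSolution (J₀ : ℝ) (g v : Param d) (B : Param d →L[ℝ] Param d) (Δ : ℝ)
    (α : Fin 2 → ℝ) : Prop :=
  Real.sqrt (α ⬝ᵥ (matG g v).mulVec α) ≤ Δ ∧
    ∀ β : Fin 2 → ℝ, Real.sqrt (β ⬝ᵥ (matG g v).mulVec β) ≤ Δ →
      model J₀ g v B α ≤ model J₀ g v B β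

/-- The compression `V Vᵀ B V Vᵀ` of `B` to `span {g, v}`, where the columns of `V` are an
orthonormal basis of that span. -/
def projected (g v : Param d) (B : Param d →L[ℝ] Param d) : Param d →L[ℝ] Param d :=
  (Submodule.span ℝ {g, v}).starProjection ∘L B ∘L (Submodule.span ℝ {g, v}).starProjection

/-- The smallest eigenvalue (of a symmetric operator). -/
def lambdaMin (B : Param d →L[ℝ] Param d) : ℝ :=
  sInf {lam : ℝ | Module.End.HasEigenvalue (B : Param d →ₗ[ℝ] Param d) lam}

/-- The last displacement `d_t = θ_t - θ_{t-1}`, with `d_0 = 0`. -/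
def lastStep (θ : ℕ → Param d) : ℕ → Param d
  | 0 => 0
  | t + 1 => θ (t + 1) - θ t

end TrustRegion

/-- A run of `T` iterations of DR-SOPO from `θ₀` with radius `Δ` and batch sizes `Ng`, `NH`, on a
probability space with a filtration `ℱ`, where `ℱ t` is the information before iteration `t`.
Given `ℱ t`, each batch of iteration `t` consists of i.i.d. trajectories from `p(·; θ_t)`.
After the last iteration one more gradient batch is drawn at `θ_T`: it is only used to span the
subspace at `θ_T`. -/
structure Run {S A : Type*} [MeasurableSpace S] [MeasurableSpace A] {𝔐 : MDP S A} {d : ℕ}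
    (π : Policy 𝔐 d) (H : ℕ) [NeZero H] {Ω : Type*} [mΩ : MeasurableSpace Ω] (μ : Measure Ω)
    (ℱ : Filtration ℕ mΩ) (θ₀ : Param d) (Δ : ℝ) (T Ng NH : ℕ) where
  θ : ℕ → Ω → Param d
  /-- the batches `ℳ_g` -/
  batchG : ℕ → Ω → Fin Ng → Traj S A H
  /-- the batches `ℳ_H` -/
  batchH : ℕ → Ω → Fin NH → Traj S A H
  /-- the step sizes -/
  α : ℕ → Ω → Fin 2 → ℝ
  start : ∀ ω, θ 0 ω = θ₀
  measurable_θ : ∀ t ≤ T, Measurable[ℱ t] (θ t)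
  measurable_batchG : ∀ t ≤ T, Measurable[ℱ (t + 1)] (batchG t)
  measurable_batchH : ∀ t < T, Measurable[ℱ (t + 1)] (batchH t)
  condLaw_batchG : ∀ t ≤ T, ∀ D, MeasurableSet[ℱ t] D → ∀ B, MeasurableSet B →
    μ (D ∩ batchG t ⁻¹' B) = ∫⁻ ω in D, Measure.pi (fun _ : Fin Ng => π.law H (θ t ω)) B ∂μ
  condLaw_batchH : ∀ t < T, ∀ D, MeasurableSet[ℱ t] D → ∀ B, MeasurableSet B →
    μ (D ∩ batchH t ⁻¹' B) = ∫⁻ ω in D, Measure.pi (fun _ : Fin NH => π.law H (θ t ω)) B ∂μ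
  solves : ∀ t < T, ∀ ω,
    IsDRTRSolution (π.J H (θ t ω)) (π.gradBatch (θ t ω) (batchG t ω))
      (lastStep (fun k => θ k ω) t) (π.hessBatch (θ t ω) (batchH t ω)) Δ (α t ω)
  update : ∀ t < T, ∀ ω,
    θ (t + 1) ω = θ t ω - α t ω 0 • π.gradBatch (θ t ω) (batchG t ω)
      + α t ω 1 • lastStep (fun k => θ k ω) t

namespace Run

variable {S A : Type*} [MeasurableSpace S] [MeasurableSpace A] {𝔐 : MDP S A} {d : ℕ}
  {π : Policy 𝔐 d} {H : ℕ} [NeZero H] {Ω : Type*} [mΩ : MeasurableSpace Ω] {μ : Measure Ω}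
  {ℱ : Filtration ℕ mΩ} {θ₀ : Param d} {Δ : ℝ} {T Ng NH : ℕ}
  (run : Run π H μ ℱ θ₀ Δ T Ng NH)

/-- The stochastic gradient `g_t`. -/
def g (t : ℕ) (ω : Ω) : Param d := π.gradBatch (run.θ t ω) (run.batchG t ω)

/-- The displacement `d_t = θ_t - θ_{t-1}`. -/
def dir (t : ℕ) (ω : Ω) : Param d := lastStep (fun k => run.θ k ω) t

/-- The projected Hessian of `J` at `θ_t`, on the subspace `span {g_t, d_t}`. -/
def projHess (t : ℕ) (ω : Ω) : Param d →L[ℝ] Param d :=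
  projected (run.g t ω) (run.dir t ω) (π.hessJ H (run.θ t ω))

end Run

/-- The variance constant `G_g²` of the stochastic gradient. -/
def gradVar (G R γ : ℝ) : ℝ := G ^ 2 * R ^ 2 / (1 - γ) ^ 3

/-- The variance constant `G_H²` of the stochastic Hessian. -/
def hessVar (H : ℕ) (G L R γ : ℝ) : ℝ :=
  (2 * (H : ℝ) ^ 4 * G ^ 4 * R ^ 2 * (1 - γ) ^ 2 + 4 * L ^ 2 * R ^ 2) / (1 - γ) ^ 4

/-- The radius `Δ`. -/
def radius (M ε : ℝ) : ℝ := 2 * Real.sqrt ε / M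

/-- The number of iterations before rounding. -/
def iterReal (M ΔJ ε : ℝ) : ℝ := 24 * M ^ 2 * ΔJ / ε ^ (3 / 2 : ℝ)

/-- The size of `ℳ_g` before rounding, for the variance constant `Gg2 = G_g²`. -/
def gradSizeReal (M Gg2 ε : ℝ) : ℝ := 144 * M ^ 2 * Gg2 / ε ^ 2

/-- The size of `ℳ_H` before rounding, for the variance constant `GH2 = G_H²`. -/
def hessSizeReal (d : ℕ) (GH2 ε : ℝ) : ℝ := 22 * 24 ^ 2 * GH2 * Real.log d / ε

/-- Number of oracle queries of a run: every iteration queries one stochastic gradient `g(θ; τ)`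
for each trajectory of `ℳ_g`, and for each trajectory of `ℳ_H` the two Hessian-vector products
`H(θ; τ) g_t` and `H(θ; τ) d_t`, which determine the two-dimensional model; finally there is the
additional gradient batch at `θ_T`. -/
def queryCount (T Ng NH : ℕ) : ℕ := (∑ _t ∈ Finset.range T, (Ng + 2 * NH)) + Ng

/-- The number of queries with the prescribed parameters, as a function of the accuracy. -/
def totalQueries (d : ℕ) (M ΔJ Gg2 GH2 ε : ℝ) : ℕ :=
  queryCount ⌈iterReal M ΔJ ε⌉₊ ⌈gradSizeReal M Gg2 ε⌉₊ ⌈hessSizeReal d GH2 ε⌉₊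

end DRSOPO

end

open DRSOPO

/-! Replace `J` by `y ↦ c * J (σ • y)` with `c = M² / ε^(3/2)` and `σ = √ε / M`. In these units the
Hessian is 1-Lipschitz, the radius is 2, gradients are multiplied by `M / ε` and Hessians by `1 /
√ε`, so both guarantees become bounds by absolute constants (plus `4 * C`) on averages along the
run.

Each step `x` minimizes a quadratic model over a ball in the plane `S` spanned by `g` and `d`. Hence
it has a multiplier `lam ≥ 0` with `P (H x) = -g - lam • x` and `H + lam ≥ 0` on `S`
(`exists_multiplier`).

Gradient. The new gradient is `r - lam • x`, with `r` the Taylor remainder, plus noise and an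
out-of-plane part controlled by `C`. Adding the worst cases of `‖r‖` (2) and of the remainder of the
values (4/3) would give 10/3 per step, which is too much. The two worst cases are incompatible
unless the next step gains a lot: the next plane contains the displacement just made, so the half
step back `-x / 2` is feasible there. This is recorded by the potential `f (θ t) - ψ t`, where `ψ t`
is an upper bound, capped at 4/5, for what the model at `θ t` can gain within distance 1. The
resulting one-step inequality has the constant 38/15 (`one_step_real`,
`TrustRegionStep.potential_le`), and it telescopes in `sum_norm_grad_le`.

Curvature. At an iterate from which a step is taken, the negative curvature on the plane is at most
`lam` plus the Hessian error, and the decrease of `f` bounds the sum of the multipliers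
(`sum_multiplier_le`). No step leaves the last iterate; there a step along a direction of negative
curvature compares the curvature with the remaining gap (`neg_curvature_le`).

Noise. The policy gradient theorem and its derivative make both estimators unbiased
(`hasGradientAt_J`, `hasFDerivAt_gradJ_integral`), with second moments bounded in `gradEst_sq_le`
and `hessEst_sq_le`. For gradient batches the variance of independent sums suffices. For Hessian
batches, symmetrization and a matrix Khintchine inequality (`sum_norm_signedSum_sq_le`) produce the
factor `log d`. The mean errors are then at most `ε / (12 M)` and `√ε / 24`.

The moment assumptions hold at each parameter separately and supply no local dominating function for
differentiating under the integral. `WeightedFamily` replaces domination by continuity of the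
derivative in L¹, obtained from truncation and Scheffé's lemma. -/

noncomputable section

namespace DRSOPO

/-! ### The one-step inequality in normalized units -/

section OneStep

/-- The scalar inequality behind one step of the method, in units where `M = 1` and `Δ = 2`. Here
`G = ‖r - λ x‖`, `e` is the cubic Taylor remainder of the values, `ρ = ⟪r, x⟫` that of the slopes
and `δ` the change of curvature along the step. -/
theorem one_step_real {a lam G e ρ δ h u v ng nH ψ ψ' b : ℝ}
    (ha0 : 0 ≤ a) (ha2 : a ≤ 2) (hlam : 0 ≤ lam) (hcomp : lam * (2 - a) = 0)
    (hh : 0 ≤ h + lam * a ^ 2)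
    (hG : G ^ 2 ≤ (a ^ 2 / 2) ^ 2 - 2 * lam * ρ + lam ^ 2 * a ^ 2)
    (he : e ≤ a ^ 3 / 6) (heρ : e - ρ / 2 ≤ a ^ 3 / 12)
    (hes : ∀ s : ℝ, 0 ≤ s → s ≤ 1 →
      e - s * ρ + s ^ 2 / 2 * δ ≤ a ^ 3 * ((1 - s) ^ 3 + s ^ 3) / 6)
    (hδ : |δ| ≤ a ^ 3) (hu : |u| ≤ a * ng) (hv : |v| ≤ a ^ 2 * nH)
    (hng : 0 ≤ ng) (hnH : 0 ≤ nH)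
    (hψ1 : ψ ≤ h / 2 + 5 / 2 * lam) (hψ2 : ψ ≤ 4 / 5) (hψ' : 0 ≤ ψ') (hb : 0 ≤ b)
    (hnext : 4 / 5 ≤ ψ' ∨ (ρ + u + v - 4 * lam) / 2 - (h + v + δ) / 8 - b ≤ ψ') :
    G + (-(h / 2 + 4 * lam) + u + v / 2 + e) - ψ' ≤ 38 / 15 - ψ + 2 * ng + 2 * nH + b := by
  have hu1 : |u| ≤ 2 * ng := hu.trans (by nlinarith)
  have hv1 : |v| ≤ 4 * nH := hv.trans (mul_le_mul_of_nonneg_right (by nlinarith) hnH)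
  obtain ⟨hu2, hu3⟩ := abs_le.1 hu1
  obtain ⟨hv2, hv3⟩ := abs_le.1 hv1
  obtain ⟨hδ1, hδ2⟩ := abs_le.1 hδ
  -- For `lam = 0` the two alternatives of `hnext` lead to 2 + 4/3 - 4/5 and to 2 + 1/3 + (4/5)/4.
  -- The cap 4/5 on `ψ` is the value that makes both equal to 38/15.
  rcases hlam.eq_or_lt with h0 | h0
  · subst h0
    have ha3 : a ^ 3 ≤ 8 := by nlinarith [sq_nonneg a, mul_nonneg ha0 ha0]
    have hG2 : G ≤ a ^ 2 / 2 := by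
      apply le_of_sq_le_sq _ (by positivity)
      linarith
    have ha4 : a ^ 2 ≤ 4 := by nlinarith
    rcases hnext with hn | hn
    · linarith
    -- The credit of the half step back contributes `-ρ / 2 + δ / 8`, which is exactly what `s = 1 /
    -- 2` produces.
    · have := hes (1 / 2) (by norm_num) (by norm_num)
      nlinarith
  · have ha : a = 2 := by
      rcases mul_eq_zero.1 hcomp with h1 | h1 <;> linarith
    subst ha
    norm_num at hG hh he heρ hes hδ1 hδ2
    -- The bound `4 * G ≤ G ^ 2 + 4` is centred at 2, the largest possible size of the remainder.
    have hGq : G ≤ 2 - lam * ρ / 2 + lam ^ 2 := by nlinarith [sq_nonneg (G - 2)]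
    by_cases hc : lam ≤ 1 / 2 ∧ (ρ + u + v - 4 * lam) / 2 - (h + v + δ) / 8 - b ≤ ψ'
    · obtain ⟨hl, hn⟩ := hc
      have hw : 0 ≤ 1 - 2 * lam := by linarith
      -- Only the fraction `1 - 2 * lam` of the credit is used. Its slope term and the one in `hGq`
      -- add up to `-(1 - lam) / 2 * ρ`, which dictates `s = (1 - lam) / 2` below.
      have hn' : (1 - 2 * lam) * ((ρ + u + v - 4 * lam) / 2 - (h + v + δ) / 8) - b ≤ ψ' := by
        linarith [mul_nonneg hw (sub_nonneg.2 hn), mul_nonneg hlam hψ', mul_nonneg hlam hb]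
      have hs := hes ((1 - lam) / 2) (by linarith) (by linarith)
      -- The coefficients `(1 - 2 * lam) / 8` and `s ^ 2 / 2 = (1 - lam) ^ 2 / 8` of `δ` differ by
      -- `lam ^ 2 / 8`.
      have hd : -(lam ^ 2 / 8 * δ) ≤ lam ^ 2 := by
        linarith [mul_nonneg (sq_nonneg lam) (sub_nonneg.2 hδ1)]
      have hψ3 : ψ - (h / 2 + 5 / 2 * lam) + (1 - 2 * lam) / 4 * (h / 2 + 5 / 2 * lam)
          ≤ (1 - 2 * lam) / 5 := by
        linarith [mul_nonneg hw (sub_nonneg.2 hψ2), mul_nonneg hlam (sub_nonneg.2 hψ1)]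
      have hN : u + v / 2 - (1 - 2 * lam) * (u / 2 + 3 / 8 * v) ≤ 2 * ng + 2 * nH := by
        linarith [mul_nonneg hw (neg_le_iff_add_nonneg.1 hu2),
          mul_nonneg hw (neg_le_iff_add_nonneg.1 hv2), mul_nonneg hlam (sub_nonneg.2 hu3),
          mul_nonneg hlam (sub_nonneg.2 hv3), mul_nonneg hlam hng, mul_nonneg hlam hnH]
      have hs' : e - (1 - lam) / 2 * ρ + ((1 - lam) / 2) ^ 2 / 2 * δ ≤ 1 / 3 + lam ^ 2 :=
        hs.trans (le_of_eq (by ring))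
      have hq : lam ^ 2 ≤ lam / 2 := by nlinarith
      linarith
    · rcases le_or_gt lam 1 with h1 | h1
      -- Convex combination, with weights `lam` and `1 - lam`, of the trapezoidal bound `heρ` and of
      -- `he`.
      · have hlin : e - lam * ρ / 2 ≤ 4 / 3 - 2 / 3 * lam := by
          linarith [mul_nonneg hlam (sub_nonneg.2 heρ),
            mul_nonneg (sub_nonneg.2 h1) (sub_nonneg.2 he)]
        rcases le_or_gt lam (1 / 2) with h3 | h3
        · have : 4 / 5 ≤ ψ' := hnext.resolve_right fun hn => hc ⟨h3, hn⟩
          have hq : lam ^ 2 ≤ lam / 2 := by nlinarith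
          linarith
        · have hq : lam ^ 2 ≤ 3 / 2 * lam - 1 / 2 := by nlinarith
          linarith
      -- For large `lam` the term `lam • x` of norm `2 * lam` dominates, so the square is centred
      -- there. The remaining `-ρ / 2` is absorbed by `heρ`, and `hh` keeps the total at 37/15.
      · have hG3 : G ≤ 2 * lam + 1 - ρ / 2 := by
          have : G * lam ≤ (2 * lam + 1 - ρ / 2) * lam := by
            linarith [sq_nonneg (G - 2 * lam)]
          exact le_of_mul_le_mul_right this h0
        linarith

/-! ### Taylor estimates for functions with Lipschitz Hessian -/

section Taylor

variable {E : Type*} [NormedAddCommGroup E] [InnerProductSpace ℝ E]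

/-- Second order Taylor bounds of a function with `M`-Lipschitz Hessian, for given candidates of the
gradient and Hessian fields. -/
structure LipschitzHessian (M : ℝ) (f : E → ℝ) (f' : E → E) (f'' : E → E →L[ℝ] E) : Prop where
  value : ∀ x y, |f y - f x - inner ℝ (f' x) (y - x) - inner ℝ (f'' x (y - x)) (y - x) / 2|
    ≤ M / 6 * ‖y - x‖ ^ 3
  grad : ∀ x y, ‖f' y - f' x - f'' x (y - x)‖ ≤ M / 2 * ‖y - x‖ ^ 2
  hess : ∀ x y, ‖f'' y - f'' x‖ ≤ M * ‖y - x‖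
  trapezoid : ∀ x y, f y - f x - inner ℝ (f' x + f' y) (y - x) / 2 ≤ M / 12 * ‖y - x‖ ^ 3

/-- The difference of `c / (k + 1) * s ^ (k + 1)` and `F` is monotone on the unit interval. This
integrates the derivative bound without any integrability of `F'`. -/
theorem sub_le_of_hasDerivAt_le_pow {F F' : ℝ → ℝ} {c : ℝ} (k : ℕ)
    (hF : ∀ s, HasDerivAt F (F' s) s) (hF' : ∀ s, 0 ≤ s → s ≤ 1 → F' s ≤ c * s ^ k) :
    F 1 - F 0 ≤ c / (k + 1) := by
  have hd : ∀ s, HasDerivAt (fun s => c / (k + 1) * s ^ (k + 1) - F s) (c * s ^ k - F' s) s := by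
    intro s
    have h := ((hasDerivAt_pow (k + 1) s).const_mul (c / (k + 1))).sub (hF s)
    refine h.congr_deriv ?_
    have : (k : ℝ) + 1 ≠ 0 := by positivity
    push_cast
    field_simp
  have hm : MonotoneOn (fun s => c / (k + 1) * s ^ (k + 1) - F s) (Set.Icc 0 1) := by
    apply monotoneOn_of_deriv_nonneg (convex_Icc 0 1)
    · exact fun s _ => (hd s).continuousAt.continuousWithinAt
    · exact fun s _ => (hd s).differentiableAt.differentiableWithinAt
    · intro s hs
      rw [interior_Icc] at hs
      rw [(hd s).deriv]
      linarith [hF' s hs.1.le hs.2.le]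
  have := hm (Set.left_mem_Icc.2 zero_le_one) (Set.right_mem_Icc.2 zero_le_one) zero_le_one
  simp at this
  linarith

theorem LipschitzHessian.of_hasFDerivAt [CompleteSpace E] {M : ℝ} {f : E → ℝ} {f' : E → E}
    {f'' : E → E →L[ℝ] E}
    (hf : ∀ x, HasGradientAt f (f' x) x) (hf' : ∀ x, HasFDerivAt f' (f'' x) x)
    (hM : ∀ x y, ‖f'' y - f'' x‖ ≤ M * ‖y - x‖) : LipschitzHessian M f f' f'' := by
  have hline : ∀ (x d : E) (s : ℝ), HasDerivAt (fun s : ℝ => x + s • d) d s := by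
    intro x d s
    simpa using ((hasDerivAt_id s).smul_const d).const_add x
  have hdf : ∀ (x d : E) (s : ℝ),
      HasDerivAt (fun s : ℝ => f (x + s • d)) (inner ℝ (f' (x + s • d)) d) s := by
    intro x d s
    have h := (hf (x + s • d)).hasFDerivAt.comp_hasDerivAt s (hline x d s)
    rw [InnerProductSpace.toDual_apply_apply] at h
    exact h
  have hdf' : ∀ (x d : E) (s : ℝ),
      HasDerivAt (fun s : ℝ => f' (x + s • d)) (f'' (x + s • d) d) s := by
    intro x d s
    exact (hf' (x + s • d)).comp_hasDerivAt s (hline x d s)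
  have hgrad : ∀ x y, ‖f' y - f' x - f'' x (y - x)‖ ≤ M / 2 * ‖y - x‖ ^ 2 := by
    intro x y
    set d := y - x with hd
    set w := f' y - f' x - f'' x d with hw
    -- Testing against the remainder `w` itself reduces the vector estimate to a scalar one, from
    -- which one factor `‖w‖` is cancelled at the end.
    have key := sub_le_of_hasDerivAt_le_pow (c := M * ‖d‖ ^ 2 * ‖w‖) 1
      (F := fun s => inner ℝ (f' (x + s • d)) w - s * inner ℝ (f'' x d) w)
      (F' := fun s => inner ℝ (f'' (x + s • d) d) w - 1 * inner ℝ (f'' x d) w)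
      (fun s => by
        have h1 := (hdf' x d s).inner ℝ (hasDerivAt_const s w)
        simp only [inner_zero_right, zero_add] at h1
        exact h1.sub ((hasDerivAt_id s).mul_const _))
      (fun s hs _ => by
        rw [one_mul, ← inner_sub_left, ← _root_.sub_apply]
        have h1 := hM x (x + s • d)
        rw [add_sub_cancel_left, norm_smul, Real.norm_of_nonneg hs] at h1
        calc inner ℝ ((f'' (x + s • d) - f'' x) d) w
            ≤ ‖(f'' (x + s • d) - f'' x) d‖ * ‖w‖ := real_inner_le_norm _ _
          _ ≤ (M * (s * ‖d‖) * ‖d‖) * ‖w‖ := by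
              gcongr
              exact ContinuousLinearMap.le_of_opNorm_le _ h1 _
          _ = _ := by ring)
    have hy : x + d = y := by rw [hd]; abel
    simp only [one_smul, zero_smul, add_zero, hy, one_mul, zero_mul, sub_zero] at key
    rw [← inner_sub_left, ← inner_sub_left, sub_right_comm, ← hw, real_inner_self_eq_norm_sq] at key
    rcases (norm_nonneg w).eq_or_lt with h0 | h0
    · rw [← h0]
      have : 0 ≤ M * ‖d‖ := (norm_nonneg _).trans (hM x y)
      nlinarith [norm_nonneg d]
    · push_cast at key
      refine le_of_mul_le_mul_right ?_ h0
      calc ‖w‖ * ‖w‖ = ‖w‖ ^ 2 := by ring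
        _ ≤ _ := key
        _ = _ := by ring
  have hinner : ∀ (x d : E) (s : ℝ), 0 ≤ s →
      |inner ℝ (f' (x + s • d) - f' x - s • f'' x d) d| ≤ M / 2 * ‖d‖ ^ 3 * s ^ 2 := by
    intro x d s hs
    have h1 := hgrad x (x + s • d)
    rw [add_sub_cancel_left, norm_smul, Real.norm_of_nonneg hs, map_smul] at h1
    calc _ ≤ ‖f' (x + s • d) - f' x - s • f'' x d‖ * ‖d‖ := abs_real_inner_le_norm _ _
      _ ≤ M / 2 * (s * ‖d‖) ^ 2 * ‖d‖ := by gcongr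
      _ = _ := by ring
  refine ⟨?_, hgrad, hM, ?_⟩
  · intro x y
    set d := y - x with hd
    have hy : x + d = y := by rw [hd]; abel
    have hder : ∀ s, HasDerivAt
        (fun s => f (x + s • d) - s * inner ℝ (f' x) d - s ^ 2 / 2 * inner ℝ (f'' x d) d)
        (inner ℝ (f' (x + s • d) - f' x - s • f'' x d) d) s := by
      intro s
      have h1 := ((hdf x d s).sub ((hasDerivAt_id s).mul_const (inner ℝ (f' x) d))).sub
        ((((hasDerivAt_pow 2 s).div_const 2)).mul_const (inner ℝ (f'' x d) d))
      refine h1.congr_deriv ?_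
      rw [inner_sub_left, inner_sub_left, real_inner_smul_left]
      norm_num
    have k1 := sub_le_of_hasDerivAt_le_pow 2 hder
      (fun s h0 _ => (le_abs_self _).trans (hinner x d s h0))
    have k2 := sub_le_of_hasDerivAt_le_pow 2 (fun s => (hder s).neg)
      (fun s h0 _ => (neg_le_abs _).trans (hinner x d s h0))
    simp only [one_smul, hy, zero_smul, add_zero, Pi.neg_apply] at k1 k2
    rw [abs_le]
    norm_num at k1 k2
    constructor <;> linarith
  · intro x y
    set d := y - x with hd
    have hy : x + d = y := by rw [hd]; abel
    -- The derivative in `s` is half the first-order remainder of the slopes, expanded at `x + s •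
    -- d` and evaluated back at `x`; hence `-d` in `hinner`. Integrating `M / 4 * s ^ 2` gives `M /
    -- 12`.
    have k1 := sub_le_of_hasDerivAt_le_pow (c := M / 4 * ‖d‖ ^ 3) 2
      (F := fun s => f (x + s • d) - s * (inner ℝ (f' x) d + inner ℝ (f' (x + s • d)) d) / 2)
      (F' := fun s => inner ℝ (f' (x + s • d)) d -
        (1 * (inner ℝ (f' x) d + inner ℝ (f' (x + s • d)) d) +
          s * inner ℝ (f'' (x + s • d) d) d) / 2)
      (fun s => by
        have h1 := (hdf' x d s).inner ℝ (hasDerivAt_const s d)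
        simp only [inner_zero_right, zero_add] at h1
        exact (hdf x d s).sub
          (((hasDerivAt_id s).mul (h1.const_add (inner ℝ (f' x) d))).div_const 2))
      (fun s hs _ => by
        have h1 := hinner (x + s • d) (-d) s hs
        rw [smul_neg, add_neg_cancel_right, norm_neg, map_neg, smul_neg, inner_neg_right,
          abs_neg, sub_neg_eq_add, inner_add_left, inner_sub_left, real_inner_smul_left] at h1
        have := (abs_le.1 h1).1
        linarith)
    simp only [one_smul, hy, zero_smul, add_zero] at k1
    rw [inner_add_left]
    norm_num at k1
    linarith

/-- Comparison through an intermediate point of the segment. -/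
theorem LipschitzHessian.value_midpoint {M : ℝ} {f : E → ℝ} {f' : E → E}
    {f'' : E → E →L[ℝ] E} (h : LipschitzHessian M f f' f'') (x y : E) {s : ℝ}
    (hs0 : 0 ≤ s) (hs1 : s ≤ 1) :
    (f y - f x - inner ℝ (f' x) (y - x) - inner ℝ (f'' x (y - x)) (y - x) / 2)
      - s * inner ℝ (f' y - f' x - f'' x (y - x)) (y - x)
      + s ^ 2 / 2 * inner ℝ ((f'' y - f'' x) (y - x)) (y - x)
      ≤ M * ‖y - x‖ ^ 3 * ((1 - s) ^ 3 + s ^ 3) / 6 := by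
  set d := y - x with hd
  have hy : y = x + d := by rw [hd]; abel
  -- The value at the intermediate point is bounded above by the expansion at `x` and below by the
  -- expansion at `y`.
  have h1 := (abs_le.1 (h.value x (x + (1 - s) • d))).2
  have h2 := (abs_le.1 (h.value y (x + (1 - s) • d))).1
  have e1 : x + (1 - s) • d - x = (1 - s) • d := by abel
  have e2 : x + (1 - s) • d - y = -(s • d) := by rw [hy, sub_smul, one_smul]; abel
  rw [e1, norm_smul, Real.norm_of_nonneg (by linarith), map_smul, real_inner_smul_right,
    real_inner_smul_right, real_inner_smul_left] at h1
  rw [e2, norm_neg, norm_smul, Real.norm_of_nonneg hs0, map_neg, map_smul, inner_neg_right,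
    inner_neg_right, inner_neg_left, real_inner_smul_right, real_inner_smul_right,
    real_inner_smul_left] at h2
  simp only [inner_sub_left, _root_.sub_apply]
  nlinarith

/-- Serves at the last iterate, where no further model exists: half a step back is judged by the
true function instead. The constant is `(M / 6) * (1 / 2) ^ 3`. -/
theorem LipschitzHessian.value_half {M : ℝ} {f : E → ℝ} {f' : E → E}
    {f'' : E → E →L[ℝ] E} (h : LipschitzHessian M f f' f'') (x d : E) :
    inner ℝ (f' x) d / 2 - inner ℝ (f'' x d) d / 8 - M / 48 * ‖d‖ ^ 3
      ≤ f x - f (x - (1 / 2 : ℝ) • d) := by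
  have h1 := (abs_le.1 (h.value x (x - (1 / 2 : ℝ) • d))).2
  rw [sub_sub_cancel_left, norm_neg, norm_smul, map_neg, map_smul, inner_neg_right,
    inner_neg_right, inner_neg_left, real_inner_smul_right, real_inner_smul_right,
    real_inner_smul_left] at h1
  norm_num at h1
  nlinarith

end Taylor

/-! ### Optimality conditions of the trust region problem -/

section TrustRegionOptimality

variable {E : Type*} [NormedAddCommGroup E] [InnerProductSpace ℝ E]

theorem nonneg_of_forall_pos_add_mul {a b c : ℝ} {δ₀ : ℝ} (hδ₀ : 0 < δ₀)
    (h : ∀ δ, 0 < δ → δ < δ₀ → 0 ≤ a + b * δ + c * δ ^ 2) : 0 ≤ a := by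
  have ht : Tendsto (fun δ : ℝ => a + b * δ + c * δ ^ 2) (𝓝[>] 0) (𝓝 (a + b * 0 + c * 0 ^ 2)) :=
    Tendsto.mono_left (Continuous.tendsto (by fun_prop) 0) nhdsWithin_le_nhds
  have := ge_of_tendsto ht (by
    filter_upwards [Ioo_mem_nhdsGT hδ₀] with δ hδ using h δ hδ.1 hδ.2)
  simpa using this

/-- Necessary optimality conditions for the trust region problem on a subspace. -/
theorem exists_multiplier {S : Submodule ℝ E} {H : E →L[ℝ] E} {g x : E} {Δ : ℝ} (hΔ : 0 < Δ)
    (hH : ∀ y z, inner ℝ (H y) z = inner ℝ y (H z)) (hxS : x ∈ S) (hx : ‖x‖ ≤ Δ)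
    (hmin : ∀ y ∈ S, ‖y‖ ≤ Δ →
      inner ℝ g x + inner ℝ x (H x) / 2 ≤ inner ℝ g y + inner ℝ y (H y) / 2) :
    ∃ lam : ℝ, 0 ≤ lam ∧ lam * (Δ - ‖x‖) = 0 ∧
      (∀ y ∈ S, inner ℝ (g + H x) y = -lam * inner ℝ x y) ∧
      ∀ y ∈ S, 0 ≤ inner ℝ y (H y) + lam * ‖y‖ ^ 2 := by
  have hexp : ∀ (v : E) (t : ℝ), inner ℝ g (x + t • v) + inner ℝ (x + t • v) (H (x + t • v)) / 2
      = inner ℝ g x + inner ℝ x (H x) / 2 + t * inner ℝ (g + H x) v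
        + t ^ 2 * (inner ℝ v (H v) / 2) := by
    intro v t
    have h1 : inner ℝ v (H x) = inner ℝ x (H v) := by rw [real_inner_comm, hH]
    have h2 := hH x v
    simp only [map_add, map_smul, inner_add_left, inner_add_right, real_inner_smul_left,
      real_inner_smul_right]
    rw [h1, h2]
    ring
  have hdir : ∀ v ∈ S, ∀ t₀ : ℝ, 0 < t₀ → (∀ t : ℝ, 0 < t → t < t₀ → ‖x + t • v‖ ≤ Δ) →
      0 ≤ inner ℝ (g + H x) v := by
    intro v hv t₀ ht₀ hfeas
    refine nonneg_of_forall_pos_add_mul (b := inner ℝ v (H v) / 2) (c := 0) ht₀ fun t h0 h1 => ?_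
    have := hmin _ (S.add_mem hxS (S.smul_mem t hv)) (hfeas t h0 h1)
    rw [hexp] at this
    have h2 : 0 ≤ t * (inner ℝ (g + H x) v + inner ℝ v (H v) / 2 * t + 0 * t ^ 2) := by nlinarith
    exact nonneg_of_mul_nonneg_right h2 h0
  -- In the interior every direction and its opposite are feasible, so the multiplier is zero.
  rcases hx.lt_or_eq with hlt | heq
  · have hfe : ∀ v : E, ∃ t₀ > 0, ∀ t : ℝ, 0 < t → t < t₀ → ‖x + t • v‖ ≤ Δ := by
      intro v
      refine ⟨(Δ - ‖x‖) / (‖v‖ + 1), div_pos (by linarith) (by positivity), fun t h0 h1 => ?_⟩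
      rw [lt_div_iff₀ (by positivity)] at h1
      calc ‖x + t • v‖ ≤ ‖x‖ + ‖t • v‖ := norm_add_le _ _
        _ = ‖x‖ + t * ‖v‖ := by rw [norm_smul, Real.norm_of_nonneg h0.le]
        _ ≤ Δ := by nlinarith
    have hD : ∀ v ∈ S, inner ℝ (g + H x) v = 0 := by
      intro v hv
      obtain ⟨t₀, ht₀, h⟩ := hfe v
      obtain ⟨t₁, ht₁, h'⟩ := hfe (-v)
      have a1 := hdir v hv t₀ ht₀ h
      have a2 := hdir (-v) (S.neg_mem hv) t₁ ht₁ h'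
      rw [inner_neg_right] at a2
      linarith
    refine ⟨0, le_rfl, by simp, fun y hy => by rw [hD y hy]; simp, fun y hy => ?_⟩
    obtain ⟨t₀, ht₀, h⟩ := hfe y
    have hm := hmin _ (S.add_mem hxS (S.smul_mem (t₀ / 2) hy)) (h _ (by linarith) (by linarith))
    rw [hexp, hD y hy] at hm
    have h2 : 0 ≤ (t₀ / 2) ^ 2 * (inner ℝ y (H y) / 2) := by linarith
    have := nonneg_of_mul_nonneg_right h2 (by positivity)
    linarith
  · have hx2 : 0 < ‖x‖ ^ 2 := by rw [heq]; positivity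
    have hx0 : ‖x‖ ≠ 0 := by rw [heq]; exact hΔ.ne'
    have hD1 : ∀ v ∈ S, inner ℝ x v < 0 → 0 ≤ inner ℝ (g + H x) v := by
      intro v hv hneg
      have hv0 : 0 < ‖v‖ ^ 2 := by
        have : v ≠ 0 := fun h => by rw [h, inner_zero_right] at hneg; exact lt_irrefl _ hneg
        positivity
      -- The bound on `t` is the parameter at which the ray from `x` in the inward direction `v`
      -- meets the sphere again.
      refine hdir v hv (-2 * inner ℝ x v / ‖v‖ ^ 2) (div_pos (by linarith) hv0) fun t h0 h1 => ?_
      rw [lt_div_iff₀ hv0] at h1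
      rw [← heq]
      apply le_of_sq_le_sq _ (norm_nonneg _)
      rw [norm_add_sq_real, norm_smul, Real.norm_of_nonneg h0.le, real_inner_smul_right]
      nlinarith
    have hD2 : ∀ v ∈ S, inner ℝ x v ≤ 0 → 0 ≤ inner ℝ (g + H x) v := by
      intro v hv hle
      refine nonneg_of_forall_pos_add_mul (b := -inner ℝ (g + H x) x) (c := 0) one_pos
        fun δ h0 _ => ?_
      have := hD1 (v - δ • x) (S.sub_mem hv (S.smul_mem _ hxS)) (by
        rw [inner_sub_right, real_inner_smul_right, real_inner_self_eq_norm_sq]; nlinarith)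
      rw [inner_sub_right, real_inner_smul_right] at this
      linarith
    have hD0 : ∀ v ∈ S, inner ℝ x v = 0 → inner ℝ (g + H x) v = 0 := by
      intro v hv h0
      have a1 := hD2 v hv h0.le
      have a2 := hD2 (-v) (S.neg_mem hv) (by rw [inner_neg_right, h0, neg_zero])
      rw [inner_neg_right] at a2
      linarith
    set lam := -inner ℝ (g + H x) x / ‖x‖ ^ 2 with hlam
    have hlamx : inner ℝ (g + H x) x = -lam * ‖x‖ ^ 2 := by
      rw [hlam, neg_div, neg_neg, div_mul_cancel₀ _ hx2.ne']
    have hlam0 : 0 ≤ lam := by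
      have := hD1 (-x) (S.neg_mem hxS) (by
        rw [inner_neg_right, real_inner_self_eq_norm_sq]; linarith)
      rw [inner_neg_right] at this
      exact div_nonneg this hx2.le
    have hstat : ∀ y ∈ S, inner ℝ (g + H x) y = -lam * inner ℝ x y := by
      intro y hy
      have := hD0 (y - (inner ℝ x y / ‖x‖ ^ 2) • x) (S.sub_mem hy (S.smul_mem _ hxS)) (by
        rw [inner_sub_right, real_inner_smul_right, real_inner_self_eq_norm_sq]
        rw [div_mul_cancel₀ _ hx2.ne', sub_self])
      rw [inner_sub_right, real_inner_smul_right, hlamx] at this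
      have h3 : inner ℝ x y / ‖x‖ ^ 2 * (-lam * ‖x‖ ^ 2) = -lam * inner ℝ x y := by field_simp
      linarith
    -- A line through `x` that is not tangent to the sphere meets it in a second point `x + t • v`.
    -- Comparing the model there, the first-order term becomes `lam * t ^ 2 * ‖v‖ ^ 2 / 2`, so the
    -- curvature inequality comes out without error.
    have hpsd : ∀ v ∈ S, inner ℝ x v ≠ 0 → 0 ≤ inner ℝ v (H v) + lam * ‖v‖ ^ 2 := by
      intro v hv hne
      have hv0 : 0 < ‖v‖ ^ 2 := by
        have : v ≠ 0 := fun h => hne (by rw [h, inner_zero_right])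
        positivity
      set t := -2 * inner ℝ x v / ‖v‖ ^ 2 with ht
      have htv : t * ‖v‖ ^ 2 = -2 * inner ℝ x v := by rw [ht, div_mul_cancel₀ _ hv0.ne']
      have ht0 : 0 < t ^ 2 := by
        have : t ≠ 0 := div_ne_zero (by simpa using hne) hv0.ne'
        positivity
      have hn : ‖x + t • v‖ ≤ Δ := by
        rw [← heq]
        apply le_of_sq_le_sq _ (norm_nonneg _)
        rw [norm_add_sq_real, norm_smul, real_inner_smul_right, mul_pow, Real.norm_eq_abs, sq_abs]
        linarith [congrArg (t * ·) htv]
      have hm := hmin _ (S.add_mem hxS (S.smul_mem t hv)) hn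
      rw [hexp, hstat v hv] at hm
      have h2 : 0 ≤ t ^ 2 * (inner ℝ v (H v) + lam * ‖v‖ ^ 2) := by
        have : t * (-lam * inner ℝ x v) = t ^ 2 * (lam * ‖v‖ ^ 2) / 2 := by
          linear_combination (-lam * t / 2) * htv
        nlinarith
      exact nonneg_of_mul_nonneg_right h2 ht0
    refine ⟨lam, hlam0, by rw [heq]; simp, hstat, fun v hv => ?_⟩
    by_cases h0 : inner ℝ x v = 0
    -- Tangent directions are limits of the non-tangent directions `v + δ • x`.
    · refine nonneg_of_forall_pos_add_mul (b := 2 * inner ℝ x (H v))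
        (c := inner ℝ x (H x) + lam * ‖x‖ ^ 2) one_pos fun δ hδ _ => ?_
      have := hpsd (v + δ • x) (S.add_mem hv (S.smul_mem _ hxS)) (by
        rw [inner_add_right, real_inner_smul_right, h0, real_inner_self_eq_norm_sq]
        positivity)
      have h1 : inner ℝ v (H x) = inner ℝ x (H v) := by rw [real_inner_comm, hH]
      rw [norm_add_sq_real, norm_smul, real_inner_smul_right, real_inner_comm x v, h0, map_add,
        map_smul, mul_pow, Real.norm_eq_abs, sq_abs] at this
      simp only [inner_add_left, inner_add_right, real_inner_smul_left,
        real_inner_smul_right] at this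
      rw [h1] at this
      nlinarith
    · exact hpsd v hv h0

end TrustRegionOptimality

end OneStep

/-! ### Summation along a deterministic path of trust region steps -/

section PathSums

section Pathwise

variable {E : Type*} [NormedAddCommGroup E] [InnerProductSpace ℝ E]

/-- A step `x` of a trust region method of radius `2` on the subspace `S`, with multiplier `lam`. -/
structure TrustRegionStep (S : Submodule ℝ E) (g : E) (H : E →L[ℝ] E) (x : E) (lam : ℝ) : Prop where
  symm : ∀ y z, inner ℝ (H y) z = inner ℝ y (H z)
  g_mem : g ∈ S
  x_mem : x ∈ S
  norm_le : ‖x‖ ≤ 2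
  lam_nonneg : 0 ≤ lam
  compl : lam * (2 - ‖x‖) = 0
  stat : ∀ y ∈ S, inner ℝ (g + H x) y = -lam * inner ℝ x y
  psd : ∀ y ∈ S, 0 ≤ inner ℝ y (H y) + lam * ‖y‖ ^ 2

namespace TrustRegionStep

variable {S : Submodule ℝ E} {g x : E} {H : E →L[ℝ] E} {lam : ℝ}

/-- By complementarity a nonzero multiplier forces the full length 2. -/
theorem lam_mul_sq (h : TrustRegionStep S g H x lam) : lam * ‖x‖ ^ 2 = 4 * lam := by
  linear_combination (-(2 + ‖x‖)) * h.compl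

theorem inner_g_x (h : TrustRegionStep S g H x lam) :
    inner ℝ g x = -inner ℝ x (H x) - 4 * lam := by
  have h1 := h.stat x h.x_mem
  rw [inner_add_left, real_inner_self_eq_norm_sq, neg_mul, h.lam_mul_sq, h.symm] at h1
  linarith

theorem curvature_nonneg (h : TrustRegionStep S g H x lam) : 0 ≤ inner ℝ x (H x) + 4 * lam := by
  have h1 := h.psd x h.x_mem
  rwa [h.lam_mul_sq] at h1

/-- The part of the model decrease that a step of half the radius can account for. -/
theorem model_le (h : TrustRegionStep S g H x lam) {y : E} (hy : y ∈ S) (hy1 : ‖y‖ ≤ 1) :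
    -inner ℝ g y - inner ℝ y (H y) / 2 ≤ inner ℝ x (H x) / 2 + 5 / 2 * lam := by
  -- Expanding the curvature at `y - x` and removing the mixed terms by stationarity leaves the
  -- model at `y`. The constant 5/2 is `(4 + 1) / 2`, from `‖x‖ ^ 2` and `‖y‖ ^ 2` weighted by
  -- `lam`.
  have h1 := h.psd (y - x) (S.sub_mem hy h.x_mem)
  have h2 := h.stat y hy
  have h3 : inner ℝ (H x) y = inner ℝ x (H y) := h.symm x y
  have h4 : inner ℝ y (H x) = inner ℝ x (H y) := by rw [real_inner_comm, h3]
  rw [inner_add_left, h3] at h2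
  rw [norm_sub_sq_real, map_sub, inner_sub_left, inner_sub_right, inner_sub_right, h4,
    mul_add, mul_sub, h.lam_mul_sq, real_inner_comm x y] at h1
  have h5 : lam * ‖y‖ ^ 2 ≤ lam :=
    mul_le_of_le_one_right h.lam_nonneg (pow_le_one₀ (norm_nonneg _) hy1)
  linarith

end TrustRegionStep

variable {f : E → ℝ} {f' : E → E} {f'' : E → E →L[ℝ] E} {S : Submodule ℝ E}
  {g x θ : E} {H : E →L[ℝ] E} {lam C : ℝ}

theorem noise_bounds (x v : E) (B : E →L[ℝ] E) :
    |inner ℝ v x| ≤ ‖x‖ * ‖v‖ ∧ |inner ℝ x (B x)| ≤ ‖x‖ ^ 2 * ‖B‖ := by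
  constructor
  · rw [mul_comm]; exact abs_real_inner_le_norm _ _
  · calc |inner ℝ x (B x)| ≤ ‖x‖ * ‖B x‖ := abs_real_inner_le_norm _ _
      _ ≤ ‖x‖ * (‖B‖ * ‖x‖) := by gcongr; exact B.le_opNorm x
      _ = _ := by ring

/-- The model decreases by `⟪x, H x⟫ / 2 + 4 * lam`, which is at least `2 * lam` by
`curvature_nonneg`. The constant 4/3 is the cubic remainder at length 2. -/
theorem TrustRegionStep.value_le (hf : LipschitzHessian 1 f f' f'')
    (h : TrustRegionStep S g H x lam) :
    f (θ + x) ≤ f θ - 2 * lam + (4 / 3 + 2 * ‖f' θ - g‖ + 2 * ‖f'' θ - H‖) := by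
  have h1 := (abs_le.1 (hf.value θ (θ + x))).2
  obtain ⟨hu, hv⟩ := noise_bounds x (f' θ - g) (f'' θ - H)
  have hu' := (le_abs_self _).trans hu
  have hv' := (le_abs_self _).trans hv
  have hx := h.norm_le
  have hx0 := norm_nonneg x
  rw [add_sub_cancel_left, real_inner_comm x (f'' θ x)] at h1
  rw [inner_sub_left, h.inner_g_x] at hu'
  rw [_root_.sub_apply, inner_sub_right] at hv'
  have hx3 : ‖x‖ ^ 3 ≤ 8 := by nlinarith [mul_nonneg hx0 hx0]
  have hx2 : ‖x‖ ^ 2 ≤ 4 := by nlinarith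
  have h2 : ‖x‖ * ‖f' θ - g‖ ≤ 2 * ‖f' θ - g‖ := by gcongr
  have h3 : ‖x‖ ^ 2 * ‖f'' θ - H‖ ≤ 4 * ‖f'' θ - H‖ := by gcongr
  linarith [h.curvature_nonneg]

/-- One step of the potential `f - ψ`: its decrease pays for the new gradient. The hypothesis
`hnext` states the credit available at the new point, namely the full cap or what the half step back
along `x` earns. -/
theorem TrustRegionStep.potential_le [FiniteDimensional ℝ E] (hf : LipschitzHessian 1 f f' f'')
    (h : TrustRegionStep S g H x lam) (hC0 : 0 ≤ C)
    (hC : ‖(f'' θ - S.starProjection ∘L f'' θ ∘L S.starProjection) x‖ ≤ C * ‖x‖ ^ 2)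
    {ψ ψ' b : ℝ} (hψ1 : ψ ≤ inner ℝ x (H x) / 2 + 5 / 2 * lam) (hψ2 : ψ ≤ 4 / 5)
    (hψ' : 0 ≤ ψ') (hb : 0 ≤ b)
    (hnext : 4 / 5 ≤ ψ' ∨
      inner ℝ (f' (θ + x)) x / 2 - inner ℝ (f'' (θ + x) x) x / 8 - b ≤ ψ') :
    ‖f' (θ + x)‖ + (f (θ + x) - ψ') ≤ 38 / 15 + 4 * C + (f θ - ψ) +
      (3 * ‖f' θ - g‖ + 4 * ‖f'' θ - H‖) + b := by
  set A := f'' θ with hA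
  set r := f' (θ + x) - f' θ - A x with hr
  have hx := h.norm_le
  have hx0 := norm_nonneg x
  have hPx : S.starProjection x = x := Submodule.starProjection_eq_self_iff.2 h.x_mem
  have hPg : S.starProjection g = g := Submodule.starProjection_eq_self_iff.2 h.g_mem
  have hPH : S.starProjection (H x) = -g - lam • x := by
    have h0 : S.starProjection (g + H x + lam • x) = 0 := by
      rw [Submodule.starProjection_apply_eq_zero_iff, Submodule.mem_orthogonal']
      intro y hy
      rw [inner_add_left, h.stat y hy, real_inner_smul_left]
      ring
    rw [map_add, map_add, map_smul, hPx, hPg] at h0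
    rw [← sub_eq_zero, ← h0]
    abel
  have hgrad : ‖f' (θ + x)‖ ≤ ‖r - lam • x‖ + ‖f' θ - g‖ + 2 * ‖A - H‖ + 4 * C := by
    -- Taylor remainder with multiplier, gradient noise, Hessian noise in the plane, and the
    -- out-of-plane part bounded through `C`. Stationarity enters by replacing the projection of `H
    -- x`.
    have hdec : f' (θ + x) = (r - lam • x) + (f' θ - g) + S.starProjection ((A - H) x)
        + (A - S.starProjection ∘L A ∘L S.starProjection) x := by
      simp only [_root_.sub_apply, map_sub, ContinuousLinearMap.comp_apply, hPx, hPH, hr]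
      abel
    have h1 : ‖S.starProjection ((A - H) x)‖ ≤ 2 * ‖A - H‖ :=
      calc _ ≤ ‖(A - H) x‖ := Submodule.norm_starProjection_apply_le _ _
        _ ≤ ‖A - H‖ * ‖x‖ := (A - H).le_opNorm x
        _ ≤ ‖A - H‖ * 2 := by gcongr
        _ = _ := mul_comm _ _
    have h2 : C * ‖x‖ ^ 2 ≤ 4 * C := by
      have : ‖x‖ ^ 2 ≤ 4 := by nlinarith
      nlinarith
    rw [hdec]
    refine (norm_add_le _ _).trans ?_
    refine add_le_add ((norm_add_le _ _).trans (add_le_add (norm_add_le _ _) h1)) (hC.trans h2)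
  have hG : ‖r - lam • x‖ ^ 2 ≤ (‖x‖ ^ 2 / 2) ^ 2 - 2 * lam * inner ℝ r x + lam ^ 2 * ‖x‖ ^ 2 := by
    have hrn : ‖r‖ ≤ ‖x‖ ^ 2 / 2 := by
      have := hf.grad θ (θ + x)
      rw [add_sub_cancel_left] at this
      linarith
    have : ‖r‖ ^ 2 ≤ (‖x‖ ^ 2 / 2) ^ 2 := by gcongr
    rw [norm_sub_sq_real, real_inner_smul_right, norm_smul, mul_pow, Real.norm_eq_abs, sq_abs]
    linarith
  obtain ⟨hu, hv⟩ := noise_bounds x (f' θ - g) (A - H)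
  have hval := (abs_le.1 (hf.value θ (θ + x))).2
  have htrap := hf.trapezoid θ (θ + x)
  have hmid := fun s hs0 hs1 => hf.value_midpoint (s := s) θ (θ + x) hs0 hs1
  have hhess := hf.hess θ (θ + x)
  rw [add_sub_cancel_left] at hval htrap hhess
  simp only [add_sub_cancel_left] at hmid
  rw [← hA] at hval hhess hmid
  set u := inner ℝ (f' θ - g) x with hu_def
  set v := inner ℝ x ((A - H) x) with hv_def
  set δ := inner ℝ ((f'' (θ + x) - A) x) x with hδ_def
  set e := f (θ + x) - f θ - inner ℝ (f' θ) x - inner ℝ (A x) x / 2 with he_def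
  set η := inner ℝ x (H x) with hη_def
  have hAx : inner ℝ (A x) x = η + v := by
    rw [hv_def, hη_def, _root_.sub_apply, inner_sub_right, real_inner_comm]; ring
  have hpx : inner ℝ (f' θ) x = u - η - 4 * lam := by
    rw [hu_def, inner_sub_left, h.inner_g_x]; ring
  have hp'x : inner ℝ (f' (θ + x)) x = inner ℝ r x + u + v - 4 * lam := by
    have : inner ℝ r x = inner ℝ (f' (θ + x)) x - inner ℝ (f' θ) x - inner ℝ (A x) x := by
      rw [hr, inner_sub_left, inner_sub_left]
    rw [hpx, hAx] at this
    linarith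
  have hA'x : inner ℝ (f'' (θ + x) x) x = η + v + δ := by
    rw [hδ_def, _root_.sub_apply, inner_sub_left, hAx]; ring
  have hδ : |δ| ≤ ‖x‖ ^ 3 :=
    calc |δ| ≤ ‖(f'' (θ + x) - A) x‖ * ‖x‖ := abs_real_inner_le_norm _ _
      _ ≤ (1 * ‖x‖ * ‖x‖) * ‖x‖ := by
          gcongr; exact ContinuousLinearMap.le_of_opNorm_le _ hhess _
      _ = _ := by ring
  rw [hp'x, hA'x] at hnext
  rw [inner_add_left, hp'x, hpx] at htrap
  have key := one_step_real (e := e) (ρ := inner ℝ r x) (δ := δ) (G := ‖r - lam • x‖) hx0 hx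
    h.lam_nonneg h.compl (by rw [h.lam_mul_sq]; exact h.curvature_nonneg) hG (by linarith)
    (by rw [he_def, hpx, hAx]; linarith)
    (fun s hs0 hs1 => by have := hmid s hs0 hs1; rw [one_mul] at this; exact this)
    hδ hu hv (norm_nonneg _) (norm_nonneg _) hψ1 hψ2 hψ' hb hnext
  have hfe : f (θ + x) - f θ = -(η / 2 + 4 * lam) + u + v / 2 + e := by
    rw [he_def, hpx, hAx]; ring
  linarith

/-- Sum of the gradient norms along a path of trust region steps. -/
theorem sum_norm_grad_le [FiniteDimensional ℝ E] (hf : LipschitzHessian 1 f f' f'') {fstar : ℝ}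
    (hstar : ∀ y, fstar ≤ f y) {T : ℕ} {θ : ℕ → E} {S : ℕ → Submodule ℝ E} {g : ℕ → E}
    {H : ℕ → E →L[ℝ] E} {lam : ℕ → ℝ} {C : ℝ} (hC0 : 0 ≤ C)
    (hstep : ∀ t < T, TrustRegionStep (S t) (g t) (H t) (θ (t + 1) - θ t) (lam t))
    (hprev : ∀ t, t + 1 < T → θ (t + 1) - θ t ∈ S (t + 1))
    (hC : ∀ t < T, ‖(f'' (θ t) - (S t).starProjection ∘L f'' (θ t) ∘L (S t).starProjection)
      (θ (t + 1) - θ t)‖ ≤ C * ‖θ (t + 1) - θ t‖ ^ 2) :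
    ∑ t ∈ Finset.range T, ‖f' (θ (t + 1))‖ ≤ T * (38 / 15 + 4 * C) + (f (θ 0) - fstar) +
      ∑ t ∈ Finset.range T, ((3 * ‖f' (θ t) - g t‖ + 4 * ‖f'' (θ t) - H t‖) +
        if t + 1 < T then ‖f' (θ (t + 1)) - g (t + 1)‖ + ‖f'' (θ (t + 1)) - H (t + 1)‖ / 2
        else 1 / 6) := by
  -- By `model_le`, `μ t` bounds the gain of any model displacement of length at most 1. Beyond the
  -- last step, the whole remaining gap takes its place, without a cap.
  set μ : ℕ → ℝ := fun t => inner ℝ (θ (t + 1) - θ t) (H t (θ (t + 1) - θ t)) / 2 + 5 / 2 * lam t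
    with hμ
  set ψ : ℕ → ℝ := fun t => if t < T then min (μ t) (4 / 5) else f (θ t) - fstar with hψ
  have hμ0 : ∀ t < T, 0 ≤ μ t := fun t ht => by
    have h1 := (hstep t ht).curvature_nonneg
    have h2 := (hstep t ht).lam_nonneg
    simp only [hμ]
    linarith
  have hψ0 : ∀ t, 0 ≤ ψ t := by
    intro t
    simp only [hψ]
    split_ifs with ht
    · exact le_min (hμ0 t ht) (by norm_num)
    · linarith [hstar (θ t)]
  have hone : ∀ t ∈ Finset.range T, ‖f' (θ (t + 1))‖ ≤ (38 / 15 + 4 * C) +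
      ((f (θ t) - ψ t) - (f (θ (t + 1)) - ψ (t + 1))) +
      ((3 * ‖f' (θ t) - g t‖ + 4 * ‖f'' (θ t) - H t‖) +
        if t + 1 < T then ‖f' (θ (t + 1)) - g (t + 1)‖ + ‖f'' (θ (t + 1)) - H (t + 1)‖ / 2
        else 1 / 6) := by
    intro t ht
    rw [Finset.mem_range] at ht
    have hst := hstep t ht
    set x := θ (t + 1) - θ t with hx
    have hθ : θ t + x = θ (t + 1) := by rw [hx]; abel
    have hψt : ψ t = min (μ t) (4 / 5) := by simp only [hψ, if_pos ht]
    have key := hst.potential_le (θ := θ t) (ψ := ψ t) (ψ' := ψ (t + 1))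
      (b := if t + 1 < T then ‖f' (θ (t + 1)) - g (t + 1)‖ + ‖f'' (θ (t + 1)) - H (t + 1)‖ / 2
        else 1 / 6) hf hC0 (hC t ht) (by rw [hψt]; exact min_le_left _ _)
      (by rw [hψt]; exact min_le_right _ _) (hψ0 _) (by split_ifs <;> positivity) (by
        rw [hθ]
        by_cases ht' : t + 1 < T
        · rw [if_pos ht']
          have hψt' : ψ (t + 1) = min (μ (t + 1)) (4 / 5) := by simp only [hψ, if_pos ht']
          rcases le_total (4 / 5) (μ (t + 1)) with h1 | h1
          · left; rw [hψt', min_eq_right h1]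
          · right
            rw [hψt', min_eq_left h1]
            have hxn := hst.norm_le
            -- Here the momentum direction matters: the previous displacement lies in the next
            -- plane, so half a step back is a competitor of length at most 1.
            have h2 := (hstep (t + 1) ht').model_le (y := -((1 / 2 : ℝ) • x))
              ((S (t + 1)).neg_mem ((S (t + 1)).smul_mem _ (hprev t ht')))
              (by rw [norm_neg, norm_smul]; norm_num; linarith)
            rw [map_neg, map_smul, inner_neg_right, inner_neg_right, inner_neg_left,
              real_inner_smul_right, real_inner_smul_right, real_inner_smul_left] at h2
            obtain ⟨hu, hv⟩ := noise_bounds x (f' (θ (t + 1)) - g (t + 1))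
              (f'' (θ (t + 1)) - H (t + 1))
            have hu' := (le_abs_self _).trans hu
            have hv' := (neg_le_abs _).trans hv
            rw [inner_sub_left] at hu'
            rw [_root_.sub_apply, inner_sub_right, real_inner_comm (f'' (θ (t + 1)) x) x] at hv'
            have hx2 : ‖x‖ ^ 2 ≤ 4 := by nlinarith [norm_nonneg x]
            have h3 : ‖x‖ * ‖f' (θ (t + 1)) - g (t + 1)‖ ≤ 2 * ‖f' (θ (t + 1)) - g (t + 1)‖ := by
              gcongr
            have h4 : ‖x‖ ^ 2 * ‖f'' (θ (t + 1)) - H (t + 1)‖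
                ≤ 4 * ‖f'' (θ (t + 1)) - H (t + 1)‖ := by gcongr
            refine le_trans ?_ (h2 : _ ≤ μ (t + 1))
            linarith
        · right
          rw [if_neg ht']
          have hψt' : ψ (t + 1) = f (θ (t + 1)) - fstar := by simp only [hψ, if_neg ht']
          -- The error `‖x‖ ^ 3 / 48` is at most 1/6, the value of `b` at the last index.
          have h1 := hf.value_half (θ (t + 1)) x
          have h2 := hstar (θ (t + 1) - (1 / 2 : ℝ) • x)
          have hx3 : ‖x‖ ^ 3 ≤ 8 := by
            have := hst.norm_le
            have h0 := norm_nonneg x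
            nlinarith [mul_nonneg h0 h0]
          rw [hψt']
          linarith)
    rw [hθ] at key
    linarith
  have hsum := Finset.sum_le_sum hone
  rw [Finset.sum_add_distrib, Finset.sum_add_distrib,
    Finset.sum_range_sub' (fun t => f (θ t) - ψ t), Finset.sum_const, Finset.card_range,
    nsmul_eq_mul] at hsum
  -- With this choice the final potential is exactly `fstar`, so the telescoped sum contains only
  -- the initial gap.
  have hψT : ψ T = f (θ T) - fstar := by simp only [hψ, lt_irrefl, if_false]
  rw [hψT] at hsum
  linarith [hψ0 0]

/-- The final value stays on the left because the curvature bound at the last iterate contains the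
gap at `θ T`, and the two cancel. -/
theorem sum_multiplier_le (hf : LipschitzHessian 1 f f' f'') {T : ℕ} {θ : ℕ → E}
    {S : ℕ → Submodule ℝ E} {g : ℕ → E} {H : ℕ → E →L[ℝ] E} {lam : ℕ → ℝ}
    (hstep : ∀ t < T, TrustRegionStep (S t) (g t) (H t) (θ (t + 1) - θ t) (lam t)) :
    ∑ t ∈ Finset.range T, 2 * lam t + f (θ T) ≤ f (θ 0) +
      ∑ t ∈ Finset.range T, (4 / 3 + 2 * ‖f' (θ t) - g t‖ + 2 * ‖f'' (θ t) - H t‖) := by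
  have hone : ∀ t ∈ Finset.range T, 2 * lam t ≤ (f (θ t) - f (θ (t + 1))) +
      (4 / 3 + 2 * ‖f' (θ t) - g t‖ + 2 * ‖f'' (θ t) - H t‖) := by
    intro t ht
    have := (hstep t (Finset.mem_range.1 ht)).value_le (θ := θ t) hf
    rw [add_sub_cancel] at this
    linarith
  have hsum := Finset.sum_le_sum hone
  rw [Finset.sum_add_distrib, Finset.sum_range_sub'] at hsum
  linarith

/-- A lower bound of the curvature at a point with a small optimality gap. -/
theorem neg_curvature_le (hf : LipschitzHessian 1 f f' f'') {fstar : ℝ} (hstar : ∀ y, fstar ≤ f y)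
    (θ : E) {w : E} (hw : ‖w‖ = 1) :
    -inner ℝ (f'' θ w) w ≤ 2 / 3 + (f θ - fstar) / 2 := by
  have hbase := hstar θ
  rcases le_or_gt (-inner ℝ (f'' θ w) w) 0 with h0 | h0
  · linarith
  set ν := -inner ℝ (f'' θ w) w with hν
  -- A step of length `2 * ν` in a non-ascending direction changes the value by at most `-2 * ν ^ 3
  -- + 8 / 6 * ν ^ 3`. Either `w` or `-w` is such a direction.
  have hdown : ∀ w : E, ‖w‖ = 1 → inner ℝ (f'' θ w) w = -ν → inner ℝ (f' θ) w ≤ 0 →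
      2 / 3 * ν ^ 3 ≤ f θ - fstar := by
    intro w hw h1 h2
    have h3 := (abs_le.1 (hf.value θ (θ + (2 * ν) • w))).2
    have h4 := hstar (θ + (2 * ν) • w)
    rw [add_sub_cancel_left, norm_smul, hw, map_smul, real_inner_smul_right, real_inner_smul_right,
      real_inner_smul_left, h1, Real.norm_of_nonneg (by linarith)] at h3
    nlinarith
  have h5 : 2 / 3 * ν ^ 3 ≤ f θ - fstar := by
    rcases le_total (inner ℝ (f' θ) w) 0 with h1 | h1
    · exact hdown w hw (by rw [hν, neg_neg]) h1
    · exact hdown (-w) (by rw [norm_neg, hw]) (by rw [map_neg, inner_neg_neg, hν, neg_neg])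
        (by rw [inner_neg_right]; linarith)
  -- The tangent of the cube at 1, `ν ^ 3 ≥ 3 * ν - 2`, makes the bound linear in `ν`.
  nlinarith [mul_nonneg (sq_nonneg (ν - 1)) (by linarith : 0 ≤ ν + 2)]

end Pathwise

end PathSums

/-! ### A matrix Khintchine inequality -/

section MatrixKhintchine

section Khintchine

variable {E : Type*} [NormedAddCommGroup E] [InnerProductSpace ℝ E] [FiniteDimensional ℝ E]

local notation "tr" => LinearMap.trace ℝ E

/-- A rearrangement inequality: `|x| ^ q - |y| ^ q` and `|x| ^ r - |y| ^ r` have the same sign. -/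
theorem pow_mul_pow_add_le (x y : ℝ) (q r : ℕ) (h : Even (q + r)) :
    x ^ q * y ^ r + x ^ r * y ^ q ≤ x ^ (q + r) + y ^ (q + r) := by
  rw [← h.pow_abs x, ← h.pow_abs y]
  have h1 : x ^ q * y ^ r ≤ |x| ^ q * |y| ^ r := by
    rw [← abs_pow, ← abs_pow, ← abs_mul]; exact le_abs_self _
  have h2 : x ^ r * y ^ q ≤ |x| ^ r * |y| ^ q := by
    rw [← abs_pow, ← abs_pow, ← abs_mul]; exact le_abs_self _
  have h3 : 0 ≤ (|x| ^ q - |y| ^ q) * (|x| ^ r - |y| ^ r) := by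
    rcases le_total (|x|) (|y|) with h | h
    · exact mul_nonneg_of_nonpos_of_nonpos
        (sub_nonpos.2 (pow_le_pow_left₀ (abs_nonneg _) h _))
        (sub_nonpos.2 (pow_le_pow_left₀ (abs_nonneg _) h _))
    · exact mul_nonneg (sub_nonneg.2 (pow_le_pow_left₀ (abs_nonneg _) h _))
        (sub_nonneg.2 (pow_le_pow_left₀ (abs_nonneg _) h _))
  rw [pow_add, pow_add]
  nlinarith

theorem exists_eigenbasis {X : Module.End ℝ E} (hX : X.IsSymmetric) :
    ∃ (u : OrthonormalBasis (Fin (Module.finrank ℝ E)) ℝ E) (s : Fin (Module.finrank ℝ E) → ℝ),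
      ∀ i, X (u i) = s i • u i :=
  ⟨hX.eigenvectorBasis rfl, hX.eigenvalues rfl, fun i => hX.apply_eigenvectorBasis rfl i⟩

section Eigen

variable {ι : Type*} [Fintype ι] {X : Module.End ℝ E} {u : OrthonormalBasis ι ℝ E} {s : ι → ℝ}

omit [FiniteDimensional ℝ E] in
theorem pow_apply_eigenbasis (hu : ∀ i, X (u i) = s i • u i) (q : ℕ) (i : ι) :
    (X ^ q) (u i) = s i ^ q • u i := by
  induction q with
  | zero => simp
  | succ q ih => rw [pow_succ', Module.End.mul_apply, ih, map_smul, hu, smul_smul, pow_succ]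

omit [FiniteDimensional ℝ E] in
theorem inner_pow_apply (hX : X.IsSymmetric) (hu : ∀ i, X (u i) = s i • u i) (q : ℕ) (w : E) :
    inner ℝ w ((X ^ q) w) = ∑ i, s i ^ q * inner ℝ (u i) w ^ 2 := by
  rw [← u.sum_inner_mul_inner]
  refine Finset.sum_congr rfl fun i _ => ?_
  rw [← (hX.pow q) (u i) w, pow_apply_eigenbasis hu, real_inner_smul_left, real_inner_comm]
  ring

omit [FiniteDimensional ℝ E] in
theorem trace_pow (hu : ∀ i, X (u i) = s i • u i) (q : ℕ) : tr (X ^ q) = ∑ i, s i ^ q := by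
  rw [LinearMap.trace_eq_sum_inner _ u]
  refine Finset.sum_congr rfl fun i _ => ?_
  rw [pow_apply_eigenbasis hu, real_inner_smul_right, real_inner_self_eq_norm_sq,
    u.orthonormal.1 i]
  ring

omit [FiniteDimensional ℝ E] in
theorem trace_sandwich {κ : Type*} [Fintype κ] {A Y : Module.End ℝ E} {v : OrthonormalBasis κ ℝ E}
    {y : κ → ℝ} (hA : A.IsSymmetric) (hX : X.IsSymmetric) (hu : ∀ i, X (u i) = s i • u i)
    (hv : ∀ j, Y (v j) = y j • v j) (q r : ℕ) :
    tr (A * X ^ q * A * Y ^ r) = ∑ j, ∑ i, s i ^ q * y j ^ r * inner ℝ (u i) (A (v j)) ^ 2 := by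
  rw [LinearMap.trace_eq_sum_inner _ v]
  refine Finset.sum_congr rfl fun j _ => ?_
  rw [Module.End.mul_apply, pow_apply_eigenbasis hv, map_smul, real_inner_smul_right,
    Module.End.mul_apply, Module.End.mul_apply, ← hA, inner_pow_apply hX hu, Finset.mul_sum]
  exact Finset.sum_congr rfl fun i _ => by ring

end Eigen

/-- In eigenbases `u` of `X` and `v` of `Y` all four traces are sums with the same nonnegative
weights `⟪u i, A (v j)⟫ ^ 2`. The claim is thus the scalar inequality for each pair of eigenvalues.
-/
theorem trace_mean_inequality {A X Y : Module.End ℝ E} (hA : A.IsSymmetric) (hX : X.IsSymmetric)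
    (hY : Y.IsSymmetric) {q r n : ℕ} (hqr : q + r = n) (h : Even n) :
    tr (A * X ^ q * A * Y ^ r) + tr (A * X ^ r * A * Y ^ q)
      ≤ tr (A * X ^ n * A) + tr (A * Y ^ n * A) := by
  obtain ⟨u, s, hu⟩ := exists_eigenbasis hX
  obtain ⟨v, y, hv⟩ := exists_eigenbasis hY
  have e1 : tr (A * X ^ n * A) = tr (A * X ^ n * A * Y ^ 0) := by rw [pow_zero, mul_one]
  have e2 : tr (A * Y ^ n * A) = tr (A * X ^ 0 * A * Y ^ n) := by
    rw [pow_zero, mul_one, LinearMap.trace_mul_comm, ← mul_assoc]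
  rw [e1, e2, trace_sandwich hA hX hu hv, trace_sandwich hA hX hu hv, trace_sandwich hA hX hu hv,
    trace_sandwich hA hX hu hv, ← Finset.sum_add_distrib, ← Finset.sum_add_distrib]
  refine Finset.sum_le_sum fun j _ => ?_
  rw [← Finset.sum_add_distrib, ← Finset.sum_add_distrib]
  refine Finset.sum_le_sum fun i _ => ?_
  rw [← add_mul, ← add_mul, pow_zero, pow_zero, mul_one, one_mul]
  subst hqr
  exact mul_le_mul_of_nonneg_right (pow_mul_pow_add_le _ _ q r h) (sq_nonneg _)

theorem pow_sub_pow_eq_sum {R : Type*} [Ring R] (X Y : R) (n : ℕ) :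
    X ^ (n + 1) - Y ^ (n + 1) = ∑ q ∈ Finset.range (n + 1), X ^ q * (X - Y) * Y ^ (n - q) := by
  induction n with
  | zero => simp
  | succ n ih =>
    rw [Finset.sum_range_succ, Nat.sub_self, pow_zero, mul_one]
    have : ∑ q ∈ Finset.range (n + 1), X ^ q * (X - Y) * Y ^ (n + 1 - q)
        = (∑ q ∈ Finset.range (n + 1), X ^ q * (X - Y) * Y ^ (n - q)) * Y := by
      rw [Finset.sum_mul]
      refine Finset.sum_congr rfl fun q hq => ?_
      have hq' : q ≤ n := Nat.lt_succ_iff.1 (Finset.mem_range.1 hq)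
      rw [Nat.sub_add_comm hq', pow_succ, mul_assoc, mul_assoc, mul_assoc]
    rw [this, ← ih, sub_mul, mul_sub, ← pow_succ, ← pow_succ]
    abel

/-- A mean value inequality for traces, applied to signed sums that differ in one sign. The
difference of powers telescopes, and the terms `q` and `2 * p - q` are paired. -/
theorem trace_pow_sub_le {A X Y : Module.End ℝ E} (hA : A.IsSymmetric) (hX : X.IsSymmetric)
    (hY : Y.IsSymmetric) {c : ℝ} (hc : c = 1 ∨ c = -1) (hXY : X - Y = (2 * c) • A) (p : ℕ) :
    c * (tr (A * X ^ (2 * p + 1)) - tr (A * Y ^ (2 * p + 1)))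
      ≤ (2 * p + 1) * (tr (A * X ^ (2 * p) * A) + tr (A * Y ^ (2 * p) * A)) := by
  set F : ℕ → ℝ := fun q => tr (A * X ^ q * A * Y ^ (2 * p - q)) with hF
  have h1 : tr (A * X ^ (2 * p + 1)) - tr (A * Y ^ (2 * p + 1))
      = 2 * c * ∑ q ∈ Finset.range (2 * p + 1), F q := by
    rw [← map_sub, ← mul_sub, pow_sub_pow_eq_sum, hXY, Finset.mul_sum, map_sum, Finset.mul_sum]
    refine Finset.sum_congr rfl fun q _ => ?_
    rw [mul_smul_comm, smul_mul_assoc, mul_smul_comm, map_smul, smul_eq_mul, ← mul_assoc,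
      ← mul_assoc]
  have h2 : ∑ q ∈ Finset.range (2 * p + 1), F (2 * p - q) = ∑ q ∈ Finset.range (2 * p + 1), F q :=
    Finset.sum_range_reflect F (2 * p + 1)
  have h3 : 2 * ∑ q ∈ Finset.range (2 * p + 1), F q
      ≤ (2 * p + 1) * (tr (A * X ^ (2 * p) * A) + tr (A * Y ^ (2 * p) * A)) := by
    rw [two_mul]
    nth_rewrite 2 [← h2]
    rw [← Finset.sum_add_distrib]
    refine (Finset.sum_le_card_nsmul _ _ (tr (A * X ^ (2 * p) * A) + tr (A * Y ^ (2 * p) * A))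
      fun q hq => ?_).trans (le_of_eq ?_)
    · have hq' : q ≤ 2 * p := Nat.lt_succ_iff.1 (Finset.mem_range.1 hq)
      have := trace_mean_inequality hA hX hY (q := q) (r := 2 * p - q)
        (by omega : q + (2 * p - q) = 2 * p) (even_two_mul p)
      simp only [hF]
      rwa [Nat.sub_sub_self hq']
    · rw [Finset.card_range, nsmul_eq_mul]; push_cast; ring
  rw [h1]
  have hcc : c * c = 1 := by rcases hc with h | h <;> rw [h] <;> norm_num
  calc c * (2 * c * ∑ q ∈ Finset.range (2 * p + 1), F q)
      = (c * c) * (2 * ∑ q ∈ Finset.range (2 * p + 1), F q) := by ring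
    _ ≤ _ := by rw [hcc, one_mul]; exact h3

theorem trace_sandwich_le {A X : Module.End ℝ E} (hA : A.IsSymmetric) (hX : X.IsSymmetric) {b : ℝ}
    (hb : ∀ w, ‖A w‖ ≤ b * ‖w‖) (p : ℕ) :
    tr (A * X ^ (2 * p) * A) ≤ b ^ 2 * tr (X ^ (2 * p)) := by
  obtain ⟨u, s, hu⟩ := exists_eigenbasis hX
  have h1 : tr (A * X ^ (2 * p) * A) = tr (A * (A * X ^ (2 * p))) := LinearMap.trace_mul_comm ℝ _ _
  rw [h1, trace_pow hu, LinearMap.trace_eq_sum_inner _ u, Finset.mul_sum]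
  refine Finset.sum_le_sum fun i _ => ?_
  rw [Module.End.mul_apply, Module.End.mul_apply, pow_apply_eigenbasis hu, map_smul, map_smul,
    real_inner_smul_right, ← hA, real_inner_self_eq_norm_sq]
  have h2 : ‖A (u i)‖ ≤ b := by simpa [u.orthonormal.1 i] using hb (u i)
  have h3 : ‖A (u i)‖ ^ 2 ≤ b ^ 2 := by gcongr
  have h4 : 0 ≤ s i ^ (2 * p) := (even_two_mul p).pow_nonneg _
  nlinarith

/-- The signed sum of a family of operators. -/
def signedSum {ι F : Type*} [Fintype ι] [AddCommGroup F] [Module ℝ F] (A : ι → F) (ε : ι → ℤˣ) :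
    F :=
  ∑ i, (((ε i : ℤˣ) : ℤ) : ℝ) • A i

variable {ι : Type*} [Fintype ι] [DecidableEq ι]

omit [FiniteDimensional ℝ E] [DecidableEq ι] in
theorem isSymmetric_signedSum {A : ι → Module.End ℝ E} (hA : ∀ i, (A i).IsSymmetric)
    (ε : ι → ℤˣ) : (signedSum A ε).IsSymmetric := by
  intro x y
  simp only [signedSum, LinearMap.sum_apply, LinearMap.smul_apply, sum_inner, inner_sum,
    real_inner_smul_left, real_inner_smul_right]
  exact Finset.sum_congr rfl fun i _ => by rw [hA i]

omit [FiniteDimensional ℝ E] in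
theorem signedSum_sub_flip {A : ι → Module.End ℝ E} (ε : ι → ℤˣ) (i : ι) :
    signedSum A ε - signedSum A (ε * Pi.mulSingle i (-1))
      = (2 * (((ε i : ℤˣ) : ℤ) : ℝ)) • A i := by
  rw [signedSum, signedSum, ← Finset.sum_sub_distrib, Finset.sum_eq_single i]
  · simp only [Pi.mul_apply, Pi.mulSingle_eq_same, mul_neg, mul_one, Units.val_neg, Int.cast_neg]
    module
  · intro j _ hj
    rw [Pi.mul_apply, Pi.mulSingle_eq_of_ne hj, mul_one, sub_self]
  · simp

/-- Integration by parts on the cube of signs. One factor of the power is expanded; averaging the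
`i`-th term with its image under flipping the `i`-th sign turns it into a difference of powers,
which costs `2 * p + 1` and frees `A i` twice. -/
theorem sum_trace_signedSum_pow_le {A : ι → Module.End ℝ E} (hA : ∀ i, (A i).IsSymmetric)
    {b : ι → ℝ} (hb : ∀ i w, ‖A i w‖ ≤ b i * ‖w‖) (p : ℕ) :
    ∑ ε : ι → ℤˣ, tr (signedSum A ε ^ (2 * (p + 1)))
      ≤ (2 * p + 1) * (∑ i, b i ^ 2) * ∑ ε : ι → ℤˣ, tr (signedSum A ε ^ (2 * p)) := by
  have hS := isSymmetric_signedSum hA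
  have hflip : ∀ (i : ι) (F : (ι → ℤˣ) → ℝ),
      ∑ ε, F (ε * Pi.mulSingle i (-1)) = ∑ ε, F ε := fun i F =>
    Fintype.sum_equiv (Equiv.mulRight (Pi.mulSingle i (-1))) _ _ fun _ => rfl
  have hone : ∀ i, ∑ ε : ι → ℤˣ, (((ε i : ℤˣ) : ℤ) : ℝ) * tr (A i * signedSum A ε ^ (2 * p + 1))
      ≤ (2 * p + 1) * b i ^ 2 * ∑ ε : ι → ℤˣ, tr (signedSum A ε ^ (2 * p)) := by
    intro i
    set F : (ι → ℤˣ) → ℝ := fun ε => tr (A i * signedSum A ε ^ (2 * p + 1)) with hF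
    set K : (ι → ℤˣ) → ℝ := fun ε => tr (A i * signedSum A ε ^ (2 * p) * A i) with hK
    -- Flipping the `i`-th sign permutes the cube and negates `ε i`.
    have h1 : ∑ ε : ι → ℤˣ, (((ε i : ℤˣ) : ℤ) : ℝ) * F ε
        = -∑ ε : ι → ℤˣ, (((ε i : ℤˣ) : ℤ) : ℝ) * F (ε * Pi.mulSingle i (-1)) := by
      rw [← hflip i fun ε => (((ε i : ℤˣ) : ℤ) : ℝ) * F ε, ← Finset.sum_neg_distrib]
      refine Finset.sum_congr rfl fun ε _ => ?_
      simp
    have h2 : ∑ ε : ι → ℤˣ, (((ε i : ℤˣ) : ℤ) : ℝ) * (F ε - F (ε * Pi.mulSingle i (-1)))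
        ≤ ∑ ε : ι → ℤˣ, (2 * p + 1) * (K ε + K (ε * Pi.mulSingle i (-1))) := by
      refine Finset.sum_le_sum fun ε _ => trace_pow_sub_le (hA i) (hS _) (hS _) ?_
        (signedSum_sub_flip ε i) p
      rcases Int.units_eq_one_or (ε i) with h | h <;> simp [h]
    rw [← Finset.mul_sum, Finset.sum_add_distrib, hflip i K] at h2
    simp only [mul_sub, Finset.sum_sub_distrib] at h2
    have h3 : ∑ ε, K ε ≤ b i ^ 2 * ∑ ε : ι → ℤˣ, tr (signedSum A ε ^ (2 * p)) := by
      rw [Finset.mul_sum]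
      exact Finset.sum_le_sum fun ε _ => trace_sandwich_le (hA i) (hS ε) (hb i) p
    have h4 : (0 : ℝ) ≤ 2 * p + 1 := by positivity
    nlinarith [mul_le_mul_of_nonneg_left h3 h4]
  have hexp : ∀ ε : ι → ℤˣ, tr (signedSum A ε ^ (2 * (p + 1)))
      = ∑ i, (((ε i : ℤˣ) : ℤ) : ℝ) * tr (A i * signedSum A ε ^ (2 * p + 1)) := by
    intro ε
    rw [show 2 * (p + 1) = 2 * p + 1 + 1 by ring, pow_succ']
    nth_rewrite 1 [signedSum]
    simp only [Finset.sum_mul, smul_mul_assoc, map_sum, map_smul, smul_eq_mul]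
  simp only [hexp]
  rw [Finset.sum_comm]
  refine (Finset.sum_le_sum fun i _ => hone i).trans (le_of_eq ?_)
  rw [← Finset.sum_mul, ← Finset.mul_sum]

theorem sum_trace_signedSum_pow_le' {A : ι → Module.End ℝ E} (hA : ∀ i, (A i).IsSymmetric)
    {b : ι → ℝ} (hb : ∀ i w, ‖A i w‖ ≤ b i * ‖w‖) (p : ℕ) :
    ∑ ε : ι → ℤˣ, tr (signedSum A ε ^ (2 * p))
      ≤ (p * ∑ i, b i ^ 2) ^ p * (Fintype.card (ι → ℤˣ) * Module.finrank ℝ E) := by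
  set v := ∑ i, b i ^ 2 with hv
  have hv0 : 0 ≤ v := Finset.sum_nonneg fun i _ => sq_nonneg _
  induction p with
  | zero => simp
  | succ p ih =>
    -- Bernoulli's inequality for `(1 + 1 / p) ^ (p + 1)`. It lets `p ^ p` dominate the product of
    -- odd numbers that the recursion creates.
    have hstep : (2 * p + 1 : ℝ) * (p : ℝ) ^ p ≤ ((p + 1 : ℕ) : ℝ) ^ (p + 1) := by
      rcases Nat.eq_zero_or_pos p with h | h
      · subst h; simp
      · have hp : (0 : ℝ) < p := Nat.cast_pos.2 h
        have hB := one_add_mul_le_pow (a := 1 / (p : ℝ)) (by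
          have : 0 ≤ 1 / (p : ℝ) := by positivity
          linarith) (p + 1)
        have : ((p + 1 : ℕ) : ℝ) = p * (1 + 1 / p) := by push_cast; field_simp
        rw [this, mul_pow, pow_succ (p : ℝ)]
        have h2 : (2 * p + 1 : ℝ) = p * (1 + ((p + 1 : ℕ) : ℝ) * (1 / p)) := by
          push_cast; field_simp; ring
        rw [h2]
        calc p * (1 + ((p + 1 : ℕ) : ℝ) * (1 / p)) * (p : ℝ) ^ p
            = (p : ℝ) ^ p * p * (1 + ((p + 1 : ℕ) : ℝ) * (1 / p)) := by ring
          _ ≤ _ := by gcongr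
    refine (sum_trace_signedSum_pow_le hA hb p).trans ?_
    rw [← hv]
    have hN : (0 : ℝ) ≤ Fintype.card (ι → ℤˣ) * Module.finrank ℝ E := by positivity
    calc (2 * p + 1) * v * ∑ ε : ι → ℤˣ, tr (signedSum A ε ^ (2 * p))
        ≤ (2 * p + 1) * v * ((p * v) ^ p * (Fintype.card (ι → ℤˣ) * Module.finrank ℝ E)) := by
          gcongr
      _ = ((2 * p + 1) * (p : ℝ) ^ p) * v ^ (p + 1) *
          (Fintype.card (ι → ℤˣ) * Module.finrank ℝ E) := by ring
      _ ≤ ((p + 1 : ℕ) : ℝ) ^ (p + 1) * v ^ (p + 1) *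
          (Fintype.card (ι → ℤˣ) * Module.finrank ℝ E) := by gcongr
      _ = _ := by rw [mul_pow]

theorem norm_pow_le_trace {X : E →L[ℝ] E} (hX : (X : Module.End ℝ E).IsSymmetric) {p : ℕ}
    (hp : p ≠ 0) : (‖X‖ ^ 2) ^ p ≤ tr ((X : Module.End ℝ E) ^ (2 * p)) := by
  obtain ⟨u, s, hu⟩ := exists_eigenbasis hX
  set K := tr ((X : Module.End ℝ E) ^ (2 * p)) with hK
  have hK' : K = ∑ i, (s i ^ 2) ^ p := by
    rw [hK, trace_pow hu]
    exact Finset.sum_congr rfl fun i _ => by rw [pow_mul]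
  have hK0 : 0 ≤ K := by
    rw [hK']
    exact Finset.sum_nonneg fun i _ => by positivity
  -- Even powers make all summands of the trace nonnegative, so every squared eigenvalue is at most
  -- the `p`-th root of the trace.
  set m := K ^ ((p : ℝ)⁻¹) with hm
  have hm0 : 0 ≤ m := Real.rpow_nonneg hK0 _
  have hmp : m ^ p = K := Real.rpow_inv_natCast_pow hK0 hp
  have hs : ∀ i, s i ^ 2 ≤ m := fun i => by
    apply le_of_pow_le_pow_left₀ hp hm0
    rw [hmp, hK']
    exact Finset.single_le_sum (f := fun i => (s i ^ 2) ^ p) (fun i _ => by positivity)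
      (Finset.mem_univ i)
  have hXm : ‖X‖ ≤ Real.sqrt m := by
    refine X.opNorm_le_bound (Real.sqrt_nonneg _) fun w => ?_
    apply le_of_sq_le_sq _ (by positivity)
    rw [mul_pow, Real.sq_sqrt hm0, ← real_inner_self_eq_norm_sq (X w)]
    have h1 : inner ℝ (X w) (X w) = inner ℝ w (((X : Module.End ℝ E) ^ 2) w) := by
      rw [pow_two, Module.End.mul_apply]
      exact hX w (X w)
    have h2 : ‖w‖ ^ 2 = inner ℝ w (((X : Module.End ℝ E) ^ 0) w) := by
      rw [pow_zero, Module.End.one_apply, real_inner_self_eq_norm_sq]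
    rw [h1, h2, inner_pow_apply hX hu, inner_pow_apply hX hu, Finset.mul_sum]
    refine Finset.sum_le_sum fun i _ => ?_
    rw [pow_zero, one_mul]
    exact mul_le_mul_of_nonneg_right (hs i) (sq_nonneg _)
  calc (‖X‖ ^ 2) ^ p ≤ m ^ p := by
        gcongr
        calc ‖X‖ ^ 2 ≤ Real.sqrt m ^ 2 := by gcongr
          _ = m := Real.sq_sqrt hm0
    _ = K := hmp

/-- A matrix Khintchine inequality for the operator norm. -/
theorem sum_norm_signedSum_sq_le {A : ι → E →L[ℝ] E}
    (hA : ∀ i, ((A i : E →L[ℝ] E) : Module.End ℝ E).IsSymmetric) {p : ℕ} (hp : p ≠ 0) :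
    ∑ ε : ι → ℤˣ, ‖signedSum A ε‖ ^ 2
      ≤ Fintype.card (ι → ℤˣ) *
        (p * (Module.finrank ℝ E : ℝ) ^ ((p : ℝ)⁻¹) * ∑ i, ‖A i‖ ^ 2) := by
  set N : ℝ := ((Fintype.card (ι → ℤˣ) : ℕ) : ℝ) with hN
  set v := ∑ i, ‖A i‖ ^ 2 with hv
  have hN0 : 0 < N := by rw [hN]; exact_mod_cast Fintype.card_pos
  have hv0 : 0 ≤ v := Finset.sum_nonneg fun i _ => sq_nonneg _
  set D := (Module.finrank ℝ E : ℝ) ^ ((p : ℝ)⁻¹) with hD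
  have hDp : D ^ p = Module.finrank ℝ E := Real.rpow_inv_natCast_pow (Nat.cast_nonneg _) hp
  have hD0 : 0 ≤ D := Real.rpow_nonneg (Nat.cast_nonneg _) _
  have hcoe : ∀ ε : ι → ℤˣ, ((signedSum A ε : E →L[ℝ] E) : Module.End ℝ E)
      = signedSum (fun i => ((A i : E →L[ℝ] E) : Module.End ℝ E)) ε := by
    intro ε
    ext w
    simp [signedSum]
  have h1 : ∑ ε : ι → ℤˣ, (‖signedSum A ε‖ ^ 2) ^ p ≤ (p * v) ^ p * (N * Module.finrank ℝ E) := by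
    refine (Finset.sum_le_sum fun ε _ => norm_pow_le_trace (X := signedSum A ε) ?_ hp).trans ?_
    · rw [hcoe]; exact isSymmetric_signedSum hA ε
    · simp only [hcoe]
      exact sum_trace_signedSum_pow_le' hA (b := fun i => ‖A i‖) (fun i w => (A i).le_opNorm w) p
  -- Jensen's inequality passes from moments of order `2 * p` to second moments, at the price of the
  -- dimension to the power `1 / p`.
  have h2 := Real.pow_arith_mean_le_arith_mean_pow Finset.univ (fun _ : ι → ℤˣ => N⁻¹)
    (fun ε => ‖signedSum A ε‖ ^ 2) (fun _ _ => by positivity)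
    (by rw [Finset.sum_const, Finset.card_univ, nsmul_eq_mul, ← hN, mul_inv_cancel₀ hN0.ne'])
    (fun _ _ => by positivity) p
  rw [← Finset.mul_sum, ← Finset.mul_sum] at h2
  have h3 : (N⁻¹ * ∑ ε : ι → ℤˣ, ‖signedSum A ε‖ ^ 2) ^ p ≤ (p * D * v) ^ p := by
    refine h2.trans ?_
    calc N⁻¹ * ∑ ε : ι → ℤˣ, (‖signedSum A ε‖ ^ 2) ^ p
        ≤ N⁻¹ * ((p * v) ^ p * (N * Module.finrank ℝ E)) := by gcongr
      _ = (p * D * v) ^ p := by rw [← hDp, mul_pow, mul_pow, mul_pow]; field_simp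
  have h4 := le_of_pow_le_pow_left₀ hp (by positivity) h3
  rwa [inv_mul_le_iff₀ hN0] at h4

/-- For `d ≥ 3` take `p = ⌈log d⌉`: then `d ^ (1 / p) ≤ e`, `p ≤ 2 * log d` and `2 * e < 11 / 2`.
Since `log 2 < 1`, the case `d = 2` is treated separately with `p = 1`. -/
theorem exists_exponent {d : ℕ} (hd : 2 ≤ d) :
    ∃ p : ℕ, p ≠ 0 ∧ p * (d : ℝ) ^ ((p : ℝ)⁻¹) ≤ 11 / 2 * Real.log d := by
  rcases hd.eq_or_lt with h | h
  · subst h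
    refine ⟨1, one_ne_zero, ?_⟩
    have := Real.log_two_gt_d9
    norm_num
    linarith
  · have hd3 : (3 : ℝ) ≤ d := by exact_mod_cast h
    have hd0 : (0 : ℝ) < d := by linarith
    have he := Real.exp_one_lt_d9
    have hlog : 1 ≤ Real.log d := by
      rw [Real.le_log_iff_exp_le hd0]
      linarith
    set p := ⌈Real.log d⌉₊ with hp
    have hp1 : Real.log d ≤ p := Nat.le_ceil _
    have hp2 : (p : ℝ) < Real.log d + 1 := Nat.ceil_lt_add_one (by linarith)
    have hp0 : (0 : ℝ) < p := by linarith
    refine ⟨p, fun h0 => by rw [h0] at hp0; simp at hp0, ?_⟩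
    have hD : (d : ℝ) ^ ((p : ℝ)⁻¹) ≤ Real.exp 1 := by
      rw [Real.rpow_def_of_pos hd0, Real.exp_le_exp, ← div_eq_mul_inv, div_le_one hp0]
      exact hp1
    calc p * (d : ℝ) ^ ((p : ℝ)⁻¹) ≤ p * Real.exp 1 := by gcongr
      _ ≤ (Real.log d + 1) * Real.exp 1 := by gcongr
      _ ≤ (Real.log d + Real.log d) * Real.exp 1 := by gcongr
      _ ≤ _ := by nlinarith

end Khintchine

end MatrixKhintchine

/-! ### Second moments of batch averages -/

section Sampling

section Concentration

variable {X : Type*} [MeasurableSpace X]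

theorem sq_lintegral_le {P : Measure X} [IsProbabilityMeasure P] {g : X → ENNReal}
    (hg : AEMeasurable g P) : (∫⁻ x, g x ∂P) ^ 2 ≤ ∫⁻ x, g x ^ 2 ∂P := by
  have h := ENNReal.lintegral_mul_le_Lp_mul_Lq P Real.HolderConjugate.two_two hg
    (aemeasurable_const (b := (1 : ENNReal)))
  simp only [Pi.mul_apply, mul_one, ENNReal.one_rpow, lintegral_const, measure_univ] at h
  calc (∫⁻ x, g x ∂P) ^ 2 ≤ ((∫⁻ x, g x ^ (2 : ℝ) ∂P) ^ (1 / (2 : ℝ))) ^ 2 := by gcongr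
    _ = ∫⁻ x, g x ^ 2 ∂P := by
      rw [← ENNReal.rpow_natCast, ← ENNReal.rpow_mul]
      norm_num

theorem lintegral_norm_sub_integral_sq_le {P : Measure X} [IsProbabilityMeasure P] {F : Type*}
    [NormedAddCommGroup F] [NormedSpace ℝ F] [CompleteSpace F] {Y : X → F} (hY : Integrable Y P)
    (c : F) :
    ENNReal.ofReal (‖c - ∫ x, Y x ∂P‖ ^ 2) ≤ ∫⁻ x, ENNReal.ofReal (‖c - Y x‖ ^ 2) ∂P := by
  have hint : Integrable (fun x => c - Y x) P := (integrable_const c).sub hY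
  have h1 : c - ∫ x, Y x ∂P = ∫ x, (c - Y x) ∂P := by
    rw [integral_sub (integrable_const c) hY]; simp
  rw [h1]
  simp only [ENNReal.ofReal_pow (norm_nonneg _), ofReal_norm]
  calc ‖∫ x, (c - Y x) ∂P‖ₑ ^ 2 ≤ (∫⁻ x, ‖c - Y x‖ₑ ∂P) ^ 2 := by
        gcongr; exact enorm_integral_le_lintegral_enorm _
    _ ≤ _ := sq_lintegral_le hint.aestronglyMeasurable.enorm

theorem lintegral_pi_eval {ι : Type*} [Fintype ι] {P : Measure X} [IsProbabilityMeasure P]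
    {φ : X → ENNReal} (hφ : Measurable φ) (i : ι) :
    ∫⁻ τ, φ (τ i) ∂(Measure.pi fun _ : ι => P) = ∫⁻ x, φ x ∂P :=
  (measurePreserving_eval (fun _ : ι => P) i).lintegral_comp hφ

/-- Symmetrization: the deviation of a sum of independent copies from its mean is dominated by the
signed sums. -/
theorem symmetrization {P : Measure X} [IsProbabilityMeasure P] {F : Type*}
    [NormedAddCommGroup F] [NormedSpace ℝ F] [CompleteSpace F] [MeasurableSpace F] [BorelSpace F]
    [SecondCountableTopology F] {A : X → F} (hA : Measurable A) (hAi : Integrable A P) (n : ℕ)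
    (ε : Fin n → ℤˣ) :
    ∫⁻ τ, ENNReal.ofReal (‖∑ i, A (τ i) - (n : ℝ) • ∫ x, A x ∂P‖ ^ 2)
        ∂(Measure.pi fun _ : Fin n => P)
      ≤ ∫⁻ z, ENNReal.ofReal (‖signedSum (fun i => A (z i).1 - A (z i).2) ε‖ ^ 2)
        ∂(Measure.pi fun _ : Fin n => P.prod P) := by
  set Q := Measure.pi fun _ : Fin n => P with hQ
  set Q2 := Measure.pi fun _ : Fin n => P.prod P with hQ2
  have hsum : Measurable fun τ : Fin n → X => ∑ i, A (τ i) := by fun_prop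
  have hi : ∀ i : Fin n, Integrable (fun τ : Fin n → X => A (τ i)) Q := fun i =>
    (measurePreserving_eval (fun _ : Fin n => P) i).integrable_comp_of_integrable hAi
  have hsumi : Integrable (fun τ : Fin n → X => ∑ i, A (τ i)) Q :=
    integrable_finsetSum _ fun i _ => hi i
  have hmean : ∫ τ, ∑ i, A (τ i) ∂Q = (n : ℝ) • ∫ x, A x ∂P := by
    rw [integral_finsetSum _ fun i _ => hi i]
    have : ∀ i : Fin n, ∫ τ, A (τ i) ∂Q = ∫ x, A x ∂P := fun i => by
      have := integral_map (μ := Q) (φ := fun τ : Fin n → X => τ i) (f := A)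
        (measurable_pi_apply i).aemeasurable hA.aestronglyMeasurable
      rw [← this, (measurePreserving_eval (fun _ : Fin n => P) i).map_eq]
    simp [this, Nat.cast_smul_eq_nsmul]
  -- Jensen's inequality replaces the mean by an independent copy of the sum.
  have h1 : ∫⁻ τ, ENNReal.ofReal (‖∑ i, A (τ i) - (n : ℝ) • ∫ x, A x ∂P‖ ^ 2) ∂Q
      ≤ ∫⁻ w : (Fin n → X) × (Fin n → X),
        ENNReal.ofReal (‖∑ i, A (w.1 i) - ∑ i, A (w.2 i)‖ ^ 2) ∂(Q.prod Q) := by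
    rw [lintegral_prod _ (Measurable.aemeasurable (by fun_prop))]
    refine lintegral_mono fun τ => ?_
    rw [← hmean]
    exact lintegral_norm_sub_integral_sq_le hsumi _
  have hmp := measurePreserving_arrowProdEquivProdArrow X X (Fin n) (fun _ => P) (fun _ => P)
  refine h1.trans (le_of_eq ?_)
  rw [← hmp.lintegral_comp (by fun_prop)]
  -- Exchanging the members of the pairs with sign `-1` preserves the product measure and inserts
  -- the signs `ε`.
  set sw : (Fin n → X × X) → Fin n → X × X :=
    fun z i => (if ε i = 1 then id else Prod.swap) (z i) with hsw
  have hswmp : MeasurePreserving sw Q2 Q2 := by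
    refine measurePreserving_pi _ _ fun i => ?_
    split_ifs
    · exact MeasurePreserving.id _
    · exact Measure.measurePreserving_swap
  rw [← hswmp.lintegral_comp (f := fun z => ENNReal.ofReal
    (‖∑ i, A ((MeasurableEquiv.arrowProdEquivProdArrow X X (Fin n) z).1 i) -
      ∑ i, A ((MeasurableEquiv.arrowProdEquivProdArrow X X (Fin n) z).2 i)‖ ^ 2)) (by fun_prop)]
  refine lintegral_congr fun z => ?_
  congr 3
  rw [signedSum, ← Finset.sum_sub_distrib]
  refine Finset.sum_congr rfl fun i _ => ?_
  have e1 : (MeasurableEquiv.arrowProdEquivProdArrow X X (Fin n) (sw z)).1 i = (sw z i).1 := rfl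
  have e2 : (MeasurableEquiv.arrowProdEquivProdArrow X X (Fin n) (sw z)).2 i = (sw z i).2 := rfl
  rw [e1, e2]
  rcases Int.units_eq_one_or (ε i) with h | h
  · simp [hsw, h]
  · simp [hsw, h]

/-- Symmetrization holds for each sign pattern, so it may be averaged over all of them, and
Khintchine applies pointwise to each of the two copies. The factor 22 is `4 * (11 / 2)`: a 2 from
splitting the squared difference and a 2 from the two copies. -/
theorem lintegral_norm_sum_sub_sq_le {P : Measure X} [IsProbabilityMeasure P] {E : Type*}
    [NormedAddCommGroup E] [InnerProductSpace ℝ E] [FiniteDimensional ℝ E]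
    [MeasurableSpace (E →L[ℝ] E)] [BorelSpace (E →L[ℝ] E)]
    {A : X → E →L[ℝ] E} (hA : Measurable A) (hAi : Integrable A P)
    (hsymm : ∀ x, ((A x : E →L[ℝ] E) : Module.End ℝ E).IsSymmetric)
    (hd : 2 ≤ Module.finrank ℝ E) {K : ℝ} (hK0 : 0 ≤ K)
    (hK : ∫⁻ x, ENNReal.ofReal (‖A x‖ ^ 2) ∂P ≤ ENNReal.ofReal K) (n : ℕ) :
    ∫⁻ τ, ENNReal.ofReal (‖∑ i, A (τ i) - (n : ℝ) • ∫ x, A x ∂P‖ ^ 2)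
        ∂(Measure.pi fun _ : Fin n => P)
      ≤ ENNReal.ofReal (22 * Real.log (Module.finrank ℝ E) * n * K) := by
  obtain ⟨p, hp, hpd⟩ := exists_exponent hd
  set κ := p * (Module.finrank ℝ E : ℝ) ^ ((p : ℝ)⁻¹) with hκ
  have hκ0 : 0 ≤ κ := by positivity
  set N := Fintype.card (Fin n → ℤˣ) with hN
  have hN0 : 0 < N := Fintype.card_pos
  set Q2 := Measure.pi fun _ : Fin n => P.prod P with hQ2
  set I := ∫⁻ τ, ENNReal.ofReal (‖∑ i, A (τ i) - (n : ℝ) • ∫ x, A x ∂P‖ ^ 2)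
    ∂(Measure.pi fun _ : Fin n => P) with hI
  have hpt : ∀ z : Fin n → X × X,
      ∑ ε : Fin n → ℤˣ, ‖signedSum (fun i => A (z i).1 - A (z i).2) ε‖ ^ 2
        ≤ N * (2 * κ) * ∑ i, (‖A (z i).1‖ ^ 2 + ‖A (z i).2‖ ^ 2) := by
    intro z
    have h1 := sum_norm_signedSum_sq_le (A := fun i => A (z i).1) (fun i => hsymm _) hp
    have h2 := sum_norm_signedSum_sq_le (A := fun i => A (z i).2) (fun i => hsymm _) hp
    rw [← hκ, ← hN] at h1 h2
    have h3 : ∀ ε : Fin n → ℤˣ, ‖signedSum (fun i => A (z i).1 - A (z i).2) ε‖ ^ 2 ≤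
        2 * ‖signedSum (fun i => A (z i).1) ε‖ ^ 2 +
          2 * ‖signedSum (fun i => A (z i).2) ε‖ ^ 2 := by
      intro ε
      have : signedSum (fun i => A (z i).1 - A (z i).2) ε
          = signedSum (fun i => A (z i).1) ε - signedSum (fun i => A (z i).2) ε := by
        simp only [signedSum, smul_sub, Finset.sum_sub_distrib]
      rw [this]
      have h4 := norm_sub_le (signedSum (fun i => A (z i).1) ε) (signedSum (fun i => A (z i).2) ε)
      have h5 := norm_nonneg (signedSum (fun i => A (z i).1) ε - signedSum (fun i => A (z i).2) ε)
      nlinarith [sq_nonneg (‖signedSum (fun i => A (z i).1) ε‖ -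
        ‖signedSum (fun i => A (z i).2) ε‖)]
    refine (Finset.sum_le_sum fun ε _ => h3 ε).trans ?_
    rw [Finset.sum_add_distrib, ← Finset.mul_sum, ← Finset.mul_sum, Finset.sum_add_distrib]
    linarith
  have hm1 : ∀ ε : Fin n → ℤˣ, Measurable fun z : Fin n → X × X =>
      ENNReal.ofReal (‖signedSum (fun i => A (z i).1 - A (z i).2) ε‖ ^ 2) := by
    intro ε
    unfold signedSum
    fun_prop
  have hmul : (N : ENNReal) * I ≤ N * ENNReal.ofReal (22 * Real.log (Module.finrank ℝ E) * n * K) :=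
    calc (N : ENNReal) * I = ∑ _ε : Fin n → ℤˣ, I := by
          rw [Finset.sum_const, Finset.card_univ, nsmul_eq_mul]
      _ ≤ ∑ ε : Fin n → ℤˣ, ∫⁻ z, ENNReal.ofReal
          (‖signedSum (fun i => A (z i).1 - A (z i).2) ε‖ ^ 2) ∂Q2 :=
          Finset.sum_le_sum fun ε _ => symmetrization hA hAi n ε
      _ = ∫⁻ z, ∑ ε : Fin n → ℤˣ, ENNReal.ofReal
          (‖signedSum (fun i => A (z i).1 - A (z i).2) ε‖ ^ 2) ∂Q2 := by
          rw [lintegral_finsetSum _ fun ε _ => hm1 ε]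
      _ ≤ ∫⁻ z, ENNReal.ofReal (N * (2 * κ)) *
          ∑ i, (ENNReal.ofReal (‖A (z i).1‖ ^ 2) + ENNReal.ofReal (‖A (z i).2‖ ^ 2)) ∂Q2 := by
          refine lintegral_mono fun z => ?_
          simp only
          rw [← ENNReal.ofReal_sum_of_nonneg fun _ _ => by positivity]
          simp only [← ENNReal.ofReal_add (sq_nonneg (‖A (z _).1‖)) (sq_nonneg (‖A (z _).2‖))]
          rw [← ENNReal.ofReal_sum_of_nonneg fun _ _ => by positivity,
            ← ENNReal.ofReal_mul (by positivity)]
          exact ENNReal.ofReal_le_ofReal (hpt z)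
      _ ≤ ENNReal.ofReal (N * (2 * κ)) * ∑ _i : Fin n, (ENNReal.ofReal K + ENNReal.ofReal K) := by
          rw [lintegral_const_mul _ (by fun_prop), lintegral_finsetSum _ fun i _ => by fun_prop]
          gcongr with i
          rw [lintegral_add_left (by fun_prop)]
          have hm : Measurable fun x => ENNReal.ofReal (‖A x‖ ^ 2) := by fun_prop
          have e1 : ∫⁻ z : Fin n → X × X, ENNReal.ofReal (‖A (z i).1‖ ^ 2) ∂Q2
              = ∫⁻ x, ENNReal.ofReal (‖A x‖ ^ 2) ∂P := by
            rw [lintegral_pi_eval (P := P.prod P)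
              (φ := fun w : X × X => ENNReal.ofReal (‖A w.1‖ ^ 2)) (by fun_prop) i]
            exact measurePreserving_fst.lintegral_comp hm
          have e2 : ∫⁻ z : Fin n → X × X, ENNReal.ofReal (‖A (z i).2‖ ^ 2) ∂Q2
              = ∫⁻ x, ENNReal.ofReal (‖A x‖ ^ 2) ∂P := by
            rw [lintegral_pi_eval (P := P.prod P)
              (φ := fun w : X × X => ENNReal.ofReal (‖A w.2‖ ^ 2)) (by fun_prop) i]
            exact measurePreserving_snd.lintegral_comp hm
          rw [e1, e2]
          exact add_le_add hK hK
      _ = ENNReal.ofReal (N * (4 * κ * n * K)) := by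
          rw [Finset.sum_const, Finset.card_univ, Fintype.card_fin, nsmul_eq_mul,
            ← ENNReal.ofReal_add hK0 hK0, ← ENNReal.ofReal_natCast n,
            ← ENNReal.ofReal_mul (by positivity), ← ENNReal.ofReal_mul (by positivity)]
          congr 1
          ring
      _ ≤ ENNReal.ofReal (N * (22 * Real.log (Module.finrank ℝ E) * n * K)) := by
          apply ENNReal.ofReal_le_ofReal
          have : 4 * κ ≤ 22 * Real.log (Module.finrank ℝ E) := by linarith
          gcongr
      _ = _ := by
          rw [ENNReal.ofReal_mul (by positivity), ENNReal.ofReal_natCast]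
  exact (ENNReal.mul_le_mul_iff_right (by exact_mod_cast hN0.ne') (ENNReal.natCast_ne_top N)).1 hmul

theorem integral_avg_sub_sq_le {P : Measure X} [IsProbabilityMeasure P] {Y : X → ℝ}
    (hY : Measurable Y) (hYL : MemLp Y 2 P) {n : ℕ} (hn : 0 < n) :
    ∫ τ, ((n : ℝ)⁻¹ * ∑ i, Y (τ i) - ∫ x, Y x ∂P) ^ 2 ∂(Measure.pi fun _ : Fin n => P)
      ≤ (n : ℝ)⁻¹ * ∫ x, (Y x) ^ 2 ∂P := by
  have hn0 : (0 : ℝ) < n := Nat.cast_pos.2 hn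
  set Q := Measure.pi fun _ : Fin n => P with hQ
  have hi : ∀ i : Fin n, Integrable (fun τ : Fin n → X => Y (τ i)) Q := fun i =>
    (measurePreserving_eval (fun _ : Fin n => P) i).integrable_comp_of_integrable
      (hYL.integrable (by norm_num))
  have hsumL : MemLp (∑ i : Fin n, fun τ : Fin n → X => Y (τ i)) 2 Q :=
    memLp_finsetSum' _ fun i _ =>
      hYL.comp_measurePreserving (measurePreserving_eval (fun _ : Fin n => P) i)
  have hE : ∫ τ, (∑ i : Fin n, fun τ : Fin n → X => Y (τ i)) τ ∂Q = n * ∫ x, Y x ∂P := by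
    simp only [Finset.sum_apply]
    rw [integral_finsetSum _ fun i _ => hi i]
    have : ∀ i : Fin n, ∫ τ, Y (τ i) ∂Q = ∫ x, Y x ∂P := fun i => by
      have := integral_map (μ := Q) (φ := fun τ : Fin n → X => τ i) (f := Y)
        (measurable_pi_apply i).aemeasurable hY.aestronglyMeasurable
      rw [← this, (measurePreserving_eval (fun _ : Fin n => P) i).map_eq]
    simp [this]
  have hV : Var[∑ i : Fin n, fun τ : Fin n → X => Y (τ i); Q] = n * Var[Y; P] := by
    rw [variance_sum_pi (X := fun _ : Fin n => Y) fun _ => hYL]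
    simp
  have hV2 : Var[Y; P] ≤ ∫ x, (Y x) ^ 2 ∂P := variance_le_expectation_sq hYL.aestronglyMeasurable
  rw [variance_eq_integral hsumL.aestronglyMeasurable.aemeasurable, hE] at hV
  calc ∫ τ, ((n : ℝ)⁻¹ * ∑ i, Y (τ i) - ∫ x, Y x ∂P) ^ 2 ∂Q
      = ∫ τ, ((n : ℝ)⁻¹) ^ 2 * ((∑ i : Fin n, fun τ : Fin n → X => Y (τ i)) τ
          - n * ∫ x, Y x ∂P) ^ 2 ∂Q := by
        refine integral_congr_ae (ae_of_all _ fun τ => ?_)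
        simp only [Finset.sum_apply]
        field_simp
    _ = ((n : ℝ)⁻¹) ^ 2 * (n * Var[Y; P]) := by rw [integral_const_mul, hV]
    _ = (n : ℝ)⁻¹ * Var[Y; P] := by field_simp
    _ ≤ _ := by gcongr

theorem memLp_two_of_lintegral_le {P : Measure X} {F : Type*} [NormedAddCommGroup F]
    {Y : X → F} (hY : AEStronglyMeasurable Y P) {K : ℝ}
    (hK : ∫⁻ x, ENNReal.ofReal (‖Y x‖ ^ 2) ∂P ≤ ENNReal.ofReal K) : MemLp Y 2 P := by
  rw [memLp_two_iff_integrable_sq_norm hY]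
  refine ⟨hY.norm.pow 2, ?_⟩
  rw [hasFiniteIntegral_iff_ofReal (ae_of_all _ fun _ => by positivity)]
  exact hK.trans_lt ENNReal.ofReal_lt_top

/-- The Euclidean norm splits into coordinates, and variances of independent sums add. No
dimensional factor appears. -/
theorem lintegral_norm_avg_sub_sq_le {P : Measure X} [IsProbabilityMeasure P] {d : ℕ}
    {Y : X → EuclideanSpace ℝ (Fin d)} (hY : Measurable Y) {K : ℝ} (hK0 : 0 ≤ K)
    (hK : ∫⁻ x, ENNReal.ofReal (‖Y x‖ ^ 2) ∂P ≤ ENNReal.ofReal K) {n : ℕ} (hn : 0 < n) :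
    ∫⁻ τ, ENNReal.ofReal (‖(n : ℝ)⁻¹ • ∑ i, Y (τ i) - ∫ x, Y x ∂P‖ ^ 2)
        ∂(Measure.pi fun _ : Fin n => P) ≤ ENNReal.ofReal (K / n) := by
  set Q := Measure.pi fun _ : Fin n => P with hQ
  have hYL : MemLp Y 2 P := memLp_two_of_lintegral_le hY.aestronglyMeasurable hK
  have hYi : Integrable Y P := hYL.integrable (by norm_num)
  have hYj : ∀ j, Measurable fun x => Y x j := fun j => by fun_prop
  have hcoord : ∀ j, MemLp (fun x => Y x j) 2 P := fun j =>
    hYL.mono (hYj j).aestronglyMeasurable (ae_of_all _ fun x => PiLp.norm_apply_le (Y x) j)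
  have hmean : ∀ j, (∫ x, Y x ∂P) j = ∫ x, Y x j ∂P := fun j =>
    ((EuclideanSpace.proj (𝕜 := ℝ) j).integral_comp_comm hYi).symm
  have hdev : ∀ (j : Fin d) (τ : Fin n → X), ((n : ℝ)⁻¹ • ∑ i, Y (τ i) - ∫ x, Y x ∂P) j
      = (n : ℝ)⁻¹ * ∑ i, Y (τ i) j - ∫ x, Y x j ∂P := by
    intro j τ
    rw [PiLp.sub_apply, PiLp.smul_apply, smul_eq_mul, hmean, WithLp.ofLp_sum, Finset.sum_apply]
  have hdevL : ∀ j, MemLp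
      (fun τ : Fin n → X => (n : ℝ)⁻¹ * ∑ i, Y (τ i) j - ∫ x, Y x j ∂P) 2 Q := fun j =>
    ((memLp_finsetSum _ fun i _ => (hcoord j).comp_measurePreserving
      (measurePreserving_eval (fun _ : Fin n => P) i)).const_mul _).sub (memLp_const _)
  have hKr : ∫ x, ‖Y x‖ ^ 2 ∂P ≤ K := by
    rw [integral_eq_lintegral_of_nonneg_ae (ae_of_all _ fun _ => by positivity)
      (hY.norm.pow_const 2).aestronglyMeasurable]
    exact ENNReal.toReal_le_of_le_ofReal hK0 hK
  simp only [EuclideanSpace.real_norm_sq_eq] at hKr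
  rw [integral_finsetSum _ fun j _ => (hcoord j).integrable_sq] at hKr
  simp only [EuclideanSpace.real_norm_sq_eq, hdev]
  rw [← ofReal_integral_eq_lintegral_ofReal
    (integrable_finsetSum _ fun j _ => (hdevL j).integrable_sq)
    (ae_of_all _ fun _ => Finset.sum_nonneg fun _ _ => sq_nonneg _)]
  apply ENNReal.ofReal_le_ofReal
  rw [integral_finsetSum _ fun j _ => (hdevL j).integrable_sq]
  refine (Finset.sum_le_sum fun j _ => integral_avg_sub_sq_le (hYj j) (hcoord j) hn).trans ?_
  rw [← Finset.mul_sum, div_eq_inv_mul]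
  gcongr

end Concentration

end Sampling

/-! ### Differentiation under the integral without local domination -/

section ParametricIntegrals

section Leibniz

variable {X : Type*} [MeasurableSpace X] {E : Type*} [NormedAddCommGroup E] [NormedSpace ℝ E]
  {F : Type*} [NormedAddCommGroup F] [NormedSpace ℝ F]

/-- A parametrized family of functions `k θ` whose derivative `k' θ` is dominated by `p θ * W θ`,
where `p θ` is a continuously parametrized probability density and `W θ` has bounded second
moments with respect to it. -/
structure WeightedFamily (ν : Measure X) (p : E → X → ℝ) (k : E → X → F) (k' : E → X → E →L[ℝ] F)
    (W : E → X → ℝ) (K : ℝ) : Prop where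
  weight_nonneg : ∀ θ x, 0 ≤ p θ x
  measurable_weight : ∀ θ, Measurable (p θ)
  continuous_weight : ∀ x, Continuous fun θ => p θ x
  lintegral_weight : ∀ θ, ∫⁻ x, ENNReal.ofReal (p θ x) ∂ν = 1
  integrable : ∀ θ, Integrable (k θ) ν
  hasFDerivAt : ∀ θ x, HasFDerivAt (fun θ => k θ x) (k' θ x) θ
  continuous_deriv : ∀ x, Continuous fun θ => k' θ x
  stronglyMeasurable_deriv : ∀ θ, StronglyMeasurable (k' θ)
  measurable_bound : ∀ θ, Measurable (W θ)
  norm_deriv_le : ∀ θ x, ‖k' θ x‖ ≤ p θ x * W θ x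
  moment_le : ∀ θ, ∫⁻ x, ENNReal.ofReal (p θ x * W θ x ^ 2) ∂ν ≤ ENNReal.ofReal K

variable {ν : Measure X} {p : E → X → ℝ} {k : E → X → F} {k' : E → X → E →L[ℝ] F}
  {W : E → X → ℝ} {K : ℝ}

omit [NormedSpace ℝ E] in
theorem tendsto_lintegral_posPart_sub {p : E → X → ℝ} (hp0 : ∀ θ x, 0 ≤ p θ x)
    (hpm : ∀ θ, Measurable (p θ)) (hpc : ∀ x, Continuous fun θ => p θ x)
    (hp1 : ∀ θ, ∫⁻ x, ENNReal.ofReal (p θ x) ∂ν = 1) (θ₀ : E) :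
    Tendsto (fun θ => ∫⁻ x, ENNReal.ofReal (p θ x - p θ₀ x) ∂ν) (𝓝 θ₀) (𝓝 0) := by
  -- Scheffé's argument: equal masses give the positive and negative parts equal integrals, and the
  -- part `p θ₀ - p θ` is dominated by `p θ₀`.
  have heq : ∀ θ, ∫⁻ x, ENNReal.ofReal (p θ x - p θ₀ x) ∂ν
      = ∫⁻ x, ENNReal.ofReal (p θ₀ x - p θ x) ∂ν := by
    intro θ
    have h := hp1 θ
    have h0 := hp1 θ₀
    have hm := hpm θ
    have hm0 := hpm θ₀
    have hsum : ∫⁻ x, (ENNReal.ofReal (p θ₀ x) + ENNReal.ofReal (p θ x - p θ₀ x)) ∂ν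
        = ∫⁻ x, (ENNReal.ofReal (p θ x) + ENNReal.ofReal (p θ₀ x - p θ x)) ∂ν := by
      refine lintegral_congr fun x => ?_
      have a := hp0 θ x
      have b := hp0 θ₀ x
      rcases le_total (p θ x) (p θ₀ x) with hle | hle
      · rw [ENNReal.ofReal_of_nonpos (by linarith : p θ x - p θ₀ x ≤ 0), add_zero,
          ← ENNReal.ofReal_add a (by linarith)]
        congr 1; ring
      · rw [ENNReal.ofReal_of_nonpos (by linarith : p θ₀ x - p θ x ≤ 0), add_zero,
          ← ENNReal.ofReal_add b (by linarith)]
        congr 1; ring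
    rw [lintegral_add_left (by fun_prop), lintegral_add_left (by fun_prop), h, h0] at hsum
    exact (ENNReal.add_right_inj ENNReal.one_ne_top).1 hsum
  simp only [heq]
  have hlim : ∀ x, Tendsto (fun θ => ENNReal.ofReal (p θ₀ x - p θ x)) (𝓝 θ₀) (𝓝 0) := by
    intro x
    have h : Tendsto (fun θ => p θ₀ x - p θ x) (𝓝 θ₀) (𝓝 (p θ₀ x - p θ₀ x)) :=
      tendsto_const_nhds.sub (hpc x).continuousAt
    rw [sub_self] at h
    simpa using ENNReal.tendsto_ofReal h
  have := tendsto_lintegral_filter_of_dominated_convergence (μ := ν) (l := 𝓝 θ₀)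
    (F := fun θ x => ENNReal.ofReal (p θ₀ x - p θ x)) (f := fun _ => 0)
    (fun x => ENNReal.ofReal (p θ₀ x))
    (Eventually.of_forall fun θ => by have := hpm θ; have := hpm θ₀; fun_prop)
    (Eventually.of_forall fun θ => ae_of_all _ fun x =>
      ENNReal.ofReal_le_ofReal (by linarith [hp0 θ x]))
    (by rw [hp1]; exact ENNReal.one_ne_top) (ae_of_all _ hlim)
  simpa using this

namespace WeightedFamily

variable (h : WeightedFamily ν p k k' W K)
include h

/-- Truncation at level `c`, by `W ≤ c + W ^ 2 / c`. The first term is dominated by a multiple of `p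
θ₀`, the second is small by Scheffé, and the last has integral of order `1 / c` uniformly in `θ`. -/
theorem norm_deriv_sub_le (θ θ₀ : E) (x : X) {c : ℝ} (hc : 0 < c) :
    ‖k' θ x - k' θ₀ x‖ ≤ min ‖k' θ x - k' θ₀ x‖ (2 * c * p θ₀ x)
      + (c * max (p θ x - p θ₀ x) 0
        + (p θ x * W θ x ^ 2 / c + p θ₀ x * W θ₀ x ^ 2 / c)) := by
  have key : ∀ θ, ‖k' θ x‖ ≤ c * p θ x + p θ x * W θ x ^ 2 / c := by
    intro θ
    refine (h.norm_deriv_le θ x).trans ?_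
    have hp := h.weight_nonneg θ x
    have : W θ x ≤ c + W θ x ^ 2 / c := by
      rw [← sub_nonneg]
      have : c + W θ x ^ 2 / c - W θ x = ((c - W θ x / 2) ^ 2 + 3 / 4 * W θ x ^ 2) / c := by
        field_simp; ring
      rw [this]; positivity
    calc p θ x * W θ x ≤ p θ x * (c + W θ x ^ 2 / c) := by gcongr
      _ = _ := by ring
  have h1 := key θ
  have h2 := key θ₀
  have h3 := norm_sub_le (k' θ x) (k' θ₀ x)
  have hp := h.weight_nonneg θ x
  have hp' := h.weight_nonneg θ₀ x
  have h4 : p θ x ≤ p θ₀ x + max (p θ x - p θ₀ x) 0 := by linarith [le_max_left (p θ x - p θ₀ x) 0]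
  have h5 : c * p θ x ≤ c * p θ₀ x + c * max (p θ x - p θ₀ x) 0 := by
    rw [← mul_add]; gcongr
  have h6 : 0 ≤ p θ x * W θ x ^ 2 / c := by positivity
  have h7 : 0 ≤ p θ₀ x * W θ₀ x ^ 2 / c := by positivity
  have h8 : 0 ≤ c * max (p θ x - p θ₀ x) 0 := by positivity
  rcases le_total ‖k' θ x - k' θ₀ x‖ (2 * c * p θ₀ x) with h9 | h9
  · rw [min_eq_left h9]; linarith
  · rw [min_eq_right h9]; linarith

theorem integrable_deriv (θ : E) : Integrable (k' θ) ν := by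
  refine ⟨(h.stronglyMeasurable_deriv θ).aestronglyMeasurable, ?_⟩
  have hm := h.measurable_weight θ
  have hW := h.measurable_bound θ
  rw [hasFiniteIntegral_iff_norm]
  calc ∫⁻ x, ENNReal.ofReal ‖k' θ x‖ ∂ν
      ≤ ∫⁻ x, (ENNReal.ofReal (p θ x) + ENNReal.ofReal (p θ x * W θ x ^ 2)) ∂ν := by
        refine lintegral_mono fun x => ?_
        have hp := h.weight_nonneg θ x
        rw [← ENNReal.ofReal_add hp (by positivity)]
        apply ENNReal.ofReal_le_ofReal
        refine (h.norm_deriv_le θ x).trans ?_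
        have : W θ x ≤ 1 + W θ x ^ 2 := by nlinarith [sq_nonneg (W θ x - 1 / 2)]
        nlinarith
    _ < ⊤ := by
        rw [lintegral_add_left (by fun_prop), h.lintegral_weight]
        exact ENNReal.add_lt_top.2 ⟨ENNReal.one_lt_top,
          (h.moment_le θ).trans_lt ENNReal.ofReal_lt_top⟩

theorem tendsto_lintegral_deriv (θ₀ : E) :
    Tendsto (fun θ => ∫⁻ x, ‖k' θ x - k' θ₀ x‖ₑ ∂ν) (𝓝 θ₀) (𝓝 0) := by
  have hpos := tendsto_lintegral_posPart_sub h.weight_nonneg h.measurable_weight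
    h.continuous_weight h.lintegral_weight θ₀
  have hsm : ∀ θ, StronglyMeasurable fun x => k' θ x - k' θ₀ x := fun θ =>
    (h.stronglyMeasurable_deriv θ).sub (h.stronglyMeasurable_deriv θ₀)
  have hmeas : ∀ θ, Measurable fun x => ‖k' θ x - k' θ₀ x‖ := fun θ => (hsm θ).norm.measurable
  have hbound : ∀ c : ℝ, 0 < c → ∀ θ, ∫⁻ x, ‖k' θ x - k' θ₀ x‖ₑ ∂ν ≤
      ∫⁻ x, ENNReal.ofReal (min ‖k' θ x - k' θ₀ x‖ (2 * c * p θ₀ x)) ∂ν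
      + (ENNReal.ofReal c * ∫⁻ x, ENNReal.ofReal (p θ x - p θ₀ x) ∂ν
        + ENNReal.ofReal (2 * K / c)) := by
    intro c hc θ
    have m1 := h.measurable_weight θ
    have m2 := h.measurable_weight θ₀
    have m3 := h.measurable_bound θ
    have m4 := h.measurable_bound θ₀
    have m5 := hmeas θ
    have hmom : ∀ θ, Measurable (p θ) → Measurable (W θ) →
        ∫⁻ x, ENNReal.ofReal (p θ x * W θ x ^ 2 / c) ∂ν ≤ ENNReal.ofReal (K / c) := by
      intro θ n1 n2
      have : ∀ x, ENNReal.ofReal (p θ x * W θ x ^ 2 / c)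
          = ENNReal.ofReal c⁻¹ * ENNReal.ofReal (p θ x * W θ x ^ 2) := fun x => by
        rw [← ENNReal.ofReal_mul (by positivity)]; congr 1; field_simp
      simp only [this]
      rw [lintegral_const_mul _ (by fun_prop)]
      calc _ ≤ ENNReal.ofReal c⁻¹ * ENNReal.ofReal K := by gcongr; exact h.moment_le θ
        _ = _ := by rw [← ENNReal.ofReal_mul (by positivity)]; congr 1; field_simp
    calc ∫⁻ x, ‖k' θ x - k' θ₀ x‖ₑ ∂ν
        ≤ ∫⁻ x, (ENNReal.ofReal (min ‖k' θ x - k' θ₀ x‖ (2 * c * p θ₀ x))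
          + (ENNReal.ofReal c * ENNReal.ofReal (p θ x - p θ₀ x)
            + (ENNReal.ofReal (p θ x * W θ x ^ 2 / c)
              + ENNReal.ofReal (p θ₀ x * W θ₀ x ^ 2 / c)))) ∂ν := by
          refine lintegral_mono fun x => ?_
          have hp := h.weight_nonneg θ x
          have hp' := h.weight_nonneg θ₀ x
          simp only
          rw [← ofReal_norm, ← ENNReal.ofReal_add (by positivity) (by positivity),
            ← ENNReal.ofReal_mul hc.le]
          have e : ENNReal.ofReal (c * (p θ x - p θ₀ x))
              = ENNReal.ofReal (c * max (p θ x - p θ₀ x) 0) := by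
            rw [ENNReal.ofReal_mul hc.le, ENNReal.ofReal_mul hc.le, ENNReal.ofReal_max]
            simp
          rw [e, ← ENNReal.ofReal_add (by positivity) (by positivity),
            ← ENNReal.ofReal_add (by positivity) (by positivity)]
          exact ENNReal.ofReal_le_ofReal (h.norm_deriv_sub_le θ θ₀ x hc)
      _ ≤ _ := by
          rw [lintegral_add_left (by fun_prop), lintegral_add_left (by fun_prop),
            lintegral_add_left (by fun_prop), lintegral_const_mul _ (by fun_prop)]
          gcongr
          refine (add_le_add (hmom θ m1 m3) (hmom θ₀ m2 m4)).trans ?_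
          rcases le_total 0 K with hK | hK
          · rw [← ENNReal.ofReal_add (by positivity) (by positivity)]
            apply ENNReal.ofReal_le_ofReal
            rw [← add_div, two_mul]
          · rw [ENNReal.ofReal_of_nonpos (div_nonpos_of_nonpos_of_nonneg hK hc.le)]
            simp
  rw [ENNReal.tendsto_nhds_zero]
  intro ε hε
  obtain ⟨δ, hδ, hδε⟩ : ∃ δ : ℝ, 0 < δ ∧ ENNReal.ofReal δ ≤ ε := by
    rcases eq_or_ne ε ⊤ with rfl | hne
    · exact ⟨1, one_pos, le_top⟩
    · exact ⟨ε.toReal, ENNReal.toReal_pos hε.ne' hne, (ENNReal.ofReal_toReal hne).le⟩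
  -- The level is fixed first, by the moment bound alone; only then does `θ` tend to `θ₀` in the
  -- other two terms.
  obtain ⟨c, hc, hcK⟩ : ∃ c : ℝ, 0 < c ∧ 2 * K / c ≤ δ / 3 := by
    refine ⟨6 * (|K| + 1) / δ, by positivity, ?_⟩
    rw [div_le_iff₀ (by positivity)]
    field_simp
    linarith [le_abs_self K]
  have hmin : Tendsto (fun θ => ∫⁻ x, ENNReal.ofReal
      (min ‖k' θ x - k' θ₀ x‖ (2 * c * p θ₀ x)) ∂ν) (𝓝 θ₀) (𝓝 0) := by
    have hlim : ∀ x, Tendsto (fun θ => ENNReal.ofReal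
        (min ‖k' θ x - k' θ₀ x‖ (2 * c * p θ₀ x))) (𝓝 θ₀) (𝓝 0) := by
      intro x
      have hp' := h.weight_nonneg θ₀ x
      have t : Tendsto (fun θ => min ‖k' θ x - k' θ₀ x‖ (2 * c * p θ₀ x)) (𝓝 θ₀)
          (𝓝 (min ‖k' θ₀ x - k' θ₀ x‖ (2 * c * p θ₀ x))) :=
        (((h.continuous_deriv x).sub continuous_const).norm.min continuous_const).continuousAt
      rw [sub_self, norm_zero, min_eq_left (by positivity)] at t
      simpa using ENNReal.tendsto_ofReal t
    have := tendsto_lintegral_filter_of_dominated_convergence (μ := ν) (l := 𝓝 θ₀)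
      (F := fun θ x => ENNReal.ofReal (min ‖k' θ x - k' θ₀ x‖ (2 * c * p θ₀ x)))
      (f := fun _ => 0) (fun x => ENNReal.ofReal (2 * c) * ENNReal.ofReal (p θ₀ x))
      (Eventually.of_forall fun θ => by
        have := hmeas θ; have := h.measurable_weight θ₀; fun_prop)
      (Eventually.of_forall fun θ => ae_of_all _ fun x => by
        rw [← ENNReal.ofReal_mul (by positivity)]
        exact ENNReal.ofReal_le_ofReal (min_le_right _ _))
      (by
        have := h.measurable_weight θ₀
        rw [lintegral_const_mul _ (by fun_prop), h.lintegral_weight, mul_one]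
        exact ENNReal.ofReal_ne_top) (ae_of_all _ hlim)
    simpa using this
  have hpos' : Tendsto (fun θ => ENNReal.ofReal c * ∫⁻ x, ENNReal.ofReal (p θ x - p θ₀ x) ∂ν)
      (𝓝 θ₀) (𝓝 0) := by
    simpa using ENNReal.Tendsto.const_mul hpos (Or.inr (ENNReal.ofReal_ne_top (r := c)))
  have hδ3 : 0 < ENNReal.ofReal (δ / 3) := ENNReal.ofReal_pos.2 (by positivity)
  filter_upwards [ENNReal.tendsto_nhds_zero.1 hmin _ hδ3,
    ENNReal.tendsto_nhds_zero.1 hpos' _ hδ3] with θ h1 h2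
  refine (hbound c hc θ).trans ?_
  calc _ ≤ ENNReal.ofReal (δ / 3) + (ENNReal.ofReal (δ / 3) + ENNReal.ofReal (δ / 3)) :=
        add_le_add h1 (add_le_add h2 (ENNReal.ofReal_le_ofReal hcK))
    _ = ENNReal.ofReal δ := by
        rw [← ENNReal.ofReal_add (by positivity) (by positivity),
          ← ENNReal.ofReal_add (by positivity) (by positivity)]
        congr 1; ring
    _ ≤ ε := hδε

theorem continuous_integral_deriv : Continuous fun θ => ∫ x, k' θ x ∂ν := by
  rw [continuous_iff_continuousAt]
  intro θ₀
  rw [ContinuousAt, tendsto_iff_edist_tendsto_0]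
  refine tendsto_of_tendsto_of_tendsto_of_le_of_le tendsto_const_nhds
    (h.tendsto_lintegral_deriv θ₀) (fun _ => zero_le) fun θ => ?_
  simp only
  rw [edist_eq_enorm_sub, ← integral_sub (h.integrable_deriv θ) (h.integrable_deriv θ₀)]
  exact enorm_integral_le_lintegral_enorm _

/-- The remainder is the integral of `k' - k' θ₀` along the segment. By Tonelli its norm is at most
an average over the segment of L¹ distances of derivatives, which are small near `θ₀`. -/
theorem hasFDerivAt_integral [SFinite ν] [CompleteSpace F] (θ₀ : E) :
    HasFDerivAt (fun θ => ∫ x, k θ x ∂ν) (∫ x, k' θ₀ x ∂ν) θ₀ := by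
  rw [hasFDerivAt_iff_isLittleO, isLittleO_iff]
  intro ε hε
  have hev := ENNReal.tendsto_nhds_zero.1 (h.tendsto_lintegral_deriv θ₀) (ENNReal.ofReal ε)
    (ENNReal.ofReal_pos.2 hε)
  obtain ⟨r, hr, hball⟩ := Metric.eventually_nhds_iff_ball.1 hev
  filter_upwards [Metric.ball_mem_nhds θ₀ hr] with θ hθ
  set v := θ - θ₀ with hv
  have hseg : ∀ s ∈ Set.Ioc (0 : ℝ) 1, θ₀ + s • v ∈ Metric.ball θ₀ r := by
    intro s hs
    rw [mem_ball_iff_norm, add_sub_cancel_left, norm_smul, Real.norm_eq_abs, abs_of_pos hs.1]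
    rw [mem_ball_iff_norm] at hθ
    exact (mul_le_of_le_one_left (norm_nonneg _) hs.2).trans_lt hθ
  have hpt : ∀ x, ‖k θ x - k θ₀ x - k' θ₀ x v‖ₑ
      ≤ ∫⁻ s in Set.Ioc (0 : ℝ) 1, ‖k' (θ₀ + s • v) x - k' θ₀ x‖ₑ * ‖v‖ₑ := by
    intro x
    have hder : ∀ s ∈ Set.uIcc (0 : ℝ) 1, HasDerivAt
        (fun s : ℝ => k (θ₀ + s • v) x - s • k' θ₀ x v)
        ((k' (θ₀ + s • v) x - k' θ₀ x) v) s := by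
      intro s _
      have hl : HasDerivAt (fun s : ℝ => θ₀ + s • v) v s := by
        simpa using ((hasDerivAt_id s).smul_const v).const_add θ₀
      have h1 := (h.hasFDerivAt (θ₀ + s • v) x).comp_hasDerivAt s hl
      have h2 := (hasDerivAt_id s).smul_const (k' θ₀ x v)
      simp only [one_smul] at h2
      rw [_root_.sub_apply]
      exact h1.sub h2
    have hcont : Continuous fun s : ℝ => (k' (θ₀ + s • v) x - k' θ₀ x) v := by
      have := (h.continuous_deriv x).comp (by fun_prop : Continuous fun s : ℝ => θ₀ + s • v)
      exact (this.sub continuous_const).clm_apply continuous_const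
    have hftc := intervalIntegral.integral_eq_sub_of_hasDerivAt hder
      (hcont.intervalIntegrable 0 1)
    have e : k θ x - k θ₀ x - k' θ₀ x v = ∫ s in (0 : ℝ)..1, (k' (θ₀ + s • v) x - k' θ₀ x) v := by
      rw [hftc]
      simp only [one_smul, zero_smul, add_zero, sub_zero, hv, add_sub_cancel]
      abel
    rw [e, intervalIntegral.integral_of_le zero_le_one]
    refine (enorm_integral_le_lintegral_enorm _).trans (lintegral_mono fun s => ?_)
    exact ContinuousLinearMap.le_opENorm _ _
  have hjoint : StronglyMeasurable fun z : ℝ × X => k' (θ₀ + z.1 • v) z.2 := by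
    refine stronglyMeasurable_uncurry_of_continuous_of_stronglyMeasurable
      (u := fun s x => k' (θ₀ + s • v) x) (fun x => ?_) fun s => ?_
    · exact (h.continuous_deriv x).comp (by fun_prop : Continuous fun s : ℝ => θ₀ + s • v)
    · exact h.stronglyMeasurable_deriv _
  have hjoint' : Measurable fun z : X × ℝ => ‖k' (θ₀ + z.2 • v) z.1 - k' θ₀ z.1‖ₑ * ‖v‖ₑ := by
    have h1 : StronglyMeasurable fun z : X × ℝ => k' (θ₀ + z.2 • v) z.1 :=
      hjoint.comp_measurable measurable_swap
    have h2 : StronglyMeasurable fun z : X × ℝ => k' θ₀ z.1 :=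
      (h.stronglyMeasurable_deriv θ₀).comp_measurable measurable_fst
    exact (h1.sub h2).enorm.mul_const _
  have happ : (∫ x, k' θ₀ x ∂ν) v = ∫ x, k' θ₀ x v ∂ν :=
    ContinuousLinearMap.integral_apply (h.integrable_deriv θ₀) v
  have hi : Integrable (fun x => k' θ₀ x v) ν := (h.integrable_deriv θ₀).apply_continuousLinearMap v
  have hmain : ‖∫ x, k θ x ∂ν - ∫ x, k θ₀ x ∂ν - (∫ x, k' θ₀ x ∂ν) v‖ₑ
      ≤ ENNReal.ofReal ε * ‖v‖ₑ := by
    have e : ∫ x, k θ x ∂ν - ∫ x, k θ₀ x ∂ν - (∫ x, k' θ₀ x ∂ν) v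
        = ∫ x, (k θ x - k θ₀ x - k' θ₀ x v) ∂ν := by
      have hs : Integrable (fun x => k θ x - k θ₀ x) ν := (h.integrable θ).sub (h.integrable θ₀)
      rw [happ, integral_sub hs hi, integral_sub (h.integrable θ) (h.integrable θ₀)]
    rw [e]
    calc _ ≤ ∫⁻ x, ‖k θ x - k θ₀ x - k' θ₀ x v‖ₑ ∂ν := enorm_integral_le_lintegral_enorm _
      _ ≤ ∫⁻ x, (∫⁻ s in Set.Ioc (0 : ℝ) 1, ‖k' (θ₀ + s • v) x - k' θ₀ x‖ₑ * ‖v‖ₑ) ∂ν :=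
          lintegral_mono hpt
      _ = ∫⁻ s in Set.Ioc (0 : ℝ) 1, ∫⁻ x, ‖k' (θ₀ + s • v) x - k' θ₀ x‖ₑ * ‖v‖ₑ ∂ν :=
          lintegral_lintegral_swap hjoint'.aemeasurable
      _ ≤ ∫⁻ _ in Set.Ioc (0 : ℝ) 1, ENNReal.ofReal ε * ‖v‖ₑ := by
          refine setLIntegral_mono measurable_const fun s hs => ?_
          rw [lintegral_mul_const' _ _ enorm_ne_top]
          gcongr
          exact hball _ (hseg s hs)
      _ = _ := by simp
  rw [← ofReal_norm, ← ofReal_norm, ← ENNReal.ofReal_mul hε.le] at hmain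
  exact (ENNReal.ofReal_le_ofReal_iff (by positivity)).1 hmain

end WeightedFamily

end Leibniz

/-! ### Measurability of parametric derivatives -/

section MeasurableDeriv

variable {X : Type*} [MeasurableSpace X] {E : Type*} [NormedAddCommGroup E] [NormedSpace ℝ E]
  {F : Type*} [NormedAddCommGroup F] [NormedSpace ℝ F]

/-- Derivatives with respect to a parameter depend measurably on the other variable. -/
theorem stronglyMeasurable_fderiv_apply {k : E → X → F} (hk : ∀ θ, StronglyMeasurable (k θ))
    (hd : ∀ θ x, DifferentiableAt ℝ (fun θ => k θ x) θ) (θ v : E) :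
    StronglyMeasurable fun x => fderiv ℝ (fun θ => k θ x) θ v := by
  have hlim : ∀ x, Tendsto (fun n : ℕ => ((n : ℝ) + 1) • (k (θ + ((n : ℝ) + 1)⁻¹ • v) x - k θ x))
      atTop (𝓝 (fderiv ℝ (fun θ => k θ x) θ v)) := by
    intro x
    exact ((hd θ x).hasFDerivAt.lim_real v).comp
      (tendsto_atTop_add_const_right _ _ tendsto_natCast_atTop_atTop)
  exact stronglyMeasurable_of_tendsto atTop (fun n => ((hk _).sub (hk _)).const_smul _)
    (tendsto_pi_nhds.2 hlim)

theorem stronglyMeasurable_of_apply [FiniteDimensional ℝ E] {A : X → E →L[ℝ] F}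
    (hA : ∀ v, StronglyMeasurable fun x => A x v) : StronglyMeasurable A := by
  set b := Module.finBasis ℝ E
  have e : A = fun x => ∑ j, ContinuousLinearMap.smulRightL ℝ E F
      (LinearMap.toContinuousLinearMap (b.coord j)) (A x (b j)) := by
    ext x v
    simp only [_root_.sum_apply, ContinuousLinearMap.smulRightL_apply_apply]
    conv_lhs => rw [← b.sum_repr v, map_sum]
    simp
  rw [e]
  exact Finset.stronglyMeasurable_fun_sum _ fun j _ =>
    (ContinuousLinearMap.continuous _).comp_stronglyMeasurable (hA _)

theorem stronglyMeasurable_fderiv [FiniteDimensional ℝ E]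
    {k : E → X → F} (hk : ∀ θ, StronglyMeasurable (k θ))
    (hd : ∀ θ x, DifferentiableAt ℝ (fun θ => k θ x) θ) (θ : E) :
    StronglyMeasurable fun x => fderiv ℝ (fun θ => k θ x) θ :=
  stronglyMeasurable_of_apply fun v => stronglyMeasurable_fderiv_apply hk hd θ v

end MeasurableDeriv

end ParametricIntegrals

/-! ### The law of a trajectory -/

section TrajectoryLaw

attribute [instance] MDP.sigmaFinite_refS
attribute [instance] MDP.sigmaFinite_refA

variable {S A : Type*} [MeasurableSpace S] [MeasurableSpace A]

namespace MDP

variable (𝔐 : MDP S A) (H : ℕ)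

/-- The reference measure on trajectories. -/
abbrev base : Measure (Traj S A H) := Measure.pi fun _ : Fin H => 𝔐.refS.prod 𝔐.refA

variable {H}

/-- The density of the state at step `h` given the past. -/
def stateDens (h : Fin H) (τ : Traj S A H) : ℝ :=
  if (h : ℕ) = 0 then 𝔐.init (τ h).1
  else 𝔐.trans (τ ⟨h - 1, by omega⟩).1 (τ ⟨h - 1, by omega⟩).2 (τ h).1

theorem stateDens_nonneg (h : Fin H) (τ : Traj S A H) : 0 ≤ 𝔐.stateDens h τ := by
  unfold stateDens
  split_ifs
  · exact 𝔐.init_nonneg _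
  · exact 𝔐.trans_nonneg _ _ _

theorem measurable_stateDens (h : Fin H) : Measurable (𝔐.stateDens (H := H) h) := by
  unfold stateDens
  split_ifs
  · exact 𝔐.measurable_init.comp (by fun_prop)
  · exact 𝔐.measurable_trans.comp (g := fun x : S × A × S => 𝔐.trans x.1 x.2.1 x.2.2)
      (f := fun τ : Traj S A H => ((τ ⟨h - 1, by omega⟩).1, (τ ⟨h - 1, by omega⟩).2, (τ h).1))
      (by fun_prop)

theorem stateDens_congr {h : Fin H} {τ τ' : Traj S A H} (hτ : ∀ i ≤ h, τ i = τ' i) :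
    𝔐.stateDens h τ = 𝔐.stateDens h τ' := by
  unfold stateDens
  rw [hτ h le_rfl, hτ ⟨h - 1, by omega⟩ (by rw [Fin.le_def]; simp)]

/-- The product of the state densities: initial density times transition densities. -/
def stateProd [NeZero H] (τ : Traj S A H) : ℝ :=
  𝔐.init (τ 0).1 *
    (∏ h : Fin H, if hh : (h : ℕ) + 1 < H then
      𝔐.trans (τ h).1 (τ h).2 (τ ⟨(h : ℕ) + 1, hh⟩).1 else 1)

/-- A shift of index: `stateDens` attaches a transition to the state it leads to, whereas
`stateProd` attaches it to the state it leaves. -/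
theorem prod_stateDens [hH : NeZero H] (τ : Traj S A H) :
    ∏ h, 𝔐.stateDens h τ = 𝔐.stateProd τ := by
  obtain ⟨n, rfl⟩ : ∃ n, H = n + 1 := ⟨H - 1, by have := NeZero.ne H; omega⟩
  rw [stateProd, Fin.prod_univ_succ, Fin.prod_univ_castSucc]
  congr 1
  simp only [Fin.val_last, lt_irrefl, dite_false, mul_one]
  refine Finset.prod_congr rfl fun i _ => ?_
  rw [dif_pos (by simp)]
  rfl

end MDP

namespace Policy

variable {𝔐 : MDP S A} {d : ℕ} (π : Policy 𝔐 d) {H : ℕ}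

/-- The density of a trajectory when the policy parameter may change with the step. -/
def genDensity (ϑ : Fin H → Param d) (τ : Traj S A H) : ℝ :=
  ∏ h, (𝔐.stateDens h τ * π.dens (ϑ h) (τ h).1 (τ h).2)

theorem genDensity_nonneg (ϑ : Fin H → Param d) (τ : Traj S A H) : 0 ≤ π.genDensity ϑ τ :=
  Finset.prod_nonneg fun _ _ => mul_nonneg (𝔐.stateDens_nonneg _ _) (π.dens_pos _ _ _).le

theorem measurable_dens_comp {X : Type*} [MeasurableSpace X] (θ : Param d) {f : X → S × A}
    (hf : Measurable f) : Measurable fun x => π.dens θ (f x).1 (f x).2 :=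
  (π.measurable_dens θ).comp hf

theorem measurable_genDensity (ϑ : Fin H → Param d) : Measurable (π.genDensity ϑ) :=
  Finset.measurable_fun_prod _ fun h _ =>
    (𝔐.measurable_stateDens h).mul (π.measurable_dens_comp _ (by fun_prop))

theorem trajDensity_eq_genDensity [NeZero H] (θ : Param d) (τ : Traj S A H) :
    π.trajDensity H θ τ = π.genDensity (fun _ => θ) τ := by
  rw [genDensity, Finset.prod_mul_distrib, 𝔐.prod_stateDens]
  rfl

/-- Conditionally on the past, the pair of state and action at step `h` has total mass one. -/
theorem lintegral_step (θ : Param d) (h : Fin H) (τ : Traj S A H) :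
    ∫⁻ y, ENNReal.ofReal (𝔐.stateDens h (Function.update τ h y) * π.dens θ y.1 y.2)
      ∂(𝔐.refS.prod 𝔐.refA) = 1 := by
  obtain ⟨q, hqm, hq, hq1⟩ : ∃ q : S → ℝ, Measurable q ∧
      (∀ y, 𝔐.stateDens h (Function.update τ h y) = q y.1) ∧
      ∫⁻ s, ENNReal.ofReal (q s) ∂𝔐.refS = 1 := by
    by_cases h0 : (h : ℕ) = 0
    · exact ⟨𝔐.init, 𝔐.measurable_init, fun y => by simp [MDP.stateDens, h0], 𝔐.lintegral_init⟩
    · refine ⟨𝔐.trans (τ ⟨h - 1, by omega⟩).1 (τ ⟨h - 1, by omega⟩).2, ?_, fun y => ?_,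
        𝔐.lintegral_trans _ _⟩
      · exact 𝔐.measurable_trans.comp (g := fun x : S × A × S => 𝔐.trans x.1 x.2.1 x.2.2)
          (f := fun s => (_, _, s)) (by fun_prop)
      · have : (⟨h - 1, by omega⟩ : Fin H) ≠ h := by
          intro e
          have := congrArg Fin.val e
          simp only at this
          omega
        simp [MDP.stateDens, h0, this]
  have hm : Measurable fun y : S × A => ENNReal.ofReal (q y.1 * π.dens θ y.1 y.2) :=
    ((hqm.comp measurable_fst).mul (π.measurable_dens_comp θ measurable_id)).ennreal_ofReal
  simp only [hq]
  rw [lintegral_prod _ hm.aemeasurable]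
  calc _ = ∫⁻ s, ENNReal.ofReal (q s) * ∫⁻ a, ENNReal.ofReal (π.dens θ s a) ∂𝔐.refA ∂𝔐.refS := by
        refine lintegral_congr fun s => ?_
        rw [← lintegral_const_mul]
        · refine lintegral_congr fun a => ?_
          simp only
          rw [ENNReal.ofReal_mul' (π.dens_pos _ _ _).le]
        · exact (π.measurable_dens_comp θ (f := fun a => (s, a)) (by fun_prop)).ennreal_ofReal
    _ = 1 := by simp [π.lintegral_dens, hq1]

/-- A function on trajectories that only depends on the steps before `m`. -/
def _root_.DRSOPO.DependsBefore {β : Type*} (m : ℕ) (φ : Traj S A H → β) : Prop :=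
  ∀ τ τ', (∀ i : Fin H, (i : ℕ) < m → τ i = τ' i) → φ τ = φ τ'

/-- The steps are integrated out from the last one backwards. Each contributes total mass one, since
neither `φ` nor the earlier factors see it; `n` counts the steps already removed. -/
theorem lmarginal_genDensity (ϑ : Fin H → Param d) {m : ℕ} {φ : Traj S A H → ENNReal}
    (hφm : Measurable φ) (hφ : DependsBefore m φ) :
    ∀ n j : ℕ, j + n = H → m ≤ j →
      lmarginal (fun _ : Fin H => 𝔐.refS.prod 𝔐.refA) (Finset.univ.filter fun i : Fin H => j ≤ i)
        (fun τ => φ τ * ENNReal.ofReal (π.genDensity ϑ τ))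
      = fun τ => φ τ * ∏ h ∈ Finset.univ.filter (fun i : Fin H => (i : ℕ) < j),
        ENNReal.ofReal (𝔐.stateDens h τ * π.dens (ϑ h) (τ h).1 (τ h).2) := by
  have hfac : ∀ h (τ : Traj S A H), 0 ≤ 𝔐.stateDens h τ * π.dens (ϑ h) (τ h).1 (τ h).2 := fun h τ =>
    mul_nonneg (𝔐.stateDens_nonneg _ _) (π.dens_pos _ _ _).le
  have hmeas : Measurable fun τ => φ τ * ENNReal.ofReal (π.genDensity ϑ τ) :=
    hφm.mul (π.measurable_genDensity ϑ).ennreal_ofReal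
  intro n
  induction n with
  | zero =>
    intro j hj hmj
    have e1 : (Finset.univ.filter fun i : Fin H => j ≤ (i : ℕ)) = ∅ := by
      ext i; simp; omega
    have e2 : (Finset.univ.filter fun i : Fin H => (i : ℕ) < j) = Finset.univ := by
      ext i; simp; omega
    rw [e1, e2, lmarginal_empty]
    ext τ
    rw [genDensity, ENNReal.ofReal_prod_of_nonneg fun h _ => hfac h τ]
  | succ n ih =>
    intro j hj hmj
    have hjH : j < H := by omega
    set J : Fin H := ⟨j, hjH⟩ with hJ
    have e1 : (Finset.univ.filter fun i : Fin H => j ≤ (i : ℕ))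
        = insert J (Finset.univ.filter fun i : Fin H => j + 1 ≤ (i : ℕ)) := by
      ext i
      simp only [Finset.mem_filter, Finset.mem_univ, true_and, Finset.mem_insert, Fin.ext_iff, hJ]
      omega
    have e2 : (Finset.univ.filter fun i : Fin H => (i : ℕ) < j + 1)
        = insert J (Finset.univ.filter fun i : Fin H => (i : ℕ) < j) := by
      ext i
      simp only [Finset.mem_filter, Finset.mem_univ, true_and, Finset.mem_insert, Fin.ext_iff, hJ]
      omega
    have hnot : J ∉ Finset.univ.filter fun i : Fin H => (i : ℕ) < j := by simp [hJ]
    ext τ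
    rw [e1, lmarginal_insert _ hmeas (by simp [hJ]), ih (j + 1) (by omega) (by omega)]
    have hupd : ∀ y (i : Fin H), (i : ℕ) < j → Function.update τ J y i = τ i := fun y i hi =>
      Function.update_of_ne (by rw [Ne, Fin.ext_iff]; simp only [hJ]; omega) _ _
    calc _ = ∫⁻ y, (φ τ * ∏ h ∈ Finset.univ.filter (fun i : Fin H => (i : ℕ) < j),
          ENNReal.ofReal (𝔐.stateDens h τ * π.dens (ϑ h) (τ h).1 (τ h).2)) *
          ENNReal.ofReal (𝔐.stateDens J (Function.update τ J y) * π.dens (ϑ J) y.1 y.2)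
          ∂(𝔐.refS.prod 𝔐.refA) := by
          refine lintegral_congr fun y => ?_
          beta_reduce
          rw [e2, Finset.prod_insert hnot, hφ _ τ fun i hi => hupd y i (by omega),
            Function.update_self, mul_comm (ENNReal.ofReal _), ← mul_assoc]
          congr 2
          refine Finset.prod_congr rfl fun h hh => ?_
          have hh' : (h : ℕ) < j := by simpa using hh
          rw [hupd y h hh', 𝔐.stateDens_congr fun i hi => hupd y i
            (lt_of_le_of_lt (Fin.le_def.1 hi) hh')]
      _ = _ := by
          have hq : Measurable fun y : S × A => ENNReal.ofReal
              (𝔐.stateDens J (Function.update τ J y) * π.dens (ϑ J) y.1 y.2) :=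
            (((𝔐.measurable_stateDens J).comp (measurable_update τ)).mul
              (π.measurable_dens_comp (ϑ J) measurable_id)).ennreal_ofReal
          rw [lintegral_const_mul _ hq, π.lintegral_step, mul_one]

theorem nonempty_traj (π : Policy 𝔐 d) : Nonempty (Traj S A H) := by
  have hS : Nonempty S := by
    by_contra hS
    rw [not_nonempty_iff] at hS
    have := 𝔐.lintegral_init
    simp [lintegral_of_isEmpty] at this
  obtain ⟨s⟩ := hS
  have hA : Nonempty A := by
    by_contra hA
    rw [not_nonempty_iff] at hA
    have := π.lintegral_dens 0 s
    simp [lintegral_of_isEmpty] at this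
  obtain ⟨a⟩ := hA
  exact ⟨fun _ => (s, a)⟩

/-- The parameters used after step `m` do not influence expectations of functions of the first `m`
steps. -/
theorem lintegral_genDensity_congr {ϑ ϑ' : Fin H → Param d} {m : ℕ} (hm : m ≤ H)
    (hϑ : ∀ i : Fin H, (i : ℕ) < m → ϑ i = ϑ' i) {φ : Traj S A H → ENNReal} (hφm : Measurable φ)
    (hφ : DependsBefore m φ) :
    ∫⁻ τ, φ τ * ENNReal.ofReal (π.genDensity ϑ τ) ∂(𝔐.base H)
      = ∫⁻ τ, φ τ * ENNReal.ofReal (π.genDensity ϑ' τ) ∂(𝔐.base H) := by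
  refine lintegral_eq_of_lmarginal_eq (Finset.univ.filter fun i : Fin H => m ≤ i)
    (hφm.mul (π.measurable_genDensity ϑ).ennreal_ofReal)
    (hφm.mul (π.measurable_genDensity ϑ').ennreal_ofReal) ?_
  rw [π.lmarginal_genDensity ϑ hφm hφ (H - m) m (by omega) le_rfl,
    π.lmarginal_genDensity ϑ' hφm hφ (H - m) m (by omega) le_rfl]
  ext τ
  congr 1
  refine Finset.prod_congr rfl fun h hh => ?_
  rw [hϑ h (by simpa using hh)]

theorem lintegral_genDensity (ϑ : Fin H → Param d) :
    ∫⁻ τ, ENNReal.ofReal (π.genDensity ϑ τ) ∂(𝔐.base H) = 1 := by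
  obtain ⟨τ⟩ := π.nonempty_traj (H := H)
  rw [lintegral_eq_lmarginal_univ τ]
  have := congrFun (π.lmarginal_genDensity ϑ (m := 0) (φ := fun _ => 1) measurable_const
    (fun _ _ _ => rfl) H 0 (by omega) le_rfl) τ
  simpa using this

/-- Expectations of bounded real functions of the first `m` steps. -/
theorem integral_genDensity_congr {ϑ ϑ' : Fin H → Param d} {m : ℕ} (hm : m ≤ H)
    (hϑ : ∀ i : Fin H, (i : ℕ) < m → ϑ i = ϑ' i) {φ : Traj S A H → ℝ} (hφm : Measurable φ)
    (hφ : DependsBefore m φ) (hφ0 : ∀ τ, 0 ≤ φ τ) :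
    ∫ τ, φ τ * π.genDensity ϑ τ ∂(𝔐.base H) = ∫ τ, φ τ * π.genDensity ϑ' τ ∂(𝔐.base H) := by
  have h := π.lintegral_genDensity_congr hm hϑ (φ := fun τ => ENNReal.ofReal (φ τ))
    hφm.ennreal_ofReal (fun τ τ' e => congrArg ENNReal.ofReal (hφ τ τ' e))
  have key : ∀ ϑ : Fin H → Param d, ∫ τ, φ τ * π.genDensity ϑ τ ∂(𝔐.base H)
      = (∫⁻ τ, ENNReal.ofReal (φ τ) * ENNReal.ofReal (π.genDensity ϑ τ) ∂(𝔐.base H)).toReal := by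
    intro ϑ
    rw [integral_eq_lintegral_of_nonneg_ae
      (ae_of_all _ fun τ => mul_nonneg (hφ0 τ) (π.genDensity_nonneg ϑ τ))
      (hφm.mul (π.measurable_genDensity ϑ)).aestronglyMeasurable]
    congr 1
    exact lintegral_congr fun τ => ENNReal.ofReal_mul (hφ0 τ)
  rw [key, key, h]

variable [NeZero H]

theorem law_eq (θ : Param d) : π.law H θ =
    (𝔐.base H).withDensity fun τ => ENNReal.ofReal (π.genDensity (fun _ => θ) τ) := by
  simp only [law, trajDensity_eq_genDensity]

instance isProbabilityMeasure_law (θ : Param d) : IsProbabilityMeasure (π.law H θ) :=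
  ⟨by rw [law_eq, withDensity_apply _ MeasurableSet.univ, Measure.restrict_univ,
    π.lintegral_genDensity]⟩

theorem lintegral_law (θ : Param d) (f : Traj S A H → ENNReal) :
    ∫⁻ τ, f τ ∂(π.law H θ)
      = ∫⁻ τ, f τ * ENNReal.ofReal (π.genDensity (fun _ => θ) τ) ∂(𝔐.base H) := by
  rw [law_eq, lintegral_withDensity_eq_lintegral_mul_non_measurable _
    (π.measurable_genDensity _).ennreal_ofReal (ae_of_all _ fun _ => ENNReal.ofReal_lt_top)]
  exact lintegral_congr fun τ => mul_comm _ _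

theorem integral_law {F : Type*} [NormedAddCommGroup F] [NormedSpace ℝ F] (θ : Param d)
    (f : Traj S A H → F) :
    ∫ τ, f τ ∂(π.law H θ) = ∫ τ, π.genDensity (fun _ => θ) τ • f τ ∂(𝔐.base H) := by
  rw [law_eq, integral_withDensity_eq_integral_toReal_smul
    (π.measurable_genDensity _).ennreal_ofReal (ae_of_all _ fun _ => ENNReal.ofReal_lt_top)]
  refine integral_congr_ae (ae_of_all _ fun τ => ?_)
  simp only [ENNReal.toReal_ofReal (π.genDensity_nonneg _ τ)]

theorem integrable_law {F : Type*} [NormedAddCommGroup F] [NormedSpace ℝ F] (θ : Param d)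
    {f : Traj S A H → F} :
    Integrable f (π.law H θ)
      ↔ Integrable (fun τ => π.genDensity (fun _ => θ) τ • f τ) (𝔐.base H) := by
  rw [law_eq, integrable_withDensity_iff_integrable_smul'
    (π.measurable_genDensity _).ennreal_ofReal (ae_of_all _ fun _ => ENNReal.ofReal_lt_top)]
  simp only [ENNReal.toReal_ofReal (π.genDensity_nonneg _ _)]

end Policy

end TrajectoryLaw

/-! ### Scores and their martingale property -/

section Scores

variable {S A : Type*} [MeasurableSpace S] [MeasurableSpace A]

theorem innerSL_gradient {d : ℕ} (f : Param d → ℝ) (θ : Param d) :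
    innerSL ℝ (gradient f θ) = fderiv ℝ f θ := by
  ext v
  rw [innerSL_apply_apply, gradient, InnerProductSpace.toDual_symm_apply]

namespace Policy

variable {𝔐 : MDP S A} {d : ℕ} (π : Policy 𝔐 d) {H : ℕ}

theorem contDiff_log_dens (s : S) (a : A) : ContDiff ℝ 2 fun θ => Real.log (π.dens θ s a) :=
  (π.contDiff_dens s a).log fun θ => (π.dens_pos θ s a).ne'

theorem hasFDerivAt_dens (θ : Param d) (s : S) (a : A) :
    HasFDerivAt (fun θ => π.dens θ s a) (π.dens θ s a • innerSL ℝ (π.score θ s a)) θ := by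
  have h1 : HasFDerivAt (fun θ => π.dens θ s a) (fderiv ℝ (fun θ => π.dens θ s a) θ) θ :=
    ((π.contDiff_dens s a).differentiable (by norm_num) θ).hasFDerivAt
  have h2 := h1.log (π.dens_pos θ s a).ne'
  have h3 : innerSL ℝ (π.score θ s a) = (π.dens θ s a)⁻¹ • fderiv ℝ (fun θ => π.dens θ s a) θ := by
    rw [score, innerSL_gradient, h2.fderiv]
  rw [h3, smul_smul, mul_inv_cancel₀ (π.dens_pos θ s a).ne', one_smul]
  exact h1

theorem contDiff_score (s : S) (a : A) : ContDiff ℝ 1 fun θ => π.score θ s a := by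
  have h := (π.contDiff_log_dens s a).fderiv_right (m := 1) (by norm_num)
  exact (InnerProductSpace.toDual ℝ (Param d)).symm.toContinuousLinearEquiv.contDiff.comp h

theorem continuous_score (s : S) (a : A) : Continuous fun θ => π.score θ s a :=
  (π.contDiff_score s a).continuous

theorem hasFDerivAt_score (θ : Param d) (s : S) (a : A) :
    HasFDerivAt (fun θ => π.score θ s a) (π.scoreDeriv θ s a) θ :=
  ((π.contDiff_score s a).differentiable (by norm_num) θ).hasFDerivAt

theorem continuous_scoreDeriv (s : S) (a : A) : Continuous fun θ => π.scoreDeriv θ s a :=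
  (π.contDiff_score s a).continuous_fderiv (by norm_num)

theorem stronglyMeasurable_score (θ : Param d) :
    StronglyMeasurable fun x : S × A => π.score θ x.1 x.2 := by
  have h := stronglyMeasurable_fderiv (k := fun θ (x : S × A) => Real.log (π.dens θ x.1 x.2))
    (fun θ => (π.measurable_dens θ).log.stronglyMeasurable)
    (fun θ x => (π.contDiff_log_dens x.1 x.2).differentiable (by norm_num) θ) θ
  exact (InnerProductSpace.toDual ℝ (Param d)).symm.continuous.comp_stronglyMeasurable h

theorem stronglyMeasurable_scoreDeriv (θ : Param d) :
    StronglyMeasurable fun x : S × A => π.scoreDeriv θ x.1 x.2 :=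
  stronglyMeasurable_fderiv (k := fun θ (x : S × A) => π.score θ x.1 x.2)
    π.stronglyMeasurable_score
    (fun θ x => (π.hasFDerivAt_score θ x.1 x.2).differentiableAt) θ

/-- The score of the action at step `h`. -/
def stepScore (θ : Param d) (h : Fin H) (τ : Traj S A H) : Param d :=
  π.score θ (τ h).1 (τ h).2

theorem stronglyMeasurable_stepScore (θ : Param d) (h : Fin H) :
    StronglyMeasurable (π.stepScore θ h) :=
  (π.stronglyMeasurable_score θ).comp_measurable (measurable_pi_apply h)

theorem measurable_stepScore (θ : Param d) (h : Fin H) : Measurable (π.stepScore θ h) :=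
  (π.stronglyMeasurable_stepScore θ h).measurable

/-- The sum of the scores of the steps before `m`. -/
def scoreSum (m : ℕ) (θ : Param d) (τ : Traj S A H) : Param d :=
  ∑ h ∈ Finset.univ.filter (fun h : Fin H => (h : ℕ) < m), π.stepScore θ h τ

theorem scoreSum_eq_sum (θ : Param d) (τ : Traj S A H) :
    π.scoreSum H θ τ = ∑ h, π.stepScore θ h τ := by
  rw [scoreSum, Finset.filter_true_of_mem fun h _ => h.2]

theorem scoreSum_succ (θ : Param d) (τ : Traj S A H) (j : Fin H) :
    π.scoreSum (j + 1) θ τ = π.stepScore θ j τ + π.scoreSum j θ τ := by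
  have e : (Finset.univ.filter fun i : Fin H => (i : ℕ) < j + 1)
      = insert j (Finset.univ.filter fun i : Fin H => (i : ℕ) < j) := by
    ext i
    simp only [Finset.mem_filter, Finset.mem_univ, true_and, Finset.mem_insert, Fin.ext_iff]
    omega
  rw [scoreSum, e, Finset.sum_insert (by simp), scoreSum]

theorem continuous_scoreSum (m : ℕ) (τ : Traj S A H) : Continuous fun θ => π.scoreSum m θ τ :=
  continuous_finsetSum _ fun _ _ => π.continuous_score _ _

theorem stronglyMeasurable_scoreSum (m : ℕ) (θ : Param d) :
    StronglyMeasurable (π.scoreSum (H := H) m θ) :=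
  Finset.stronglyMeasurable_fun_sum _ fun _ _ => π.stronglyMeasurable_stepScore θ _

theorem dependsBefore_scoreSum (m : ℕ) (θ : Param d) :
    DependsBefore m (π.scoreSum (H := H) m θ) := by
  intro τ τ' h
  refine Finset.sum_congr rfl fun i hi => ?_
  rw [stepScore, stepScore, h i (by simpa using hi)]

/-- The parameters of the policy that follows `θ` before step `m`, and `θ₀` afterwards. -/
def mixPar (m : ℕ) (θ θ₀ : Param d) (i : Fin H) : Param d := if (i : ℕ) < m then θ else θ₀

theorem mixPar_self (m : ℕ) (θ : Param d) : mixPar (H := H) m θ θ = fun _ => θ := by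
  ext i : 1
  simp [mixPar]

theorem mixPar_top (θ θ₀ : Param d) : mixPar (H := H) H θ θ₀ = fun _ => θ := by
  ext i : 1
  simp [mixPar]

theorem hasFDerivAt_genDensity_mixPar (m : ℕ) (θ θ₀ : Param d) (τ : Traj S A H) :
    HasFDerivAt (fun θ => π.genDensity (mixPar m θ θ₀) τ)
      (π.genDensity (mixPar m θ θ₀) τ • innerSL ℝ (π.scoreSum m θ τ)) θ := by
  have hstep : ∀ h : Fin H, HasFDerivAt
      (fun θ => 𝔐.stateDens h τ * π.dens (mixPar m θ θ₀ h) (τ h).1 (τ h).2)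
      ((𝔐.stateDens h τ * π.dens (mixPar m θ θ₀ h) (τ h).1 (τ h).2) •
        (if (h : ℕ) < m then innerSL ℝ (π.stepScore θ h τ) else 0)) θ := by
    intro h
    unfold mixPar
    split_ifs
    · have := (π.hasFDerivAt_dens θ (τ h).1 (τ h).2).const_mul (𝔐.stateDens h τ)
      rw [smul_smul] at this
      exact this
    · rw [smul_zero]; exact hasFDerivAt_const _ _
  have h := HasFDerivAt.finsetProd (u := Finset.univ) fun h _ => hstep h
  have e : π.genDensity (mixPar m θ θ₀) τ • innerSL ℝ (π.scoreSum m θ τ)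
      = ∑ i, (∏ j ∈ Finset.univ.erase i,
          𝔐.stateDens j τ * π.dens (mixPar m θ θ₀ j) (τ j).1 (τ j).2) •
        (𝔐.stateDens i τ * π.dens (mixPar m θ θ₀ i) (τ i).1 (τ i).2) •
          (if (i : ℕ) < m then innerSL ℝ (π.stepScore θ i τ) else 0) := by
    rw [scoreSum, map_sum, Finset.sum_filter, Finset.smul_sum]
    refine Finset.sum_congr rfl fun i _ => ?_
    rw [smul_smul, Finset.prod_erase_mul _ _ (Finset.mem_univ i), genDensity]
  rw [e]
  exact h

theorem continuous_genDensity_mixPar (m : ℕ) (θ₀ : Param d) (τ : Traj S A H) :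
    Continuous fun θ => π.genDensity (mixPar m θ θ₀) τ :=
  continuous_iff_continuousAt.2 fun θ =>
    (π.hasFDerivAt_genDensity_mixPar m θ θ₀ τ).continuousAt

/-- The standing assumptions on the costs and the policy. -/
structure Bounds [NeZero H] (R G L : ℝ) : Prop where
  R_nonneg : 0 ≤ R
  cost_le : ∀ s a, |𝔐.cost s a| ≤ R
  score_le : ∀ (θ : Param d) (h : Fin H),
    ∫⁻ τ, ENNReal.ofReal (‖π.stepScore θ h τ‖ ^ 4) ∂(π.law H θ) ≤ ENNReal.ofReal (G ^ 4)
  scoreDeriv_le : ∀ (θ : Param d) (h : Fin H),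
    ∫⁻ τ, ENNReal.ofReal (‖π.scoreDeriv θ (τ h).1 (τ h).2‖ ^ 2) ∂(π.law H θ)
      ≤ ENNReal.ofReal (L ^ 2)

namespace Bounds

variable {π} [NeZero H] {R G L : ℝ} (hπ : π.Bounds (H := H) R G L)
include hπ

theorem score_sq_le (θ : Param d) (h : Fin H) :
    ∫⁻ τ, ENNReal.ofReal (‖π.stepScore θ h τ‖ ^ 2) ∂(π.law H θ) ≤ ENNReal.ofReal (G ^ 2) := by
  have hm := π.measurable_stepScore θ h
  have h1 := sq_lintegral_le (P := π.law H θ)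
    (g := fun τ => ENNReal.ofReal (‖π.stepScore θ h τ‖ ^ 2)) (by fun_prop)
  have h2 : ∀ τ, ENNReal.ofReal (‖π.stepScore θ h τ‖ ^ 2) ^ 2
      = ENNReal.ofReal (‖π.stepScore θ h τ‖ ^ 4) := fun τ => by
    rw [← ENNReal.ofReal_pow (by positivity), ← pow_mul]
  simp only [h2] at h1
  have h3 := h1.trans (hπ.score_le θ h)
  have h4 : ENNReal.ofReal (G ^ 4) = ENNReal.ofReal (G ^ 2) ^ 2 := by
    rw [← ENNReal.ofReal_pow (by positivity), ← pow_mul]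
  rw [h4] at h3
  exact (ENNReal.pow_le_pow_left_iff two_ne_zero).1 h3

theorem memLp_stepScore (θ : Param d) (h : Fin H) : MemLp (π.stepScore θ h) 2 (π.law H θ) :=
  memLp_two_of_lintegral_le (π.stronglyMeasurable_stepScore θ h).aestronglyMeasurable
    (hπ.score_sq_le θ h)

theorem integrable_stepScore (θ : Param d) (h : Fin H) :
    Integrable (π.stepScore θ h) (π.law H θ) :=
  (hπ.memLp_stepScore θ h).integrable (by norm_num)

theorem scoreSum_sq_le (m : ℕ) (θ : Param d) :
    ∫⁻ τ, ENNReal.ofReal (‖π.scoreSum m θ τ‖ ^ 2) ∂(π.law H θ)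
      ≤ ENNReal.ofReal (H * (H * G ^ 2)) := by
  have hm := fun h : Fin H => π.measurable_stepScore θ h
  calc _ ≤ ∫⁻ τ, ENNReal.ofReal H * ∑ h : Fin H, ENNReal.ofReal (‖π.stepScore θ h τ‖ ^ 2)
        ∂(π.law H θ) := by
        refine lintegral_mono fun τ => ?_
        rw [← ENNReal.ofReal_sum_of_nonneg fun _ _ => by positivity,
          ← ENNReal.ofReal_mul (by positivity)]
        apply ENNReal.ofReal_le_ofReal
        calc ‖π.scoreSum m θ τ‖ ^ 2 ≤ (∑ h : Fin H, ‖π.stepScore θ h τ‖) ^ 2 := by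
              gcongr
              refine (norm_sum_le _ _).trans ?_
              exact Finset.sum_le_sum_of_subset_of_nonneg (Finset.filter_subset _ _)
                fun _ _ _ => norm_nonneg _
          _ ≤ _ := by
              have := sq_sum_le_card_mul_sum_sq (s := (Finset.univ : Finset (Fin H)))
                (f := fun h => ‖π.stepScore θ h τ‖)
              simpa using this
    _ ≤ ENNReal.ofReal H * ∑ _h : Fin H, ENNReal.ofReal (G ^ 2) := by
        rw [lintegral_const_mul _ (by fun_prop), lintegral_finsetSum _ fun h _ => by fun_prop]
        gcongr with h
        exact hπ.score_sq_le θ h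
    _ = _ := by
        rw [Finset.sum_const, Finset.card_univ, Fintype.card_fin, nsmul_eq_mul,
          ENNReal.ofReal_mul (by positivity), ENNReal.ofReal_mul (by positivity),
          ENNReal.ofReal_natCast]

/-- With the parameter frozen after step `m`, only the scores before `m` appear in the derivative.
They depend on those steps alone, so their moments may be computed under the law of `θ`, where the
assumption applies. -/
theorem weightedFamily_mix {m : ℕ} (hm : m ≤ H) (θ₀ : Param d) {φ : Traj S A H → ℝ}
    (hφm : Measurable φ) {B : ℝ} (hφ : ∀ τ, |φ τ| ≤ B) :
    WeightedFamily (𝔐.base H) (fun θ => π.genDensity (mixPar m θ θ₀))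
      (fun θ τ => φ τ * π.genDensity (mixPar m θ θ₀) τ)
      (fun θ τ => (φ τ * π.genDensity (mixPar m θ θ₀) τ) • innerSL ℝ (π.scoreSum m θ τ))
      (fun θ τ => B * ‖π.scoreSum m θ τ‖) (B ^ 2 * (H * (H * G ^ 2))) where
  weight_nonneg θ τ := π.genDensity_nonneg _ _
  measurable_weight θ := π.measurable_genDensity _
  continuous_weight τ := π.continuous_genDensity_mixPar m θ₀ τ
  lintegral_weight θ := π.lintegral_genDensity _
  integrable θ := by
    refine Integrable.bdd_mul (c := B) ⟨(π.measurable_genDensity _).aestronglyMeasurable, ?_⟩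
      hφm.aestronglyMeasurable (ae_of_all _ hφ)
    rw [hasFiniteIntegral_iff_ofReal (ae_of_all _ fun τ => π.genDensity_nonneg _ τ),
      π.lintegral_genDensity]
    exact ENNReal.one_lt_top
  hasFDerivAt θ τ := by
    have := (π.hasFDerivAt_genDensity_mixPar m θ θ₀ τ).const_mul (φ τ)
    rwa [smul_smul] at this
  continuous_deriv τ := (continuous_const.mul (π.continuous_genDensity_mixPar m θ₀ τ)).smul
    ((innerSL ℝ).continuous.comp (π.continuous_scoreSum m τ))
  stronglyMeasurable_deriv θ :=
    (hφm.mul (π.measurable_genDensity _)).stronglyMeasurable.smul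
      ((innerSL ℝ).continuous.comp_stronglyMeasurable (π.stronglyMeasurable_scoreSum m θ))
  measurable_bound θ := ((π.stronglyMeasurable_scoreSum m θ).norm.measurable).const_mul B
  norm_deriv_le θ τ := by
    have hp := π.genDensity_nonneg (mixPar m θ θ₀) τ
    rw [norm_smul, innerSL_apply_norm, norm_mul, Real.norm_eq_abs, Real.norm_eq_abs,
      abs_of_nonneg hp]
    calc _ ≤ B * π.genDensity (mixPar m θ θ₀) τ * ‖π.scoreSum m θ τ‖ := by gcongr; exact hφ τ
      _ = _ := by ring
  moment_le θ := by
    have hsm := (π.stronglyMeasurable_scoreSum (H := H) m θ).measurable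
    have e : ∀ τ : Traj S A H,
        ENNReal.ofReal (π.genDensity (mixPar m θ θ₀) τ * (B * ‖π.scoreSum m θ τ‖) ^ 2)
        = ENNReal.ofReal (B ^ 2 * ‖π.scoreSum m θ τ‖ ^ 2)
          * ENNReal.ofReal (π.genDensity (mixPar m θ θ₀) τ) := fun τ => by
      rw [← ENNReal.ofReal_mul (by positivity)]; congr 1; ring
    simp only [e]
    rw [π.lintegral_genDensity_congr hm (ϑ' := fun _ => θ) (fun i hi => by simp [mixPar, hi])
      (by fun_prop) (fun τ τ' h => by rw [π.dependsBefore_scoreSum m θ τ τ' h]),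
      ← π.lintegral_law]
    simp only [ENNReal.ofReal_mul (sq_nonneg B)]
    rw [lintegral_const_mul _ (by fun_prop)]
    gcongr
    exact hπ.scoreSum_sq_le m θ

theorem integrable_smul_stepScore (j : Fin H) (θ : Param d) {φ : Traj S A H → ℝ}
    (hφm : Measurable φ) {B : ℝ} (hφ : ∀ τ, |φ τ| ≤ B) :
    Integrable (fun τ => φ τ • π.stepScore θ j τ) (π.law H θ) :=
  (hπ.integrable_stepScore θ j).bdd_smul (𝕜 := ℝ) B hφm.aestronglyMeasurable (ae_of_all _ hφ)

/-- The score at step `j` has conditional mean zero given the past. -/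
theorem integral_smul_stepScore_of_nonneg (j : Fin H) (θ : Param d) {φ : Traj S A H → ℝ}
    (hφm : Measurable φ) {B : ℝ} (hφ : ∀ τ, |φ τ| ≤ B) (hφ0 : ∀ τ, 0 ≤ φ τ)
    (hdep : DependsBefore j φ) :
    ∫ τ, φ τ • π.stepScore θ j τ ∂(π.law H θ) = 0 := by
  have w0 := hπ.weightedFamily_mix (m := j) (by omega) θ hφm hφ
  have w1 := hπ.weightedFamily_mix (m := j + 1) (by omega) θ hφm hφ
  have d0 := w0.hasFDerivAt_integral θ
  have d1 := w1.hasFDerivAt_integral θ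
  -- Releasing the parameter at step `j` does not change the expectation of a function of the past.
  -- The two derivatives therefore agree, and they differ by exactly the score at step `j`.
  have hfun : (fun θ' => ∫ τ, φ τ * π.genDensity (mixPar (j + 1) θ' θ) τ ∂(𝔐.base H))
      = fun θ' => ∫ τ, φ τ * π.genDensity (mixPar j θ' θ) τ ∂(𝔐.base H) := by
    ext θ'
    refine π.integral_genDensity_congr (m := j) (by omega) (fun i hi => ?_) hφm hdep hφ0
    simp [mixPar, hi, Nat.lt_succ_of_lt hi]
  rw [hfun] at d1
  have heq := d1.unique d0
  have i0 := w0.integrable_deriv θ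
  have i1 := w1.integrable_deriv θ
  simp only [mixPar_self] at heq i0 i1
  rw [← sub_eq_zero, ← integral_sub i1 i0] at heq
  have e : ∀ τ, (φ τ * π.genDensity (fun _ => θ) τ) • innerSL ℝ (π.scoreSum (j + 1) θ τ)
      - (φ τ * π.genDensity (fun _ => θ) τ) • innerSL ℝ (π.scoreSum j θ τ)
      = innerSL ℝ (π.genDensity (fun _ => θ) τ • φ τ • π.stepScore θ j τ) := fun τ => by
    rw [π.scoreSum_succ, map_add, smul_add, add_sub_cancel_right, map_smul, map_smul, smul_smul,
      mul_comm]
  simp only [e] at heq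
  have hint := hπ.integrable_smul_stepScore j θ hφm hφ
  rw [ContinuousLinearMap.integral_comp_comm _ ((π.integrable_law θ).1 hint)] at heq
  rw [π.integral_law]
  have := congrArg norm heq
  rwa [innerSL_apply_norm, norm_zero, norm_eq_zero] at this

theorem integral_smul_stepScore (j : Fin H) (θ : Param d) {φ : Traj S A H → ℝ}
    (hφm : Measurable φ) {B : ℝ} (hφ : ∀ τ, |φ τ| ≤ B) (hdep : DependsBefore j φ) :
    ∫ τ, φ τ • π.stepScore θ j τ ∂(π.law H θ) = 0 := by
  obtain ⟨τ₀⟩ := π.nonempty_traj (H := H)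
  have hB : 0 ≤ B := (abs_nonneg _).trans (hφ τ₀)
  -- Adding the constant `B` reduces to nonnegative weights; the constant itself contributes zero.
  have h1 := hπ.integral_smul_stepScore_of_nonneg j θ (φ := fun τ => φ τ + B) (B := 2 * B)
    (by fun_prop) (fun τ => by rw [abs_le]; have := abs_le.1 (hφ τ); constructor <;> linarith)
    (fun τ => by have := abs_le.1 (hφ τ); linarith) (fun τ τ' h => by simp only [hdep τ τ' h])
  have h2 := hπ.integral_smul_stepScore_of_nonneg j θ (φ := fun _ => B) (B := B)
    (by fun_prop) (fun τ => (abs_of_nonneg hB).le) (fun τ => hB) (fun τ τ' h => rfl)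
  have hint := hπ.integrable_smul_stepScore j θ hφm hφ
  simp only [add_smul] at h1
  have hint' : Integrable (fun τ => B • π.stepScore θ j τ) (π.law H θ) :=
    (hπ.integrable_stepScore θ j).smul B
  rw [integral_add hint hint', h2, add_zero] at h1
  exact h1

end Bounds

end Policy

end Scores

/-! ### The policy gradient theorem and the variance of the gradient estimator -/

section PolicyGradient

theorem sum_pow_le {γ : ℝ} (h0 : 0 ≤ γ) (h1 : γ < 1) (n : ℕ) :
    ∑ i : Fin n, γ ^ (i : ℕ) ≤ 1 / (1 - γ) := by
  rw [Fin.sum_univ_eq_sum_range (fun i => γ ^ i), le_div_iff₀ (by linarith), mul_comm,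
    mul_neg_geom_sum]
  linarith [pow_nonneg h0 n]

theorem sum_Ici_pow_le {γ : ℝ} (h0 : 0 ≤ γ) (h1 : γ < 1) {n : ℕ} (h : Fin n) :
    ∑ i ∈ Finset.Ici h, γ ^ (i : ℕ) ≤ γ ^ (h : ℕ) / (1 - γ) := by
  have e : ∑ i ∈ Finset.Ici h, γ ^ (i : ℕ) = ∑ i ∈ Finset.Ico (h : ℕ) n, γ ^ i := by
    rw [← Fin.map_valEmbedding_Ici, Finset.sum_map]
    rfl
  rw [e, Finset.sum_Ico_eq_sum_range]
  simp only [pow_add]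
  rw [← Finset.mul_sum, le_div_iff₀ (by linarith), mul_assoc, mul_comm (∑ _ ∈ _, _),
    mul_neg_geom_sum]
  have := pow_nonneg h0 (n - (h : ℕ))
  have := pow_nonneg h0 (h : ℕ)
  nlinarith

theorem sum_succ_mul_pow_le {γ : ℝ} (h0 : 0 ≤ γ) (h1 : γ < 1) (n : ℕ) :
    ∑ i : Fin n, ((i : ℕ) + 1 : ℝ) * γ ^ (i : ℕ) ≤ 1 / (1 - γ) ^ 2 := by
  rw [Fin.sum_univ_eq_sum_range (fun i => ((i : ℝ) + 1) * γ ^ i)]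
  have e : (∑ i ∈ Finset.range n, ((i : ℝ) + 1) * γ ^ i) * (1 - γ) ^ 2
      = 1 - γ ^ n * (1 + n * (1 - γ)) := by
    induction n with
    | zero => simp
    | succ n ih => rw [Finset.sum_range_succ, add_mul, ih]; push_cast; ring
  have h2 : 0 < 1 - γ := by linarith
  rw [le_div_iff₀ (by positivity), e]
  have : 0 ≤ γ ^ n * (1 + n * (1 - γ)) := by positivity
  linarith

variable {S A : Type*} [MeasurableSpace S] [MeasurableSpace A]

namespace MDP

variable (𝔐 : MDP S A) {H : ℕ}

/-- The discounted cost of step `i`. -/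
def stepCost (i : Fin H) (τ : Traj S A H) : ℝ := 𝔐.disc ^ (i : ℕ) * 𝔐.cost (τ i).1 (τ i).2

/-- The discounted cost-to-go from step `h` on. -/
def costToGo (h : Fin H) (τ : Traj S A H) : ℝ := ∑ i ∈ Finset.Ici h, 𝔐.stepCost i τ

theorem measurable_stepCost (i : Fin H) : Measurable (𝔐.stepCost (H := H) i) :=
  (𝔐.measurable_cost.comp (measurable_pi_apply i)).const_mul _

theorem measurable_costToGo (h : Fin H) : Measurable (𝔐.costToGo (H := H) h) :=
  Finset.measurable_fun_sum _ fun i _ => 𝔐.measurable_stepCost i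

variable {𝔐} {R : ℝ} (hR : ∀ s a, |𝔐.cost s a| ≤ R)
include hR

theorem abs_stepCost_le (i : Fin H) (τ : Traj S A H) :
    |𝔐.stepCost i τ| ≤ 𝔐.disc ^ (i : ℕ) * R := by
  have := pow_nonneg 𝔐.disc_nonneg (i : ℕ)
  rw [stepCost, abs_mul, abs_of_nonneg this]
  gcongr
  exact hR _ _

theorem abs_costToGo_le (hR0 : 0 ≤ R) (h : Fin H) (τ : Traj S A H) :
    |𝔐.costToGo h τ| ≤ 𝔐.disc ^ (h : ℕ) / (1 - 𝔐.disc) * R := by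
  refine (Finset.abs_sum_le_sum_abs _ _).trans ?_
  refine (Finset.sum_le_sum fun i _ => abs_stepCost_le hR i τ).trans ?_
  rw [← Finset.sum_mul]
  gcongr
  exact sum_Ici_pow_le 𝔐.disc_nonneg 𝔐.disc_lt_one h

theorem abs_sum_stepCost_le (hR0 : 0 ≤ R) (τ : Traj S A H) :
    |∑ i, 𝔐.stepCost i τ| ≤ 1 / (1 - 𝔐.disc) * R := by
  refine (Finset.abs_sum_le_sum_abs _ _).trans ?_
  refine (Finset.sum_le_sum fun i _ => abs_stepCost_le hR i τ).trans ?_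
  rw [← Finset.sum_mul]
  gcongr
  exact sum_pow_le 𝔐.disc_nonneg 𝔐.disc_lt_one H

end MDP

namespace Policy

variable {𝔐 : MDP S A} {d : ℕ} (π : Policy 𝔐 d) {H : ℕ}

theorem gradEst_eq (θ : Param d) (τ : Traj S A H) :
    π.gradEst θ τ = ∑ h, 𝔐.costToGo h τ • π.stepScore θ h τ := rfl

/-- Summation by costs instead of scores: the cost of step `i` meets only the scores up to step `i`,
which are orthogonal and so have a sum of moderate size. -/
theorem gradEst_eq_sum (θ : Param d) (τ : Traj S A H) :
    π.gradEst θ τ = ∑ i, 𝔐.stepCost i τ • π.scoreSum (i + 1) θ τ := by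
  simp only [gradEst_eq, MDP.costToGo, scoreSum, Finset.sum_smul, Finset.smul_sum]
  refine Finset.sum_comm' fun h i => ?_
  simp only [Finset.mem_univ, Finset.mem_Ici, true_and, Finset.mem_filter, and_true, Fin.le_def]
  omega

theorem stronglyMeasurable_gradEst (θ : Param d) :
    StronglyMeasurable (π.gradEst (H := H) θ) :=
  Finset.stronglyMeasurable_fun_sum _ fun h _ =>
    (𝔐.measurable_costToGo h).stronglyMeasurable.smul (π.stronglyMeasurable_stepScore θ h)

theorem continuous_gradEst (τ : Traj S A H) : Continuous fun θ => π.gradEst θ τ :=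
  continuous_finsetSum _ fun h _ => by
    have := π.continuous_score (τ h).1 (τ h).2
    fun_prop

variable [NeZero H]

theorem J_eq (θ θ₀ : Param d) :
    π.J H θ = ∫ τ, (∑ i, 𝔐.stepCost i τ) * π.genDensity (mixPar H θ θ₀) τ ∂(𝔐.base H) := by
  rw [mixPar_top, J, π.integral_law]
  refine integral_congr_ae (ae_of_all _ fun τ => ?_)
  simp only [smul_eq_mul, MDP.stepCost, mul_comm]

namespace Bounds

variable {π} {R G L : ℝ} (hπ : π.Bounds (H := H) R G L)
include hπ

theorem abs_J_le (θ : Param d) : |π.J H θ| ≤ 1 / (1 - 𝔐.disc) * R := by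
  have := norm_integral_le_of_norm_le_const (μ := π.law H θ)
    (f := fun τ : Traj S A H => ∑ i, 𝔐.stepCost i τ)
    (ae_of_all _ (MDP.abs_sum_stepCost_le hπ.cost_le hπ.R_nonneg))
  simpa [J, MDP.stepCost] using this

/-- Causality: scores after step `i` have mean zero given the cost of step `i`. This turns the full
likelihood-ratio gradient into the cost-to-go form. -/
theorem integral_stepCost_smul_scoreSum (θ : Param d) (i : Fin H) :
    ∫ τ, 𝔐.stepCost i τ • π.scoreSum (i + 1) θ τ ∂(π.law H θ)
      = ∫ τ, 𝔐.stepCost i τ • π.scoreSum H θ τ ∂(π.law H θ) := by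
  have hint := fun h : Fin H => hπ.integrable_smul_stepScore h θ (𝔐.measurable_stepCost i)
    (MDP.abs_stepCost_le hπ.cost_le i)
  simp only [scoreSum, Finset.smul_sum]
  rw [integral_finsetSum _ fun h _ => hint h, integral_finsetSum _ fun h _ => hint h]
  refine Finset.sum_subset (Finset.monotone_filter_right _ fun h _ _ => h.2) fun h _ hh => ?_
  refine hπ.integral_smul_stepScore h θ (𝔐.measurable_stepCost i)
    (MDP.abs_stepCost_le hπ.cost_le i) fun τ τ' hτ => ?_
  rw [MDP.stepCost, MDP.stepCost, hτ i (by simpa using hh)]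

theorem integrable_stepCost_smul_scoreSum (θ : Param d) (i : Fin H) (m : ℕ) :
    Integrable (fun τ => 𝔐.stepCost i τ • π.scoreSum m θ τ) (π.law H θ) := by
  simp only [scoreSum, Finset.smul_sum]
  exact integrable_finsetSum _ fun h _ => hπ.integrable_smul_stepScore h θ
    (𝔐.measurable_stepCost i) (MDP.abs_stepCost_le hπ.cost_le i)

theorem integrable_gradEst (θ : Param d) : Integrable (π.gradEst θ) (π.law H θ) := by
  have : π.gradEst (H := H) θ = fun τ => ∑ i, 𝔐.stepCost i τ • π.scoreSum (i + 1) θ τ :=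
    funext fun τ => π.gradEst_eq_sum θ τ
  rw [this]
  exact integrable_finsetSum _ fun i _ => hπ.integrable_stepCost_smul_scoreSum θ i _

/-- The policy gradient theorem. -/
theorem hasGradientAt_J (θ : Param d) :
    HasGradientAt (π.J H) (∫ τ, π.gradEst θ τ ∂(π.law H θ)) θ := by
  have hm : Measurable fun τ : Traj S A H => ∑ i, 𝔐.stepCost i τ :=
    Finset.measurable_fun_sum _ fun i _ => 𝔐.measurable_stepCost i
  -- For `m = H` nothing is frozen, and the second parameter is arbitrary.
  have w := hπ.weightedFamily_mix le_rfl (0 : Param d) hm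
    (MDP.abs_sum_stepCost_le hπ.cost_le hπ.R_nonneg)
  have hd := w.hasFDerivAt_integral θ
  have hJ : (fun θ => ∫ τ, (∑ i, 𝔐.stepCost i τ) * π.genDensity (mixPar H θ 0) τ ∂(𝔐.base H))
      = π.J H := funext fun θ => (π.J_eq θ 0).symm
  rw [hJ] at hd
  have hint : Integrable (fun τ => (∑ i, 𝔐.stepCost i τ) • π.scoreSum H θ τ) (π.law H θ) := by
    simp only [Finset.sum_smul]
    exact integrable_finsetSum _ fun i _ => hπ.integrable_stepCost_smul_scoreSum θ i _
  have e : ∀ τ : Traj S A H, ((∑ i, 𝔐.stepCost i τ) * π.genDensity (mixPar H θ 0) τ) •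
      innerSL ℝ (π.scoreSum H θ τ) = innerSL ℝ (π.genDensity (fun _ => θ) τ •
        (∑ i, 𝔐.stepCost i τ) • π.scoreSum H θ τ) := fun τ => by
    rw [map_smul, map_smul, smul_smul, mul_comm, mixPar_top]
  simp only [e] at hd
  rw [ContinuousLinearMap.integral_comp_comm _ ((π.integrable_law θ).1 hint),
    ← π.integral_law] at hd
  have e2 : ∫ τ, (∑ i, 𝔐.stepCost i τ) • π.scoreSum H θ τ ∂(π.law H θ)
      = ∫ τ, π.gradEst θ τ ∂(π.law H θ) := by
    simp only [gradEst_eq_sum, Finset.sum_smul]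
    rw [integral_finsetSum _ fun i _ => hπ.integrable_stepCost_smul_scoreSum θ i _,
      integral_finsetSum _ fun i _ => hπ.integrable_stepCost_smul_scoreSum θ i _]
    exact Finset.sum_congr rfl fun i _ => (hπ.integral_stepCost_smul_scoreSum θ i).symm
  rw [e2] at hd
  exact hd

theorem gradJ_eq (θ : Param d) : π.gradJ H θ = ∫ τ, π.gradEst θ τ ∂(π.law H θ) :=
  (hπ.hasGradientAt_J θ).gradient

theorem hasGradientAt (θ : Param d) : HasGradientAt (π.J H) (π.gradJ H θ) θ := by
  rw [hπ.gradJ_eq]; exact hπ.hasGradientAt_J θ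

/-- Scores of different steps are orthogonal. -/
theorem integral_inner_stepScore (θ : Param d) {h j : Fin H} (hhj : h < j) :
    ∫ τ, inner ℝ (π.stepScore θ h τ) (π.stepScore θ j τ) ∂(π.law H θ) = 0 := by
  have hL := hπ.memLp_stepScore θ
  have hmh := π.measurable_stepScore θ h
  have hmj := π.measurable_stepScore θ j
  have hprod : ∀ c, Integrable (fun τ => π.stepScore θ h τ c * π.stepScore θ j τ c)
      (π.law H θ) := by
    intro c
    have l : ∀ i, MemLp (fun τ => π.stepScore θ i τ c) 2 (π.law H θ) := fun i =>
      (hL i).mono (by have := π.measurable_stepScore θ i; fun_prop)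
        (ae_of_all _ fun τ => PiLp.norm_apply_le _ c)
    exact (l h).integrable_mul (l j)
  have hzero : ∀ c, ∫ τ, π.stepScore θ h τ c * π.stepScore θ j τ c ∂(π.law H θ) = 0 := by
    intro c
    -- The martingale property is available for bounded weights only, so the earlier score is
    -- clipped at `n` and dominated convergence removes the clipping.
    set cl : ℕ → ℝ → ℝ := fun n x => max (-(n : ℝ)) (min x n) with hcl
    have hclabs : ∀ n x, |cl n x| ≤ n := fun n x => abs_le.2 ⟨le_max_left _ _,
      max_le (by have := Nat.cast_nonneg (α := ℝ) n; linarith) (min_le_right _ _)⟩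
    have hclle : ∀ n x, |cl n x| ≤ |x| := by
      intro n x
      have hn := Nat.cast_nonneg (α := ℝ) n
      simp only [hcl]
      rcases abs_cases x with ⟨h1, h2⟩ | ⟨h1, h2⟩ <;>
        rw [h1, abs_le] <;> constructor <;>
        rcases max_cases (-(n : ℝ)) (min x n) with ⟨h3, h4⟩ | ⟨h3, h4⟩ <;>
        rcases min_cases x (n : ℝ) with ⟨h5, h6⟩ | ⟨h5, h6⟩ <;> linarith
    have hz : ∀ n : ℕ, ∫ τ, cl n (π.stepScore θ h τ c) * π.stepScore θ j τ c ∂(π.law H θ) = 0 := by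
      intro n
      have hb := hπ.integrable_smul_stepScore j θ
        (φ := fun τ => cl n (π.stepScore θ h τ c)) (by fun_prop) fun τ => hclabs n _
      have hm0 := hπ.integral_smul_stepScore j θ
        (φ := fun τ => cl n (π.stepScore θ h τ c)) (by fun_prop) (fun τ => hclabs n _)
        (fun τ τ' e => by simp only [stepScore, e h (Fin.lt_def.1 hhj)])
      have := congrArg (EuclideanSpace.proj (𝕜 := ℝ) c) hm0
      rw [← ContinuousLinearMap.integral_comp_comm _ hb] at this
      simpa using this
    have hlim := tendsto_integral_of_dominated_convergence (μ := π.law H θ)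
      (F := fun n τ => cl n (π.stepScore θ h τ c) * π.stepScore θ j τ c)
      (f := fun τ => π.stepScore θ h τ c * π.stepScore θ j τ c)
      (fun τ => |π.stepScore θ h τ c * π.stepScore θ j τ c|)
      (fun n => by fun_prop) (hprod c).abs
      (fun n => ae_of_all _ fun τ => by
        rw [Real.norm_eq_abs, abs_mul, abs_mul]
        exact mul_le_mul_of_nonneg_right (hclle n _) (abs_nonneg _))
      (ae_of_all _ fun τ => by
        refine tendsto_const_nhds.congr' ?_
        obtain ⟨N, hN⟩ := exists_nat_ge |π.stepScore θ h τ c|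
        filter_upwards [eventually_ge_atTop N] with n hn
        have h1 : |π.stepScore θ h τ c| ≤ n := hN.trans (by exact_mod_cast hn)
        have h2 := abs_le.1 h1
        simp only [hcl]
        rw [min_eq_left h2.2, max_eq_right h2.1])
    simp only [hz] at hlim
    exact (tendsto_nhds_unique hlim tendsto_const_nhds)
  simp only [PiLp.inner_apply, RCLike.inner_apply, conj_trivial]
  rw [integral_finsetSum _ fun c _ => by simpa only [mul_comm] using hprod c]
  refine Finset.sum_eq_zero fun c _ => ?_
  simpa only [mul_comm] using hzero c

/-- Orthogonality makes the second moment grow linearly in the number of steps. The triangle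
inequality would give a square and spoil the third power of `1 - γ`. -/
theorem integral_sq_scoreSum_le (θ : Param d) (i : Fin H) :
    ∫ τ, ‖π.scoreSum (i + 1) θ τ‖ ^ 2 ∂(π.law H θ) ≤ ((i : ℕ) + 1) * G ^ 2 := by
  have hL := hπ.memLp_stepScore θ
  have hint : ∀ h j : Fin H,
      Integrable (fun τ => inner ℝ (π.stepScore θ h τ) (π.stepScore θ j τ)) (π.law H θ) :=
    fun h j => ((hL h).norm.integrable_mul (hL j).norm).mono
      ((hL h).aestronglyMeasurable.inner (hL j).aestronglyMeasurable) (ae_of_all _ fun τ => by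
        simpa using abs_real_inner_le_norm (π.stepScore θ h τ) (π.stepScore θ j τ))
  have hoff : ∀ h j : Fin H, h ≠ j →
      ∫ τ, inner ℝ (π.stepScore θ h τ) (π.stepScore θ j τ) ∂(π.law H θ) = 0 := by
    intro h j hne
    rcases lt_or_gt_of_ne hne with hlt | hlt
    · exact hπ.integral_inner_stepScore θ hlt
    · simp only [real_inner_comm (π.stepScore θ j _)]
      exact hπ.integral_inner_stepScore θ hlt
  have hdiag : ∀ h : Fin H,
      ∫ τ, inner ℝ (π.stepScore θ h τ) (π.stepScore θ h τ) ∂(π.law H θ) ≤ G ^ 2 := by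
    intro h
    simp only [real_inner_self_eq_norm_sq]
    rw [integral_eq_lintegral_of_nonneg_ae (ae_of_all _ fun _ => by positivity)
      ((π.measurable_stepScore θ h).norm.pow_const 2).aestronglyMeasurable]
    exact ENNReal.toReal_le_of_le_ofReal (by positivity) (hπ.score_sq_le θ h)
  simp only [← real_inner_self_eq_norm_sq, scoreSum, sum_inner, inner_sum]
  rw [integral_finsetSum _ fun h _ => integrable_finsetSum _ fun j _ => hint _ _]
  have hcard : (Finset.univ.filter fun h : Fin H => (h : ℕ) < i + 1).card ≤ (i : ℕ) + 1 := by
    refine (Finset.card_le_card_of_injOn (t := Finset.range ((i : ℕ) + 1)) Fin.val (fun h hh => by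
      simpa using hh) Fin.val_injective.injOn).trans (by simp)
  calc _ = ∑ h ∈ Finset.univ.filter (fun h : Fin H => (h : ℕ) < i + 1),
        ∫ τ, inner ℝ (π.stepScore θ h τ) (π.stepScore θ h τ) ∂(π.law H θ) := by
        refine Finset.sum_congr rfl fun h hh => ?_
        rw [integral_finsetSum _ fun j _ => hint _ _, Finset.sum_eq_single_of_mem h hh]
        exact fun j _ hj => hoff _ _ (by tauto)
    _ ≤ ∑ h ∈ Finset.univ.filter (fun h : Fin H => (h : ℕ) < i + 1), G ^ 2 :=
        Finset.sum_le_sum fun h _ => hdiag h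
    _ ≤ _ := by
        rw [Finset.sum_const, nsmul_eq_mul]
        gcongr
        exact_mod_cast hcard

theorem memLp_scoreSum (m : ℕ) (θ : Param d) : MemLp (π.scoreSum m θ) 2 (π.law H θ) :=
  memLp_finsetSum _ fun h _ => hπ.memLp_stepScore θ h

/-- The second moment of the stochastic gradient. -/
theorem gradEst_sq_le (θ : Param d) :
    ∫⁻ τ, ENNReal.ofReal (‖π.gradEst θ τ‖ ^ 2) ∂(π.law H θ)
      ≤ ENNReal.ofReal (gradVar G R 𝔐.disc) := by
  set γ := 𝔐.disc with hγ
  have h0 : 0 ≤ γ := 𝔐.disc_nonneg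
  have h1 : 0 < 1 - γ := by have := 𝔐.disc_lt_one; linarith
  have hR := hπ.R_nonneg
  have hpt : ∀ τ : Traj S A H, ‖π.gradEst θ τ‖ ^ 2 ≤
      1 / (1 - γ) * ∑ i : Fin H, γ ^ (i : ℕ) * (R ^ 2 * ‖π.scoreSum (i + 1) θ τ‖ ^ 2) := by
    intro τ
    calc ‖π.gradEst θ τ‖ ^ 2
        ≤ (∑ i : Fin H, γ ^ (i : ℕ) * (R * ‖π.scoreSum (i + 1) θ τ‖)) ^ 2 := by
          gcongr
          rw [gradEst_eq_sum]
          refine (norm_sum_le _ _).trans (Finset.sum_le_sum fun i _ => ?_)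
          rw [norm_smul, ← mul_assoc]
          gcongr
          exact MDP.abs_stepCost_le hπ.cost_le i τ
      -- Cauchy–Schwarz with weights `γ ^ i`. The weights sum to at most `1 / (1 - γ)`, and the
      -- moments below contribute `1 / (1 - γ) ^ 2`.
      _ ≤ (∑ i : Fin H, γ ^ (i : ℕ)) *
          ∑ i : Fin H, γ ^ (i : ℕ) * (R * ‖π.scoreSum (i + 1) θ τ‖) ^ 2 := by
          have hp : ∀ i : Fin H, 0 ≤ γ ^ (i : ℕ) := fun i => pow_nonneg h0 _
          refine Finset.sum_sq_le_sum_mul_sum_of_sq_le_mul _ (fun i _ => hp i)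
            (fun i _ => mul_nonneg (hp i) (sq_nonneg _)) fun i _ => le_of_eq (by ring)
      _ ≤ 1 / (1 - γ) * ∑ i : Fin H, γ ^ (i : ℕ) * (R ^ 2 * ‖π.scoreSum (i + 1) θ τ‖ ^ 2) := by
          simp only [mul_pow]
          gcongr
          exact sum_pow_le h0 𝔐.disc_lt_one H
  have hint : ∀ i : Fin H, Integrable
      (fun τ => γ ^ (i : ℕ) * (R ^ 2 * ‖π.scoreSum (i + 1) θ τ‖ ^ 2)) (π.law H θ) := fun i =>
    ((hπ.memLp_scoreSum _ θ).integrable_norm_pow (by norm_num)).const_mul _ |>.const_mul _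
  calc _ ≤ ∫⁻ τ, ENNReal.ofReal (1 / (1 - γ) *
        ∑ i : Fin H, γ ^ (i : ℕ) * (R ^ 2 * ‖π.scoreSum (i + 1) θ τ‖ ^ 2)) ∂(π.law H θ) :=
        lintegral_mono fun τ => ENNReal.ofReal_le_ofReal (hpt τ)
    _ ≤ _ := by
        rw [← ofReal_integral_eq_lintegral_ofReal
          ((integrable_finsetSum _ fun i _ => hint i).const_mul _)
          (ae_of_all _ fun τ => by positivity)]
        apply ENNReal.ofReal_le_ofReal
        rw [integral_const_mul, integral_finsetSum _ fun i _ => hint i]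
        simp only [integral_const_mul]
        calc _ ≤ 1 / (1 - γ) * ∑ i : Fin H, γ ^ (i : ℕ) * (R ^ 2 * (((i : ℕ) + 1) * G ^ 2)) := by
              gcongr with i
              exact hπ.integral_sq_scoreSum_le θ i
          _ = 1 / (1 - γ) * ((R ^ 2 * G ^ 2) * ∑ i : Fin H, ((i : ℕ) + 1 : ℝ) * γ ^ (i : ℕ)) := by
              congr 1
              rw [Finset.mul_sum]
              exact Finset.sum_congr rfl fun i _ => by ring
          _ ≤ 1 / (1 - γ) * ((R ^ 2 * G ^ 2) * (1 / (1 - γ) ^ 2)) := by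
              gcongr
              exact sum_succ_mul_pow_le h0 𝔐.disc_lt_one H
          _ = gradVar G R γ := by rw [gradVar]; field_simp

theorem norm_gradJ_sq_le (θ : Param d) : ‖π.gradJ H θ‖ ^ 2 ≤ gradVar G R 𝔐.disc := by
  have h := lintegral_norm_sub_integral_sq_le (hπ.integrable_gradEst θ) 0
  simp only [zero_sub, norm_neg] at h
  have h2 := h.trans (hπ.gradEst_sq_le θ)
  rw [← hπ.gradJ_eq] at h2
  have h3 : 0 ≤ gradVar G R 𝔐.disc := by
    have := 𝔐.disc_lt_one
    have : 0 < 1 - 𝔐.disc := by linarith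
    rw [gradVar]; positivity
  exact (ENNReal.ofReal_le_ofReal_iff h3).1 h2

end Bounds

end Policy

end PolicyGradient

/-! ### The policy Hessian and the second moment of its estimator -/

section PolicyHessian

variable {S A : Type*} [MeasurableSpace S] [MeasurableSpace A]

namespace Policy

variable {𝔐 : MDP S A} {d : ℕ} (π : Policy 𝔐 d) {H : ℕ}

/-- The derivative of the stochastic gradient. -/
def gradEstDeriv (θ : Param d) (τ : Traj S A H) : Param d →L[ℝ] Param d :=
  ∑ h, 𝔐.costToGo h τ • π.scoreDeriv θ (τ h).1 (τ h).2

theorem hasFDerivAt_gradEst (θ : Param d) (τ : Traj S A H) :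
    HasFDerivAt (fun θ => π.gradEst θ τ) (π.gradEstDeriv θ τ) θ :=
  HasFDerivAt.fun_sum fun h _ => (π.hasFDerivAt_score θ (τ h).1 (τ h).2).const_smul
    (𝔐.costToGo h τ)

/-- The stochastic Hessian on trajectories of positive density. -/
def hessFormula (θ : Param d) (τ : Traj S A H) : Param d →L[ℝ] Param d :=
  π.gradEstDeriv θ τ + (innerSL ℝ (π.scoreSum H θ τ)).smulRight (π.gradEst θ τ)

theorem stronglyMeasurable_gradEstDeriv (θ : Param d) :
    StronglyMeasurable (π.gradEstDeriv (H := H) θ) :=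
  Finset.stronglyMeasurable_fun_sum _ fun h _ =>
    (𝔐.measurable_costToGo h).stronglyMeasurable.smul
      ((π.stronglyMeasurable_scoreDeriv θ).comp_measurable (measurable_pi_apply h))

theorem continuous_gradEstDeriv (τ : Traj S A H) : Continuous fun θ => π.gradEstDeriv θ τ :=
  continuous_finsetSum _ fun h _ => by
    have := π.continuous_scoreDeriv (τ h).1 (τ h).2
    fun_prop

theorem stronglyMeasurable_hessFormula (θ : Param d) :
    StronglyMeasurable (π.hessFormula (H := H) θ) :=
  (π.stronglyMeasurable_gradEstDeriv θ).add
    ((ContinuousLinearMap.smulRightL ℝ (Param d) (Param d)).continuous₂.comp_stronglyMeasurable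
      (((innerSL ℝ).continuous.comp_stronglyMeasurable
        (π.stronglyMeasurable_scoreSum H θ)).prodMk (π.stronglyMeasurable_gradEst θ)))

theorem continuous_hessFormula (τ : Traj S A H) : Continuous fun θ => π.hessFormula θ τ :=
  (π.continuous_gradEstDeriv τ).add
    ((ContinuousLinearMap.smulRightL ℝ (Param d) (Param d)).continuous₂.comp
      (((innerSL ℝ).continuous.comp (π.continuous_scoreSum H τ)).prodMk (π.continuous_gradEst τ)))

variable [NeZero H]

theorem genDensity_const_eq (θ : Param d) (τ : Traj S A H) :
    π.genDensity (fun _ => θ) τ = 𝔐.stateProd τ * ∏ h : Fin H, π.dens θ (τ h).1 (τ h).2 := by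
  rw [genDensity, Finset.prod_mul_distrib, 𝔐.prod_stateDens]

theorem _root_.DRSOPO.MDP.measurable_stateProd : Measurable (𝔐.stateProd (H := H)) := by
  have : 𝔐.stateProd (H := H) = fun τ => ∏ h, 𝔐.stateDens h τ :=
    funext fun τ => (𝔐.prod_stateDens τ).symm
  rw [this]
  exact Finset.measurable_fun_prod _ fun h _ => 𝔐.measurable_stateDens h

theorem hessEst_of_stateProd_ne_zero (θ : Param d) {τ : Traj S A H} (hτ : 𝔐.stateProd τ ≠ 0) :
    π.hessEst θ τ = π.hessFormula θ τ := by
  have hpos : π.genDensity (fun _ => θ) τ ≠ 0 := by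
    rw [genDensity_const_eq]
    exact mul_ne_zero hτ (Finset.prod_pos fun _ _ => π.dens_pos _ _ _).ne'
  have h1 := π.hasFDerivAt_genDensity_mixPar H θ 0 τ
  simp only [mixPar_top] at h1
  have h2 := h1.log hpos
  rw [smul_smul, inv_mul_cancel₀ hpos, one_smul] at h2
  rw [hessEst, hessFormula, innerSL_gradient, (π.hasFDerivAt_gradEst θ τ).fderiv]
  simp only [trajDensity_eq_genDensity]
  rw [h2.fderiv]

/-- The state factor does not involve the parameter, so on such a trajectory the density vanishes
for every parameter. With `Real.log 0 = 0` its logarithm is constant and the rank-one term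
disappears. -/
theorem hessEst_of_stateProd_eq_zero (θ : Param d) {τ : Traj S A H} (hτ : 𝔐.stateProd τ = 0) :
    π.hessEst θ τ = π.gradEstDeriv θ τ := by
  have h0 : ∀ θ, π.trajDensity H θ τ = 0 := fun θ => by
    rw [trajDensity_eq_genDensity, genDensity_const_eq, hτ, zero_mul]
  rw [hessEst, innerSL_gradient, (π.hasFDerivAt_gradEst θ τ).fderiv]
  simp only [h0, Real.log_zero, fderiv_fun_const]
  ext v
  simp

/-- The estimator and the formula can differ only where the density is zero, so their expectations
coincide. -/
theorem genDensity_smul_hessEst (θ : Param d) (τ : Traj S A H) :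
    π.genDensity (fun _ => θ) τ • π.hessEst θ τ
      = π.genDensity (fun _ => θ) τ • π.hessFormula θ τ := by
  by_cases hτ : 𝔐.stateProd τ = 0
  · have : π.genDensity (fun _ => θ) τ = 0 := by rw [genDensity_const_eq, hτ, zero_mul]
    rw [this]
    exact (zero_smul ℝ (π.hessEst θ τ)).trans (zero_smul ℝ (π.hessFormula θ τ)).symm
  · rw [π.hessEst_of_stateProd_ne_zero θ hτ]

theorem hessEst_eq_ite (θ : Param d) (τ : Traj S A H) [Decidable (𝔐.stateProd τ = 0)] :
    π.hessEst θ τ = if 𝔐.stateProd τ = 0 then π.gradEstDeriv θ τ else π.hessFormula θ τ := by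
  split_ifs with hτ
  · exact π.hessEst_of_stateProd_eq_zero θ hτ
  · exact π.hessEst_of_stateProd_ne_zero θ hτ

theorem stronglyMeasurable_hessEst (θ : Param d) : StronglyMeasurable (π.hessEst (H := H) θ) := by
  classical
  have : π.hessEst (H := H) θ = fun τ =>
      if 𝔐.stateProd τ = 0 then π.gradEstDeriv θ τ else π.hessFormula θ τ :=
    funext fun τ => π.hessEst_eq_ite θ τ
  rw [this]
  exact StronglyMeasurable.ite (MDP.measurable_stateProd (measurableSet_singleton 0))
    (π.stronglyMeasurable_gradEstDeriv θ) (π.stronglyMeasurable_hessFormula θ)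

theorem continuous_hessEst (τ : Traj S A H) : Continuous fun θ => π.hessEst θ τ := by
  by_cases hτ : 𝔐.stateProd τ = 0
  · simp only [π.hessEst_of_stateProd_eq_zero _ hτ]
    exact π.continuous_gradEstDeriv τ
  · simp only [π.hessEst_of_stateProd_ne_zero _ hτ]
    exact π.continuous_hessFormula τ

/-- A common bound for the norms of the stochastic Hessian and of its formula. -/
def hessBound (θ : Param d) (τ : Traj S A H) : ℝ :=
  (∑ h, |𝔐.costToGo h τ| * ‖π.scoreDeriv θ (τ h).1 (τ h).2‖)
    + ‖π.scoreSum H θ τ‖ * ‖π.gradEst θ τ‖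

omit [NeZero H] in
theorem norm_gradEstDeriv_le (θ : Param d) (τ : Traj S A H) :
    ‖π.gradEstDeriv θ τ‖ ≤ ∑ h, |𝔐.costToGo h τ| * ‖π.scoreDeriv θ (τ h).1 (τ h).2‖ :=
  (norm_sum_le _ _).trans (Finset.sum_le_sum fun h _ => by rw [norm_smul, Real.norm_eq_abs])

omit [NeZero H] in
theorem norm_hessFormula_le (θ : Param d) (τ : Traj S A H) :
    ‖π.hessFormula θ τ‖ ≤ π.hessBound θ τ := by
  refine (norm_add_le _ _).trans (add_le_add (π.norm_gradEstDeriv_le θ τ) ?_)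
  rw [ContinuousLinearMap.norm_smulRight_apply, innerSL_apply_norm]

theorem norm_hessEst_le (θ : Param d) (τ : Traj S A H) :
    ‖π.hessEst θ τ‖ ≤ π.hessBound θ τ := by
  by_cases hτ : 𝔐.stateProd τ = 0
  · rw [π.hessEst_of_stateProd_eq_zero _ hτ]
    exact (π.norm_gradEstDeriv_le θ τ).trans (le_add_of_nonneg_right (by positivity))
  · rw [π.hessEst_of_stateProd_ne_zero _ hτ]
    exact π.norm_hessFormula_le θ τ

namespace Bounds

variable {π} {R G L : ℝ} (hπ : π.Bounds (H := H) R G L)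
include hπ

theorem hessBound_sq_le (θ : Param d) (τ : Traj S A H) :
    π.hessBound θ τ ^ 2 ≤ (2 * R ^ 2 / (1 - 𝔐.disc) ^ 3) *
        (∑ h : Fin H, 𝔐.disc ^ (h : ℕ) * ‖π.scoreDeriv θ (τ h).1 (τ h).2‖ ^ 2)
      + (2 * R ^ 2 * (H : ℝ) ^ 3 / (1 - 𝔐.disc) ^ 2) * ∑ h : Fin H, ‖π.stepScore θ h τ‖ ^ 4 := by
  set γ := 𝔐.disc with hγ
  have h0 : 0 ≤ γ := 𝔐.disc_nonneg
  have h1 : 0 < 1 - γ := by have := 𝔐.disc_lt_one; linarith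
  have hR := hπ.R_nonneg
  have hp : ∀ i : Fin H, 0 ≤ γ ^ (i : ℕ) := fun i => pow_nonneg h0 _
  have hΨ := MDP.abs_costToGo_le (H := H) hπ.cost_le hR
  have hfirst : (∑ h, |𝔐.costToGo h τ| * ‖π.scoreDeriv θ (τ h).1 (τ h).2‖) ^ 2
      ≤ (R ^ 2 / (1 - γ) ^ 3) *
        ∑ h : Fin H, γ ^ (h : ℕ) * ‖π.scoreDeriv θ (τ h).1 (τ h).2‖ ^ 2 := by
    calc _ ≤ (∑ h : Fin H, R / (1 - γ) *
          (γ ^ (h : ℕ) * ‖π.scoreDeriv θ (τ h).1 (τ h).2‖)) ^ 2 := by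
          refine pow_le_pow_left₀ (by positivity) (Finset.sum_le_sum fun h _ => ?_) 2
          refine (mul_le_mul_of_nonneg_right (hΨ h τ)
            (norm_nonneg (π.scoreDeriv θ (τ h).1 (τ h).2))).trans (le_of_eq ?_)
          ring
      _ = (R / (1 - γ)) ^ 2 * (∑ h : Fin H,
          (γ ^ (h : ℕ) * ‖π.scoreDeriv θ (τ h).1 (τ h).2‖)) ^ 2 := by
          rw [← Finset.mul_sum, mul_pow]
      _ ≤ (R / (1 - γ)) ^ 2 * ((∑ h : Fin H, γ ^ (h : ℕ)) *
          ∑ h : Fin H, γ ^ (h : ℕ) * ‖π.scoreDeriv θ (τ h).1 (τ h).2‖ ^ 2) := by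
          gcongr
          exact Finset.sum_sq_le_sum_mul_sum_of_sq_le_mul _ (fun i _ => hp i)
            (fun i _ => mul_nonneg (hp i) (sq_nonneg _)) fun i _ => le_of_eq (by ring)
      _ ≤ (R / (1 - γ)) ^ 2 * ((1 / (1 - γ)) *
          ∑ h : Fin H, γ ^ (h : ℕ) * ‖π.scoreDeriv θ (τ h).1 (τ h).2‖ ^ 2) := by
          gcongr
          exact sum_pow_le h0 𝔐.disc_lt_one H
      _ = _ := by field_simp
  -- The rank-one term is a product of two sums of scores, so its square has degree four. This is
  -- where fourth moments of the scores are needed.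
  have hsum4 : (∑ h : Fin H, ‖π.stepScore θ h τ‖) ^ 4
      ≤ (H : ℝ) ^ 3 * ∑ h : Fin H, ‖π.stepScore θ h τ‖ ^ 4 := by
    have c1 := sq_sum_le_card_mul_sum_sq (s := (Finset.univ : Finset (Fin H)))
      (f := fun h => ‖π.stepScore θ h τ‖)
    have c2 := sq_sum_le_card_mul_sum_sq (s := (Finset.univ : Finset (Fin H)))
      (f := fun h => ‖π.stepScore θ h τ‖ ^ 2)
    simp only [Finset.card_univ, Fintype.card_fin, ← pow_mul] at c1 c2
    calc (∑ h : Fin H, ‖π.stepScore θ h τ‖) ^ 4 = ((∑ h : Fin H, ‖π.stepScore θ h τ‖) ^ 2) ^ 2 := by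
          ring
      _ ≤ (H * ∑ h : Fin H, ‖π.stepScore θ h τ‖ ^ 2) ^ 2 := by gcongr
      _ = (H : ℝ) ^ 2 * (∑ h : Fin H, ‖π.stepScore θ h τ‖ ^ 2) ^ 2 := by ring
      _ ≤ (H : ℝ) ^ 2 * (H * ∑ h : Fin H, ‖π.stepScore θ h τ‖ ^ 4) := by gcongr
      _ = _ := by ring
  have hsecond : (‖π.scoreSum H θ τ‖ * ‖π.gradEst θ τ‖) ^ 2
      ≤ (R ^ 2 * (H : ℝ) ^ 3 / (1 - γ) ^ 2) * ∑ h : Fin H, ‖π.stepScore θ h τ‖ ^ 4 := by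
    have e1 : ‖π.scoreSum H θ τ‖ ≤ ∑ h : Fin H, ‖π.stepScore θ h τ‖ := by
      rw [scoreSum_eq_sum]; exact norm_sum_le _ _
    have e2 : ‖π.gradEst θ τ‖ ≤ R / (1 - γ) * ∑ h : Fin H, ‖π.stepScore θ h τ‖ := by
      rw [gradEst_eq, Finset.mul_sum]
      refine (norm_sum_le _ _).trans (Finset.sum_le_sum fun h _ => ?_)
      rw [norm_smul, Real.norm_eq_abs]
      gcongr
      refine (hΨ h τ).trans ?_
      rw [div_mul_eq_mul_div]
      gcongr
      exact mul_le_of_le_one_left hR (pow_le_one₀ h0 𝔐.disc_lt_one.le)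
    calc _ ≤ ((∑ h : Fin H, ‖π.stepScore θ h τ‖) *
          (R / (1 - γ) * ∑ h : Fin H, ‖π.stepScore θ h τ‖)) ^ 2 := by gcongr
      _ = (R / (1 - γ)) ^ 2 * (∑ h : Fin H, ‖π.stepScore θ h τ‖) ^ 4 := by ring
      _ ≤ (R / (1 - γ)) ^ 2 * ((H : ℝ) ^ 3 * ∑ h : Fin H, ‖π.stepScore θ h τ‖ ^ 4) := by gcongr
      _ = _ := by field_simp
  rw [hessBound]
  refine (add_sq_le).trans ?_
  rw [mul_add]
  refine (add_le_add (mul_le_mul_of_nonneg_left hfirst zero_le_two)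
    (mul_le_mul_of_nonneg_left hsecond zero_le_two)).trans (le_of_eq ?_)
  ring

/-- The second moment of the stochastic Hessian. -/
theorem lintegral_hessBound_sq_le (θ : Param d) :
    ∫⁻ τ, ENNReal.ofReal (π.hessBound θ τ ^ 2) ∂(π.law H θ)
      ≤ ENNReal.ofReal (hessVar H G L R 𝔐.disc) := by
  set γ := 𝔐.disc with hγ
  have h0 : 0 ≤ γ := 𝔐.disc_nonneg
  have h1 : 0 < 1 - γ := by have := 𝔐.disc_lt_one; linarith
  have hp : ∀ i : Fin H, 0 ≤ γ ^ (i : ℕ) := fun i => pow_nonneg h0 _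
  have hm1 : ∀ h : Fin H, Measurable fun τ : Traj S A H => ‖π.scoreDeriv θ (τ h).1 (τ h).2‖ :=
    fun h => ((π.stronglyMeasurable_scoreDeriv θ).comp_measurable
      (measurable_pi_apply h)).norm.measurable
  have hm2 : ∀ h : Fin H, Measurable (π.stepScore θ h) := π.measurable_stepScore θ
  set a := 2 * R ^ 2 / (1 - γ) ^ 3 with ha
  set b := 2 * R ^ 2 * (H : ℝ) ^ 3 / (1 - γ) ^ 2 with hb
  have ha0 : 0 ≤ a := by positivity
  have hb0 : 0 ≤ b := by positivity
  calc _ ≤ ∫⁻ τ, (ENNReal.ofReal a * (∑ h : Fin H, ENNReal.ofReal (γ ^ (h : ℕ)) *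
          ENNReal.ofReal (‖π.scoreDeriv θ (τ h).1 (τ h).2‖ ^ 2))
        + ENNReal.ofReal b * ∑ h : Fin H, ENNReal.ofReal (‖π.stepScore θ h τ‖ ^ 4))
          ∂(π.law H θ) := by
        refine lintegral_mono fun τ => (ENNReal.ofReal_le_ofReal
          (hπ.hessBound_sq_le θ τ)).trans (le_of_eq ?_)
        have hs : ∀ h : Fin H, 0 ≤ γ ^ (h : ℕ) * ‖π.scoreDeriv θ (τ h).1 (τ h).2‖ ^ 2 :=
          fun h => mul_nonneg (hp h) (sq_nonneg _)
        rw [← hγ, ← ha, ← hb, ENNReal.ofReal_add (mul_nonneg ha0 (Finset.sum_nonneg fun h _ => hs h))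
          (by positivity), ENNReal.ofReal_mul ha0, ENNReal.ofReal_mul hb0,
          ENNReal.ofReal_sum_of_nonneg fun h _ => hs h,
          ENNReal.ofReal_sum_of_nonneg fun h _ => by positivity]
        simp only [ENNReal.ofReal_mul (hp _)]
    _ ≤ ENNReal.ofReal a * (∑ h : Fin H, ENNReal.ofReal (γ ^ (h : ℕ)) * ENNReal.ofReal (L ^ 2))
        + ENNReal.ofReal b * ∑ _h : Fin H, ENNReal.ofReal (G ^ 4) := by
        rw [lintegral_add_left (by fun_prop), lintegral_const_mul _ (by fun_prop),
          lintegral_const_mul _ (by fun_prop), lintegral_finsetSum _ fun h _ => by fun_prop,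
          lintegral_finsetSum _ fun h _ => by fun_prop]
        gcongr with h _ h _
        · rw [lintegral_const_mul _ (by fun_prop)]
          gcongr
          exact hπ.scoreDeriv_le θ h
        · exact hπ.score_le θ h
    _ = ENNReal.ofReal (a * ((∑ h : Fin H, γ ^ (h : ℕ)) * L ^ 2) + b * (H * G ^ 4)) := by
        have hs : 0 ≤ ∑ h : Fin H, γ ^ (h : ℕ) := Finset.sum_nonneg fun h _ => hp h
        rw [ENNReal.ofReal_add (by positivity) (by positivity), ENNReal.ofReal_mul ha0,
          ENNReal.ofReal_mul hb0, ENNReal.ofReal_mul hs,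
          ENNReal.ofReal_sum_of_nonneg fun h _ => hp h, ← Finset.sum_mul, Finset.sum_const,
          Finset.card_univ, Fintype.card_fin, nsmul_eq_mul, ENNReal.ofReal_mul (by positivity),
          ENNReal.ofReal_natCast]
    _ ≤ _ := by
        apply ENNReal.ofReal_le_ofReal
        calc _ ≤ a * (1 / (1 - γ) * L ^ 2) + b * (H * G ^ 4) := by
              gcongr; exact sum_pow_le h0 𝔐.disc_lt_one H
          _ = (2 * (H : ℝ) ^ 4 * G ^ 4 * R ^ 2 * (1 - γ) ^ 2 + 2 * L ^ 2 * R ^ 2) / (1 - γ) ^ 4 := by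
              rw [ha, hb]; field_simp; ring
          _ ≤ _ := by
              rw [hessVar]
              gcongr
              norm_num

theorem hessEst_sq_le (θ : Param d) :
    ∫⁻ τ, ENNReal.ofReal (‖π.hessEst θ τ‖ ^ 2) ∂(π.law H θ)
      ≤ ENNReal.ofReal (hessVar H G L R 𝔐.disc) :=
  (lintegral_mono fun τ => ENNReal.ofReal_le_ofReal (by gcongr; exact π.norm_hessEst_le θ τ)).trans
    (hπ.lintegral_hessBound_sq_le θ)

theorem integrable_hessEst (θ : Param d) : Integrable (π.hessEst θ) (π.law H θ) :=
  (memLp_two_of_lintegral_le (π.stronglyMeasurable_hessEst θ).aestronglyMeasurable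
    (hπ.hessEst_sq_le θ)).integrable (by norm_num)

/-- The product rule applied to density times estimator gives density times `hessFormula`, so the
required moment is the second moment of the stochastic Hessian. -/
theorem weightedFamily_grad :
    WeightedFamily (𝔐.base H) (fun θ => π.genDensity fun _ => θ)
      (fun θ τ => π.genDensity (fun _ => θ) τ • π.gradEst θ τ)
      (fun θ τ => π.genDensity (fun _ => θ) τ • π.hessFormula θ τ)
      (fun θ τ => ‖π.hessFormula θ τ‖) (hessVar H G L R 𝔐.disc) where
  weight_nonneg θ τ := π.genDensity_nonneg _ _
  measurable_weight θ := π.measurable_genDensity _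
  continuous_weight τ := by
    simpa only [mixPar_top] using π.continuous_genDensity_mixPar H 0 τ
  lintegral_weight θ := π.lintegral_genDensity _
  integrable θ := (π.integrable_law θ).1 (hπ.integrable_gradEst θ)
  hasFDerivAt θ τ := by
    have h1 := π.hasFDerivAt_genDensity_mixPar H θ 0 τ
    simp only [mixPar_top] at h1
    have h2 := h1.smul (π.hasFDerivAt_gradEst θ τ)
    have e : π.genDensity (fun _ => θ) τ • π.hessFormula θ τ
        = π.genDensity (fun _ => θ) τ • π.gradEstDeriv θ τ +
          (π.genDensity (fun _ => θ) τ • innerSL ℝ (π.scoreSum H θ τ)).smulRight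
            (π.gradEst θ τ) := by
      rw [hessFormula, smul_add]
      congr 1
      ext v : 1
      simp only [_root_.smul_apply, ContinuousLinearMap.smulRight_apply, smul_smul, smul_eq_mul]
    rw [e]
    exact h2
  continuous_deriv τ := by
    have h : Continuous fun θ => π.genDensity (fun _ => θ) τ := by
      simpa only [mixPar_top] using π.continuous_genDensity_mixPar H 0 τ
    exact h.smul (π.continuous_hessFormula τ)
  stronglyMeasurable_deriv θ :=
    (π.measurable_genDensity _).stronglyMeasurable.smul (π.stronglyMeasurable_hessFormula θ)
  measurable_bound θ := (π.stronglyMeasurable_hessFormula θ).norm.measurable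
  norm_deriv_le θ τ := by
    rw [norm_smul, Real.norm_eq_abs, abs_of_nonneg (π.genDensity_nonneg _ τ)]
  moment_le θ := by
    have hm := (π.stronglyMeasurable_hessFormula (H := H) θ).norm.measurable
    refine le_trans ?_ (hπ.lintegral_hessBound_sq_le θ)
    rw [π.lintegral_law]
    refine lintegral_mono fun τ => ?_
    rw [ENNReal.ofReal_mul (π.genDensity_nonneg _ τ), mul_comm]
    gcongr
    exact π.norm_hessFormula_le θ τ

omit hπ in
theorem integral_hessEst_eq (θ : Param d) :
    ∫ τ, π.hessEst θ τ ∂(π.law H θ)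
      = ∫ τ, π.genDensity (fun _ => θ) τ • π.hessFormula θ τ ∂(𝔐.base H) := by
  rw [π.integral_law]
  simp only [genDensity_smul_hessEst]

theorem hasFDerivAt_gradJ_integral (θ : Param d) :
    HasFDerivAt (π.gradJ H) (∫ τ, π.hessEst θ τ ∂(π.law H θ)) θ := by
  have h := hπ.weightedFamily_grad.hasFDerivAt_integral θ
  rw [← integral_hessEst_eq] at h
  have e : π.gradJ H = fun θ => ∫ τ, π.genDensity (fun _ => θ) τ • π.gradEst θ τ ∂(𝔐.base H) :=
    funext fun θ => by rw [hπ.gradJ_eq, π.integral_law]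
  rw [e]
  exact h

theorem hessJ_eq (θ : Param d) : π.hessJ H θ = ∫ τ, π.hessEst θ τ ∂(π.law H θ) :=
  (hπ.hasFDerivAt_gradJ_integral θ).fderiv

theorem hasFDerivAt_gradJ (θ : Param d) : HasFDerivAt (π.gradJ H) (π.hessJ H θ) θ := by
  rw [hπ.hessJ_eq]; exact hπ.hasFDerivAt_gradJ_integral θ

theorem continuous_hessJ : Continuous (π.hessJ H) := by
  have : π.hessJ H = fun θ => _ :=
    funext fun θ => (hπ.hessJ_eq θ).trans (integral_hessEst_eq θ)
  rw [this]
  exact hπ.weightedFamily_grad.continuous_integral_deriv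

theorem inner_hessJ_comm (θ v w : Param d) :
    inner ℝ (π.hessJ H θ v) w = inner ℝ v (π.hessJ H θ w) := by
  have h := second_derivative_symmetric (𝕜 := ℝ) (f := π.J H)
    (f' := fun θ => innerSL ℝ (π.gradJ H θ)) (f'' := (innerSL ℝ).comp (π.hessJ H θ)) (x := θ)
    (fun θ => hπ.hasGradientAt θ) ((innerSL ℝ).hasFDerivAt.comp θ (hπ.hasFDerivAt_gradJ θ)) v w
  simp only [ContinuousLinearMap.comp_apply, innerSL_apply_apply] at h
  rw [h, real_inner_comm]

theorem norm_hessJ_sq_le (θ : Param d) : ‖π.hessJ H θ‖ ^ 2 ≤ hessVar H G L R 𝔐.disc := by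
  have h := lintegral_norm_sub_integral_sq_le (hπ.integrable_hessEst θ) 0
  simp only [zero_sub, norm_neg] at h
  have h2 := h.trans (hπ.hessEst_sq_le θ)
  rw [← hπ.hessJ_eq] at h2
  have h3 : 0 ≤ hessVar H G L R 𝔐.disc := by
    have := 𝔐.disc_lt_one
    have : 0 < 1 - 𝔐.disc := by linarith
    rw [hessVar]; positivity
  exact (ENNReal.ofReal_le_ofReal_iff h3).1 h2

end Bounds

end Policy

end PolicyHessian

/-! ### Mean errors of the batches drawn along a run -/

section BatchErrors

variable {S A : Type*} [MeasurableSpace S] [MeasurableSpace A]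

namespace Policy

variable {𝔐 : MDP S A} {d : ℕ} (π : Policy 𝔐 d) {H : ℕ} [NeZero H]

/-- The symmetric part of the stochastic Hessian. -/
def symHessEst (θ : Param d) (τ : Traj S A H) : Param d →L[ℝ] Param d :=
  (2 : ℝ)⁻¹ • (π.hessEst θ τ + ContinuousLinearMap.adjoint (π.hessEst θ τ))

theorem continuous_symHessEst (τ : Traj S A H) : Continuous fun θ => π.symHessEst θ τ := by
  have h := π.continuous_hessEst τ
  exact (h.add (ContinuousLinearMap.adjoint.continuous.comp h)).const_smul (2 : ℝ)⁻¹

theorem measurable_symHessEst (θ : Param d) : Measurable (π.symHessEst (H := H) θ) := by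
  have h := π.stronglyMeasurable_hessEst (H := H) θ
  exact ((h.add (ContinuousLinearMap.adjoint.continuous.comp_stronglyMeasurable h)).const_smul
    (2 : ℝ)⁻¹).measurable

theorem isSymmetric_symHessEst (θ : Param d) (τ : Traj S A H) :
    ((π.symHessEst θ τ : Param d →L[ℝ] Param d) : Module.End ℝ (Param d)).IsSymmetric := by
  intro x y
  simp only [symHessEst, ContinuousLinearMap.coe_coe, _root_.smul_apply, _root_.add_apply,
    inner_smul_left, inner_smul_right, inner_add_left, inner_add_right,
    ContinuousLinearMap.adjoint_inner_left, ContinuousLinearMap.adjoint_inner_right]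
  simp [add_comm]

theorem norm_symHessEst_le (θ : Param d) (τ : Traj S A H) :
    ‖π.symHessEst θ τ‖ ≤ ‖π.hessEst θ τ‖ := by
  rw [symHessEst, norm_smul]
  have h := norm_add_le (π.hessEst θ τ) (ContinuousLinearMap.adjoint (π.hessEst θ τ))
  rw [LinearIsometryEquiv.norm_map] at h
  norm_num
  linarith

theorem hessBatch_eq {n : ℕ} (θ : Param d) (ℳ : Fin n → Traj S A H) :
    π.hessBatch θ ℳ = (n : ℝ)⁻¹ • ∑ i, π.symHessEst θ (ℳ i) := by
  simp only [hessBatch, symHessEst, ← Finset.smul_sum, Finset.sum_add_distrib, map_sum, map_smulₛₗ,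
    conj_trivial]
  rw [smul_comm, smul_add, smul_add, smul_add]

theorem isSymmetric_hessBatch {n : ℕ} (θ : Param d) (ℳ : Fin n → Traj S A H) (x y : Param d) :
    inner ℝ (π.hessBatch θ ℳ x) y = inner ℝ x (π.hessBatch θ ℳ y) := by
  have h := fun i => π.isSymmetric_symHessEst θ (ℳ i) x y
  simp only [ContinuousLinearMap.coe_coe] at h
  simp only [hessBatch_eq, _root_.smul_apply, _root_.sum_apply, inner_smul_left, inner_smul_right,
    sum_inner, inner_sum, h, conj_trivial]

omit [NeZero H] in
theorem continuous_gradBatch {n : ℕ} (ℳ : Fin n → Traj S A H) :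
    Continuous fun θ => π.gradBatch θ ℳ :=
  (continuous_finsetSum _ fun i _ => π.continuous_gradEst (ℳ i)).const_smul (n : ℝ)⁻¹

omit [NeZero H] in
theorem measurable_gradBatch {n : ℕ} (θ : Param d) :
    Measurable fun ℳ : Fin n → Traj S A H => π.gradBatch θ ℳ := by
  have := (π.stronglyMeasurable_gradEst (H := H) θ).measurable
  unfold gradBatch
  fun_prop

theorem continuous_hessBatch {n : ℕ} (ℳ : Fin n → Traj S A H) :
    Continuous fun θ => π.hessBatch θ ℳ := by
  simp only [hessBatch_eq]
  exact (continuous_finsetSum _ fun i _ => π.continuous_symHessEst (ℳ i)).const_smul (n : ℝ)⁻¹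

theorem measurable_hessBatch {n : ℕ} (θ : Param d) :
    Measurable fun ℳ : Fin n → Traj S A H => π.hessBatch θ ℳ := by
  have := π.measurable_symHessEst (H := H) θ
  simp only [hessBatch_eq]
  fun_prop

namespace Bounds

variable {π} {R G L : ℝ} (hπ : π.Bounds (H := H) R G L)
include hπ

theorem gradVar_nonneg : 0 ≤ gradVar G R 𝔐.disc :=
  (sq_nonneg _).trans (hπ.norm_gradJ_sq_le 0)

theorem hessVar_nonneg : 0 ≤ hessVar H G L R 𝔐.disc :=
  (sq_nonneg _).trans (hπ.norm_hessJ_sq_le 0)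

theorem integrable_symHessEst (θ : Param d) : Integrable (π.symHessEst θ) (π.law H θ) :=
  (hπ.integrable_hessEst θ).mono (π.measurable_symHessEst θ).aestronglyMeasurable
    (ae_of_all _ fun τ => π.norm_symHessEst_le θ τ)

/-- The Hessian of `J` is symmetric, so passing to symmetric parts preserves unbiasedness. -/
theorem integral_symHessEst (θ : Param d) :
    ∫ τ, π.symHessEst θ τ ∂(π.law H θ) = π.hessJ H θ := by
  have hi := hπ.integrable_hessEst θ
  ext v : 1
  refine ext_inner_right ℝ fun w => ?_
  have e1 : ∀ f : Traj S A H → Param d →L[ℝ] Param d, Integrable f (π.law H θ) → ∀ v w,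
      inner ℝ ((∫ τ, f τ ∂(π.law H θ)) v) w = ∫ τ, inner ℝ (f τ v) w ∂(π.law H θ) := by
    intro f hf v w
    rw [ContinuousLinearMap.integral_apply hf, real_inner_comm, ← integral_inner
      (hf.apply_continuousLinearMap v)]
    simp only [real_inner_comm]
  rw [e1 _ (hπ.integrable_symHessEst θ)]
  have e2 : ∀ τ : Traj S A H, inner ℝ (π.symHessEst θ τ v) w
      = 2⁻¹ * inner ℝ (π.hessEst θ τ v) w + 2⁻¹ * inner ℝ (π.hessEst θ τ w) v := fun τ => by
    simp only [symHessEst, _root_.smul_apply, _root_.add_apply, inner_smul_left, inner_add_left,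
      ContinuousLinearMap.adjoint_inner_left, conj_trivial, mul_add]
    rw [real_inner_comm v]
  have hi' : ∀ v w, Integrable (fun τ => inner ℝ (π.hessEst θ τ v) w) (π.law H θ) := fun v w =>
    (hi.apply_continuousLinearMap v).inner_const w
  simp only [e2]
  rw [integral_add ((hi' v w).const_mul _) ((hi' w v).const_mul _), integral_const_mul,
    integral_const_mul, ← e1 _ hi, ← e1 _ hi, ← hπ.hessJ_eq, hπ.inner_hessJ_comm θ w v,
    real_inner_comm w]
  ring

theorem lintegral_gradBatch_sub_sq_le (θ : Param d) {n : ℕ} (hn : 0 < n) :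
    ∫⁻ ℳ, ENNReal.ofReal (‖π.gradJ H θ - π.gradBatch θ ℳ‖ ^ 2)
      ∂(Measure.pi fun _ : Fin n => π.law H θ) ≤ ENNReal.ofReal (gradVar G R 𝔐.disc / n) := by
  have h := lintegral_norm_avg_sub_sq_le (π.stronglyMeasurable_gradEst θ).measurable
    hπ.gradVar_nonneg (hπ.gradEst_sq_le θ) hn
  rw [← hπ.gradJ_eq] at h
  simpa only [gradBatch, norm_sub_rev] using h

theorem lintegral_hessBatch_sub_sq_le (hd : 2 ≤ d) (θ : Param d) {n : ℕ} (hn : 0 < n) :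
    ∫⁻ ℳ, ENNReal.ofReal (‖π.hessJ H θ - π.hessBatch θ ℳ‖ ^ 2)
      ∂(Measure.pi fun _ : Fin n => π.law H θ)
      ≤ ENNReal.ofReal (22 * Real.log d * hessVar H G L R 𝔐.disc / n) := by
  have hn0 : (0 : ℝ) < n := Nat.cast_pos.2 hn
  have hm := π.measurable_hessBatch (H := H) (n := n) θ
  have hm' := π.measurable_symHessEst (H := H) θ
  have hsq : ∫⁻ τ, ENNReal.ofReal (‖π.symHessEst θ τ‖ ^ 2) ∂(π.law H θ)
      ≤ ENNReal.ofReal (hessVar H G L R 𝔐.disc) :=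
    (lintegral_mono fun τ => ENNReal.ofReal_le_ofReal
      (by gcongr; exact π.norm_symHessEst_le θ τ)).trans (hπ.hessEst_sq_le θ)
  have h := lintegral_norm_sum_sub_sq_le hm' (hπ.integrable_symHessEst θ)
    (π.isSymmetric_symHessEst θ) (by simpa using hd) hπ.hessVar_nonneg hsq n
  rw [hπ.integral_symHessEst, finrank_euclideanSpace, Fintype.card_fin] at h
  have e : ∀ ℳ : Fin n → Traj S A H, ENNReal.ofReal (‖π.hessJ H θ - π.hessBatch θ ℳ‖ ^ 2)
      = ENNReal.ofReal (((n : ℝ)⁻¹) ^ 2) *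
        ENNReal.ofReal (‖∑ i, π.symHessEst θ (ℳ i) - (n : ℝ) • π.hessJ H θ‖ ^ 2) := by
    intro ℳ
    rw [← ENNReal.ofReal_mul (by positivity), hessBatch_eq]
    congr 1
    have : π.hessJ H θ - (n : ℝ)⁻¹ • ∑ i, π.symHessEst θ (ℳ i)
        = -((n : ℝ)⁻¹ • (∑ i, π.symHessEst θ (ℳ i) - (n : ℝ) • π.hessJ H θ)) := by
      rw [smul_sub, smul_smul, inv_mul_cancel₀ hn0.ne', one_smul, neg_sub]
    rw [this, norm_neg, norm_smul, mul_pow, Real.norm_of_nonneg (by positivity)]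
  simp only [e]
  rw [lintegral_const_mul _ (by fun_prop)]
  calc _ ≤ ENNReal.ofReal (((n : ℝ)⁻¹) ^ 2) *
        ENNReal.ofReal (22 * Real.log d * n * hessVar H G L R 𝔐.disc) := by gcongr
    _ = _ := by
        rw [← ENNReal.ofReal_mul (by positivity)]
        congr 1
        field_simp

end Bounds

omit [NeZero H] in
theorem measurable_genDensity_uncurry :
    Measurable fun z : Param d × Traj S A H => π.genDensity (fun _ => z.1) z.2 := by
  refine (stronglyMeasurable_uncurry_of_continuous_of_stronglyMeasurable
    (u := fun (θ : Param d) (τ : Traj S A H) => π.genDensity (fun _ => θ) τ) (fun τ => ?_)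
    fun θ => (π.measurable_genDensity _).stronglyMeasurable).measurable
  simpa only [mixPar_top] using π.continuous_genDensity_mixPar H 0 τ

theorem measurable_law : Measurable (π.law H) := by
  refine Measure.measurable_of_measurable_coe _ fun B hB => ?_
  simp only [law_eq, withDensity_apply _ hB]
  exact π.measurable_genDensity_uncurry.ennreal_ofReal.lintegral_prod_right'

/-- The law of a batch of independent trajectories, as a kernel. -/
def batchKernel (H : ℕ) [NeZero H] (n : ℕ) : Kernel (Param d) (Fin n → Traj S A H) where
  toFun θ := Measure.pi fun _ : Fin n => π.law H θ
  measurable' := by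
    refine Measurable.measure_of_isPiSystem_of_isProbabilityMeasure generateFrom_pi.symm
      isPiSystem_pi ?_
    rintro _ ⟨B, hB, rfl⟩
    simp only [Measure.pi_pi]
    exact Finset.measurable_fun_prod _ fun i _ =>
      (Measure.measurable_coe (show MeasurableSet (B i) from hB i trivial)).comp π.measurable_law

instance (n : ℕ) : IsMarkovKernel (π.batchKernel H n) :=
  ⟨fun θ => by rw [batchKernel]; exact inferInstanceAs (IsProbabilityMeasure (Measure.pi _))⟩

/-- If a batch is drawn from the law at `θ`, given a `σ`-algebra for which `θ` is measurable, then
bounds on conditional expectations integrate. -/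
theorem lintegral_batch_le {Ω : Type*} {m mΩ : MeasurableSpace Ω} {μ : Measure Ω}
    [IsProbabilityMeasure μ] (hm : m ≤ mΩ) {n : ℕ} {θ : Ω → Param d}
    {b : Ω → Fin n → Traj S A H} (hθ : Measurable[m] θ) (hb : Measurable b)
    (hlaw : ∀ D, MeasurableSet[m] D → ∀ B, MeasurableSet B →
      μ (D ∩ b ⁻¹' B) = ∫⁻ ω in D, Measure.pi (fun _ : Fin n => π.law H (θ ω)) B ∂μ)
    {f : Param d → (Fin n → Traj S A H) → ENNReal} (hf : Measurable (Function.uncurry f))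
    {c : ENNReal} (hc : ∀ θ, ∫⁻ ℳ, f θ ℳ ∂(Measure.pi fun _ : Fin n => π.law H θ) ≤ c) :
    ∫⁻ ω, f (θ ω) (b ω) ∂μ ≤ c := by
  have hθ' : Measurable θ := hθ.mono hm le_rfl
  -- The conditional law on past events, applied to preimages under `θ`, identifies the joint law of
  -- the iterate and its batch on rectangles.
  have hmap : μ.map (fun ω => (θ ω, b ω)) = (μ.map θ) ⊗ₘ (π.batchKernel H n) := by
    have : IsProbabilityMeasure (μ.map θ) := Measure.isProbabilityMeasure_map hθ'.aemeasurable
    have : IsProbabilityMeasure (μ.map fun ω => (θ ω, b ω)) :=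
      Measure.isProbabilityMeasure_map (hθ'.prodMk hb).aemeasurable
    refine Measure.ext_prod fun {D B} hD hB => ?_
    rw [Measure.map_apply (hθ'.prodMk hb) (hD.prod hB), Measure.compProd_apply_prod hD hB,
      setLIntegral_map hD ((π.batchKernel H n).measurable_coe hB) hθ']
    exact hlaw _ (hθ hD) _ hB
  calc ∫⁻ ω, f (θ ω) (b ω) ∂μ = ∫⁻ z, Function.uncurry f z ∂(μ.map fun ω => (θ ω, b ω)) :=
        (lintegral_map hf (hθ'.prodMk hb)).symm
    _ = ∫⁻ θ, ∫⁻ ℳ, f θ ℳ ∂(π.batchKernel H n θ) ∂(μ.map θ) := by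
        rw [hmap, Measure.lintegral_compProd hf]; rfl
    _ ≤ ∫⁻ _, c ∂(μ.map θ) := lintegral_mono fun θ => hc θ
    _ = c := by
        rw [lintegral_const, Measure.map_apply hθ' MeasurableSet.univ]
        simp

end Policy

theorem integral_le_of_lintegral_sq_le {Ω : Type*} [MeasurableSpace Ω] {μ : Measure Ω}
    [IsProbabilityMeasure μ] {X : Ω → ℝ} (hX : Measurable X) (hX0 : ∀ ω, 0 ≤ X ω) {c : ℝ}
    (hc : 0 ≤ c) (h : ∫⁻ ω, ENNReal.ofReal (X ω ^ 2) ∂μ ≤ ENNReal.ofReal (c ^ 2)) :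
    Integrable X μ ∧ ∫ ω, X ω ∂μ ≤ c := by
  have h1 := sq_lintegral_le (P := μ) (g := fun ω => ENNReal.ofReal (X ω)) (by fun_prop)
  simp only [← ENNReal.ofReal_pow (hX0 _)] at h1
  have h2 := h1.trans h
  rw [ENNReal.ofReal_pow hc] at h2
  have h3 := (ENNReal.pow_le_pow_left_iff two_ne_zero).1 h2
  refine ⟨⟨hX.aestronglyMeasurable, ?_⟩, ?_⟩
  · rw [hasFiniteIntegral_iff_ofReal (ae_of_all _ hX0)]
    exact h3.trans_lt ENNReal.ofReal_lt_top
  · rw [integral_eq_lintegral_of_nonneg_ae (ae_of_all _ hX0) hX.aestronglyMeasurable]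
    exact ENNReal.toReal_le_of_le_ofReal hc h3

namespace Run

variable {𝔐 : MDP S A} {d : ℕ} {π : Policy 𝔐 d} {H : ℕ} [NeZero H] {Ω : Type*}
  [mΩ : MeasurableSpace Ω] {μ : Measure Ω} [IsProbabilityMeasure μ] {ℱ : Filtration ℕ mΩ}
  {θ₀ : Param d} {Δ : ℝ} {T Ng NH : ℕ} (run : Run π H μ ℱ θ₀ Δ T Ng NH)

/-- The Hessian estimate `H_t`. -/
def hess (t : ℕ) (ω : Ω) : Param d →L[ℝ] Param d := π.hessBatch (run.θ t ω) (run.batchH t ω)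

/-- The error of the gradient estimate. -/
def gradErr (t : ℕ) (ω : Ω) : ℝ := ‖π.gradJ H (run.θ t ω) - run.g t ω‖

/-- The error of the Hessian estimate. -/
def hessErr (t : ℕ) (ω : Ω) : ℝ := ‖π.hessJ H (run.θ t ω) - run.hess t ω‖

variable {R G L : ℝ} (hπ : π.Bounds (H := H) R G L)

omit [IsProbabilityMeasure μ] in
theorem measurable_θ' {t : ℕ} (ht : t ≤ T) : Measurable (run.θ t) :=
  (run.measurable_θ t ht).mono (ℱ.le t) le_rfl

include hπ

theorem gradErr_le (hNg : 0 < Ng) {c : ℝ} (hc : 0 ≤ c) (hcv : gradVar G R 𝔐.disc / Ng ≤ c ^ 2)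
    {t : ℕ} (ht : t ≤ T) :
    Integrable (run.gradErr t) μ ∧ ∫ ω, run.gradErr t ω ∂μ ≤ c := by
  have hb : Measurable (run.batchG t) := (run.measurable_batchG t ht).mono (ℱ.le _) le_rfl
  have hgc : Continuous (π.gradJ H) := continuous_iff_continuousAt.2 fun θ =>
    (hπ.hasFDerivAt_gradJ θ).continuousAt
  have hjoint : Measurable (Function.uncurry fun (θ : Param d) (ℳ : Fin Ng → Traj S A H) =>
      ‖π.gradJ H θ - π.gradBatch θ ℳ‖) :=
    (stronglyMeasurable_uncurry_of_continuous_of_stronglyMeasurable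
      (u := fun (θ : Param d) (ℳ : Fin Ng → Traj S A H) => ‖π.gradJ H θ - π.gradBatch θ ℳ‖)
      (fun ℳ => (hgc.sub (π.continuous_gradBatch ℳ)).norm)
      fun θ => ((π.measurable_gradBatch θ).const_sub _).norm.stronglyMeasurable).measurable
  refine integral_le_of_lintegral_sq_le
    (hjoint.comp ((run.measurable_θ' ht).prodMk hb)) (fun _ => norm_nonneg _) hc ?_
  refine π.lintegral_batch_le (ℱ.le t) (run.measurable_θ t ht) hb (run.condLaw_batchG t ht)
    (f := fun θ ℳ => ENNReal.ofReal (‖π.gradJ H θ - π.gradBatch θ ℳ‖ ^ 2))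
    (hjoint.pow_const 2).ennreal_ofReal fun θ => ?_
  exact (hπ.lintegral_gradBatch_sub_sq_le θ hNg).trans (ENNReal.ofReal_le_ofReal hcv)

theorem hessErr_le (hd : 2 ≤ d) (hNH : 0 < NH) {c : ℝ} (hc : 0 ≤ c)
    (hcv : 22 * Real.log d * hessVar H G L R 𝔐.disc / NH ≤ c ^ 2) {t : ℕ} (ht : t < T) :
    Integrable (run.hessErr t) μ ∧ ∫ ω, run.hessErr t ω ∂μ ≤ c := by
  have hb : Measurable (run.batchH t) := (run.measurable_batchH t ht).mono (ℱ.le _) le_rfl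
  have hjoint : Measurable (Function.uncurry fun (θ : Param d) (ℳ : Fin NH → Traj S A H) =>
      ‖π.hessJ H θ - π.hessBatch θ ℳ‖) :=
    (stronglyMeasurable_uncurry_of_continuous_of_stronglyMeasurable
      (u := fun (θ : Param d) (ℳ : Fin NH → Traj S A H) => ‖π.hessJ H θ - π.hessBatch θ ℳ‖)
      (fun ℳ => (hπ.continuous_hessJ.sub (π.continuous_hessBatch ℳ)).norm)
      fun θ => ((π.measurable_hessBatch θ).const_sub _).norm.stronglyMeasurable).measurable
  refine integral_le_of_lintegral_sq_le
    (hjoint.comp ((run.measurable_θ' ht.le).prodMk hb)) (fun _ => norm_nonneg _) hc ?_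
  refine π.lintegral_batch_le (ℱ.le t) (run.measurable_θ t ht.le) hb (run.condLaw_batchH t ht)
    (f := fun θ ℳ => ENNReal.ofReal (‖π.hessJ H θ - π.hessBatch θ ℳ‖ ^ 2))
    (hjoint.pow_const 2).ennreal_ofReal fun θ => ?_
  exact (hπ.lintegral_hessBatch_sub_sq_le hd θ hNH).trans (ENNReal.ofReal_le_ofReal hcv)

end Run

end BatchErrors

/-! ### Rescaling, the two-dimensional model and the smallest eigenvalue -/

section Model

section Scaling

variable {E : Type*} [NormedAddCommGroup E] [InnerProductSpace ℝ E]

/-- Each derivative gains a factor `σ`, and the Lipschitz estimate of the Hessian a third one; this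
accounts for `c * σ ^ 3 * M`. -/
theorem LipschitzHessian.scale [CompleteSpace E] {f : E → ℝ} {f' : E → E} {f'' : E → E →L[ℝ] E}
    {M c σ : ℝ} (hc : 0 < c) (hσ : 0 < σ) (hM : c * σ ^ 3 * M = 1)
    (hf : ∀ x, HasGradientAt f (f' x) x) (hf' : ∀ x, HasFDerivAt f' (f'' x) x)
    (hL : ∀ x y, ‖f'' y - f'' x‖ ≤ M * ‖y - x‖) :
    LipschitzHessian 1 (fun y => c * f (σ • y)) (fun y => (c * σ) • f' (σ • y))
      (fun y => (c * σ ^ 2) • f'' (σ • y)) := by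
  have hs : ∀ y : E, HasFDerivAt (fun y : E => σ • y) (σ • ContinuousLinearMap.id ℝ E) y :=
    fun y => (hasFDerivAt_id y).const_smul σ
  refine LipschitzHessian.of_hasFDerivAt (fun y => ?_) (fun y => ?_) fun x y => ?_
  · have h := ((hf (σ • y)).hasFDerivAt.comp y (hs y)).const_mul c
    rw [hasGradientAt_iff_hasFDerivAt]
    have e : (InnerProductSpace.toDual ℝ E) ((c * σ) • f' (σ • y))
        = c • ((InnerProductSpace.toDual ℝ E (f' (σ • y))) ∘SL (σ • ContinuousLinearMap.id ℝ E)) := by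
      ext v
      simp only [InnerProductSpace.toDual_apply_apply, inner_smul_left, conj_trivial,
        _root_.smul_apply, ContinuousLinearMap.comp_apply, ContinuousLinearMap.id_apply,
        inner_smul_right, smul_eq_mul]
      ring
    rw [e]
    exact h
  · have h := ((hf' (σ • y)).comp y (hs y)).const_smul (c * σ)
    have e : (c * σ ^ 2) • f'' (σ • y)
        = (c * σ) • (f'' (σ • y) ∘SL (σ • ContinuousLinearMap.id ℝ E)) := by
      ext v : 1
      simp only [_root_.smul_apply, ContinuousLinearMap.comp_apply, ContinuousLinearMap.id_apply,
        map_smul, smul_smul]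
      congr 1
      ring
    rw [e]
    exact h
  · rw [← smul_sub, norm_smul, Real.norm_of_nonneg (by positivity)]
    calc c * σ ^ 2 * ‖f'' (σ • y) - f'' (σ • x)‖
        ≤ c * σ ^ 2 * (M * ‖σ • y - σ • x‖) := by gcongr; exact hL _ _
      _ = c * σ ^ 3 * M * ‖y - x‖ := by
          rw [← smul_sub, norm_smul, Real.norm_of_nonneg hσ.le]; ring
      _ = _ := by rw [hM]

/-- A minimizer of the quadratic model over a subspace and a ball is, after rescaling, a trust
region step. -/
theorem exists_trustRegionStep {S : Submodule ℝ E} {H : E →L[ℝ] E} {g x : E} {c σ : ℝ}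
    (hc : 0 < c) (hσ : 0 < σ) (hH : ∀ y z, inner ℝ (H y) z = inner ℝ y (H z)) (hgS : g ∈ S)
    (hxS : x ∈ S) (hx : ‖x‖ ≤ 2 * σ)
    (hmin : ∀ y ∈ S, ‖y‖ ≤ 2 * σ →
      inner ℝ g x + inner ℝ x (H x) / 2 ≤ inner ℝ g y + inner ℝ y (H y) / 2) :
    ∃ lam, TrustRegionStep S ((c * σ) • g) ((c * σ ^ 2) • H) (σ⁻¹ • x) lam := by
  have hsymm : ∀ y z, inner ℝ (((c * σ ^ 2) • H) y) z = inner ℝ y (((c * σ ^ 2) • H) z) := by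
    intro y z
    simp only [_root_.smul_apply, inner_smul_left, inner_smul_right, hH, conj_trivial]
  have hnorm : ‖σ⁻¹ • x‖ ≤ 2 := by
    rw [norm_smul, Real.norm_of_nonneg (by positivity), inv_mul_le_iff₀ hσ]
    linarith
  have hmodel : ∀ y : E, inner ℝ ((c * σ) • g) y + inner ℝ y (((c * σ ^ 2) • H) y) / 2
      = c * (inner ℝ g (σ • y) + inner ℝ (σ • y) (H (σ • y)) / 2) := by
    intro y
    simp only [_root_.smul_apply, inner_smul_left, inner_smul_right, map_smul, conj_trivial]
    ring
  obtain ⟨lam, h1, h2, h3, h4⟩ := exists_multiplier (S := S) (g := (c * σ) • g)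
    (x := σ⁻¹ • x) two_pos hsymm (S.smul_mem _ hxS) hnorm fun y hy hy2 => by
      rw [hmodel, hmodel, smul_smul, mul_inv_cancel₀ hσ.ne', one_smul]
      refine mul_le_mul_of_nonneg_left (hmin _ (S.smul_mem _ hy) ?_) hc.le
      rw [norm_smul, Real.norm_of_nonneg hσ.le]
      nlinarith
  exact ⟨lam, hsymm, S.smul_mem _ hgS, S.smul_mem _ hxS, hnorm, h1, h2, h3, h4⟩

end Scaling

section Model

variable {d : ℕ}

theorem model_eq (J₀ : ℝ) (g v : Param d) {B : Param d →L[ℝ] Param d}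
    (hB : ∀ y z, inner ℝ (B y) z = inner ℝ y (B z)) (α : Fin 2 → ℝ) :
    model J₀ g v B α = J₀ + (inner ℝ g (-(α 0) • g + α 1 • v) +
      inner ℝ (-(α 0) • g + α 1 • v) (B (-(α 0) • g + α 1 • v)) / 2) := by
  have h1 : inner ℝ g (B v) = inner ℝ v (B g) := by rw [← hB, real_inner_comm]
  simp only [model, vecC, matQ, Matrix.mulVec, dotProduct, Fin.sum_univ_two, Matrix.of_apply,
    Matrix.cons_val', Matrix.cons_val_zero, Matrix.cons_val_one, Matrix.cons_val_fin_one,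
    map_add, map_smul, inner_add_left, inner_add_right, inner_smul_left, inner_smul_right,
    conj_trivial, h1, real_inner_self_eq_norm_sq]
  ring

theorem sqrt_matG_eq (g v : Param d) (α : Fin 2 → ℝ) :
    Real.sqrt (α ⬝ᵥ (matG g v).mulVec α) = ‖-(α 0) • g + α 1 • v‖ := by
  rw [← Real.sqrt_sq (norm_nonneg (-(α 0) • g + α 1 • v)), ← real_inner_self_eq_norm_sq]
  congr 1
  simp only [matG, Matrix.mulVec, dotProduct, Fin.sum_univ_two, Matrix.of_apply,
    Matrix.cons_val', Matrix.cons_val_zero, Matrix.cons_val_one, Matrix.cons_val_fin_one,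
    inner_add_left, inner_add_right, inner_smul_left, inner_smul_right, conj_trivial,
    real_inner_comm g v]
  ring

/-- The coordinates parametrize the whole span, possibly not injectively, so minimality in
coordinates is minimality on the span. The vectors `g` and `v` may be dependent or zero. -/
theorem IsDRTRSolution.exists_trustRegionStep {J₀ : ℝ} {g v : Param d}
    {B : Param d →L[ℝ] Param d} {α : Fin 2 → ℝ} {c σ : ℝ} (hc : 0 < c) (hσ : 0 < σ)
    (hB : ∀ y z, inner ℝ (B y) z = inner ℝ y (B z))
    (h : IsDRTRSolution J₀ g v B (2 * σ) α) :
    ∃ lam, TrustRegionStep (Submodule.span ℝ {g, v}) ((c * σ) • g) ((c * σ ^ 2) • B)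
      (σ⁻¹ • (-(α 0) • g + α 1 • v)) lam := by
  obtain ⟨h1, h2⟩ := h
  have hg : g ∈ Submodule.span ℝ {g, v} := Submodule.subset_span (by simp)
  have hv : v ∈ Submodule.span ℝ {g, v} := Submodule.subset_span (by simp)
  rw [sqrt_matG_eq] at h1
  refine DRSOPO.exists_trustRegionStep hc hσ hB hg
    (Submodule.add_mem _ (Submodule.smul_mem _ _ hg) (Submodule.smul_mem _ _ hv)) h1
    fun y hy hyn => ?_
  obtain ⟨a, b, rfl⟩ := Submodule.mem_span_pair.1 hy
  have h3 := h2 ![-a, b] (by rw [sqrt_matG_eq]; simpa using hyn)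
  rw [model_eq _ _ _ hB, model_eq _ _ _ hB] at h3
  simpa using h3

end Model

section LambdaMin

variable {d : ℕ}

/-- In finite dimension the infimum of the Rayleigh quotient is an eigenvalue, and it bounds all
others from below. Positivity of `d` ensures that the set of eigenvalues is nonempty. -/
theorem le_lambdaMin_iff (hd : 0 < d) {B : Param d →L[ℝ] Param d}
    (hB : ∀ y z, inner ℝ (B y) z = inner ℝ y (B z)) {a : ℝ} :
    a ≤ lambdaMin B ↔ ∀ x, a * ‖x‖ ^ 2 ≤ inner ℝ (B x) x := by
  have : Nontrivial (Param d) := by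
    have : Nonempty (Fin d) := ⟨⟨0, hd⟩⟩
    infer_instance
  have hsymm : (B : Param d →ₗ[ℝ] Param d).IsSymmetric := hB
  have hlow : ∀ c, (∀ x, c * ‖x‖ ^ 2 ≤ inner ℝ (B x) x) →
      ∀ lam ∈ {lam : ℝ | Module.End.HasEigenvalue (B : Param d →ₗ[ℝ] Param d) lam}, c ≤ lam := by
    intro c hc lam hlam
    obtain ⟨v, hv⟩ := hlam.exists_hasEigenvector
    have h1 := hc v
    have h2 : B v = lam • v := hv.apply_eq_smul
    rw [h2, inner_smul_left, real_inner_self_eq_norm_sq, conj_trivial] at h1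
    have h3 : 0 < ‖v‖ ^ 2 := by have := norm_pos_iff.2 hv.2; positivity
    exact le_of_mul_le_mul_right h1 h3
  have hbdd : ∀ x, -‖B‖ * ‖x‖ ^ 2 ≤ inner ℝ (B x) x := by
    intro x
    have h1 := abs_real_inner_le_norm (B x) x
    have h2 := B.le_opNorm x
    have h3 := neg_abs_le (inner ℝ (B x) x)
    nlinarith [norm_nonneg x]
  have heig := hsymm.hasEigenvalue_iInf_of_finiteDimensional
  constructor
  · intro ha x
    rcases eq_or_ne x 0 with rfl | hx
    · simp
    have h1 : lambdaMin B ≤ ⨅ x : { x : Param d // x ≠ 0 },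
        RCLike.re (inner ℝ ((B : Param d →ₗ[ℝ] Param d) x) (x : Param d)) / ‖(x : Param d)‖ ^ 2 :=
      csInf_le ⟨_, hlow _ hbdd⟩ heig
    have hb : BddBelow (Set.range fun x : { x : Param d // x ≠ 0 } =>
        RCLike.re (inner ℝ ((B : Param d →ₗ[ℝ] Param d) x) (x : Param d))
          / ‖(x : Param d)‖ ^ 2) := by
      refine ⟨-‖B‖, ?_⟩
      rintro _ ⟨y, rfl⟩
      have h3 : 0 < ‖(y : Param d)‖ ^ 2 := by have := norm_pos_iff.2 y.2; positivity
      simp only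
      rw [le_div_iff₀ h3]
      exact hbdd y
    have h2 := ha.trans (h1.trans (ciInf_le hb ⟨x, hx⟩))
    have h3 : 0 < ‖x‖ ^ 2 := by have := norm_pos_iff.2 hx; positivity
    rw [le_div_iff₀ h3] at h2
    exact h2
  · exact fun h => le_csInf ⟨_, heig⟩ (hlow a h)

theorem lambdaMin_le_norm (hd : 0 < d) {B : Param d →L[ℝ] Param d}
    (hB : ∀ y z, inner ℝ (B y) z = inner ℝ y (B z)) : |lambdaMin B| ≤ ‖B‖ := by
  have hbdd : ∀ x, |inner ℝ (B x) x| ≤ ‖B‖ * ‖x‖ ^ 2 := by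
    intro x
    have h1 := abs_real_inner_le_norm (B x) x
    have h2 := B.le_opNorm x
    nlinarith [norm_nonneg x]
  rw [abs_le]
  constructor
  · exact (le_lambdaMin_iff hd hB).2 fun x => by have := abs_le.1 (hbdd x); linarith
  · have : Nontrivial (Param d) := by
      have : Nonempty (Fin d) := ⟨⟨0, hd⟩⟩
      infer_instance
    obtain ⟨x, hx⟩ := exists_ne (0 : Param d)
    have h1 := (le_lambdaMin_iff hd hB).1 le_rfl x
    have h2 := (abs_le.1 (hbdd x)).2
    have h3 : 0 < ‖x‖ ^ 2 := by have := norm_pos_iff.2 hx; positivity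
    exact le_of_mul_le_mul_right (h1.trans h2) h3

theorem inner_projected (g v : Param d) (B : Param d →L[ℝ] Param d) (x y : Param d) :
    inner ℝ (projected g v B x) y = inner ℝ
      (B ((Submodule.span ℝ {g, v}).starProjection x)) ((Submodule.span ℝ {g, v}).starProjection y) := by
  simp only [projected, ContinuousLinearMap.comp_apply]
  exact Submodule.inner_starProjection_left_eq_right _ _ _

theorem isSymmetric_projected (g v : Param d) {B : Param d →L[ℝ] Param d}
    (hB : ∀ y z, inner ℝ (B y) z = inner ℝ y (B z)) (x y : Param d) :
    inner ℝ (projected g v B x) y = inner ℝ x (projected g v B y) := by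
  rw [inner_projected, ← real_inner_comm x, inner_projected, hB, real_inner_comm]

theorem norm_projected_le (g v : Param d) (B : Param d →L[ℝ] Param d) :
    ‖projected g v B‖ ≤ ‖B‖ := by
  set P := (Submodule.span ℝ {g, v}).starProjection
  have h1 : ‖P‖ ≤ 1 := Submodule.starProjection_norm_le _
  calc ‖P ∘L B ∘L P‖ ≤ ‖P‖ * (‖B‖ * ‖P‖) :=
        (ContinuousLinearMap.opNorm_comp_le _ _).trans
          (mul_le_mul_of_nonneg_left (ContinuousLinearMap.opNorm_comp_le _ _) (norm_nonneg _))
    _ ≤ 1 * (‖B‖ * 1) := by gcongr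
    _ = ‖B‖ := by ring

/-- A lower bound of the quadratic form on the subspace bounds the smallest eigenvalue of the
compression. -/
theorem le_lambdaMin_projected (hd : 0 < d) {g v : Param d} {B : Param d →L[ℝ] Param d}
    (hB : ∀ y z, inner ℝ (B y) z = inner ℝ y (B z)) {b : ℝ} (hb : 0 ≤ b)
    (h : ∀ x ∈ Submodule.span ℝ {g, v}, -b * ‖x‖ ^ 2 ≤ inner ℝ (B x) x) :
    -b ≤ lambdaMin (projected g v B) := by
  refine (le_lambdaMin_iff hd (isSymmetric_projected g v hB)).2 fun x => ?_
  rw [inner_projected]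
  refine le_trans ?_ (h _ (Submodule.starProjection_apply_mem _ x))
  have h1 : ‖(Submodule.span ℝ {g, v}).starProjection x‖ ≤ ‖x‖ :=
    Submodule.norm_starProjection_apply_le _ x
  -- Projecting shortens `x`, so a nonpositive lower bound survives. For a positive one this fails,
  -- because the compression vanishes off the plane.
  rw [neg_mul, neg_mul, neg_le_neg_iff]
  gcongr

/-- Projection onto a plane by the Gram–Schmidt process. -/
theorem starProjection_span_pair (g v x : Param d) :
    (Submodule.span ℝ {g, v}).starProjection x =
      (inner ℝ g x / ‖g‖ ^ 2) • g +
        (inner ℝ (v - (inner ℝ g v / ‖g‖ ^ 2) • g) x / ‖v - (inner ℝ g v / ‖g‖ ^ 2) • g‖ ^ 2) •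
          (v - (inner ℝ g v / ‖g‖ ^ 2) • g) := by
  set w := v - (inner ℝ g v / ‖g‖ ^ 2) • g with hw
  have hg : g ∈ Submodule.span ℝ {g, v} := Submodule.subset_span (by simp)
  have hv : v ∈ Submodule.span ℝ {g, v} := Submodule.subset_span (by simp)
  have hwS : w ∈ Submodule.span ℝ {g, v} := Submodule.sub_mem _ hv (Submodule.smul_mem _ _ hg)
  -- For `u = 0` both sides vanish with the convention `0 / 0 = 0`, so the formula also covers
  -- degenerate spans.
  have hdiv : ∀ u y : Param d, inner ℝ u y / ‖u‖ ^ 2 * ‖u‖ ^ 2 = inner ℝ u y := by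
    intro u y
    rcases eq_or_ne u 0 with rfl | hu
    · simp
    · have := norm_pos_iff.2 hu
      field_simp
  have hgw : inner ℝ g w = 0 := by
    rw [hw, inner_sub_right, inner_smul_right, real_inner_self_eq_norm_sq, hdiv, sub_self]
  refine Submodule.eq_starProjection_of_mem_of_inner_eq_zero
    (Submodule.add_mem _ (Submodule.smul_mem _ _ hg) (Submodule.smul_mem _ _ hwS)) ?_
  have h1 : inner ℝ g (x - ((inner ℝ g x / ‖g‖ ^ 2) • g + (inner ℝ w x / ‖w‖ ^ 2) • w)) = 0 := by
    rw [inner_sub_right, inner_add_right, inner_smul_right, inner_smul_right, hgw,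
      real_inner_self_eq_norm_sq, hdiv]
    ring
  have h2 : inner ℝ w (x - ((inner ℝ g x / ‖g‖ ^ 2) • g + (inner ℝ w x / ‖w‖ ^ 2) • w)) = 0 := by
    rw [inner_sub_right, inner_add_right, inner_smul_right, inner_smul_right,
      real_inner_comm g w, hgw, real_inner_self_eq_norm_sq, hdiv]
    ring
  have h3 : inner ℝ v (x - ((inner ℝ g x / ‖g‖ ^ 2) • g + (inner ℝ w x / ‖w‖ ^ 2) • w)) = 0 := by
    have : v = w + (inner ℝ g v / ‖g‖ ^ 2) • g := by rw [hw]; abel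
    nth_rewrite 1 [this]
    rw [inner_add_left, inner_smul_left, h1, h2]
    simp
  intro y hy
  obtain ⟨a, b, rfl⟩ := Submodule.mem_span_pair.1 hy
  rw [inner_add_right, inner_smul_right, inner_smul_right, real_inner_comm, h1,
    real_inner_comm, h3]
  simp

/-- Superlevel sets are countable intersections of quadratic form inequalities over a dense
sequence. The Gram–Schmidt formula makes the projection measurable even where the dimension of the
span changes. -/
theorem measurable_lambdaMin_projected (hd : 0 < d) {Ω : Type*} [MeasurableSpace Ω]
    {g v : Ω → Param d} {B : Ω → Param d →L[ℝ] Param d} (hg : Measurable g) (hv : Measurable v)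
    (hBm : Measurable B) (hB : ∀ ω y z, inner ℝ (B ω y) z = inner ℝ y (B ω z)) :
    Measurable fun ω => lambdaMin (projected (g ω) (v ω) (B ω)) := by
  refine measurable_of_Ici fun a => ?_
  have hset : (fun ω => lambdaMin (projected (g ω) (v ω) (B ω))) ⁻¹' Set.Ici a
      = ⋂ n, {ω | a * ‖TopologicalSpace.denseSeq (Param d) n‖ ^ 2 ≤
        inner ℝ (projected (g ω) (v ω) (B ω) (TopologicalSpace.denseSeq (Param d) n))
          (TopologicalSpace.denseSeq (Param d) n)} := by
    ext ω
    simp only [Set.mem_preimage, Set.mem_Ici, Set.mem_iInter, Set.mem_ofPred_eq]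
    rw [le_lambdaMin_iff hd (isSymmetric_projected _ _ (hB ω))]
    constructor
    · exact fun h n => h _
    · intro h x
      have hcl : IsClosed {x | a * ‖x‖ ^ 2 ≤ inner ℝ (projected (g ω) (v ω) (B ω) x) x} :=
        isClosed_le (by fun_prop) (by fun_prop)
      have hdense := TopologicalSpace.denseRange_denseSeq (Param d)
      exact hdense.induction_on (p := fun x => a * ‖x‖ ^ 2 ≤
        inner ℝ (projected (g ω) (v ω) (B ω) x) x) x hcl h
  rw [hset]
  refine MeasurableSet.iInter fun n => measurableSet_le measurable_const ?_
  simp only [inner_projected]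
  have hP : ∀ x, Measurable fun ω => (Submodule.span ℝ {g ω, v ω}).starProjection x := by
    intro x
    simp only [starProjection_span_pair]
    fun_prop
  have hBP : Measurable fun ω => B ω ((Submodule.span ℝ {g ω, v ω}).starProjection
      (TopologicalSpace.denseSeq (Param d) n)) := by
    have hc : Continuous fun z : (Param d →L[ℝ] Param d) × Param d => z.1 z.2 :=
      isBoundedBilinearMap_apply.continuous
    exact hc.measurable.comp (hBm.prodMk (hP _))
  exact hBP.inner (hP _)

end LambdaMin

end Model

/-! ### The path estimates for a run -/

section PathwiseGuarantees

variable {S A : Type*} [MeasurableSpace S] [MeasurableSpace A]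

namespace Run

variable {𝔐 : MDP S A} {d : ℕ} {π : Policy 𝔐 d} {H : ℕ} [NeZero H] {Ω : Type*}
  [mΩ : MeasurableSpace Ω] {μ : Measure Ω} {ℱ : Filtration ℕ mΩ}
  {θ₀ : Param d} {Δ : ℝ} {T Ng NH : ℕ} (run : Run π H μ ℱ θ₀ Δ T Ng NH)
  {R G L M C c σ : ℝ} (hπ : π.Bounds (H := H) R G L)

theorem exists_step (hc : 0 < c) (hσ : 0 < σ) (hΔ : Δ = 2 * σ) {t : ℕ} (ht : t < T) (ω : Ω) :
    ∃ lam, TrustRegionStep (Submodule.span ℝ {run.g t ω, run.dir t ω}) ((c * σ) • run.g t ω)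
      ((c * σ ^ 2) • run.hess t ω) (σ⁻¹ • run.θ (t + 1) ω - σ⁻¹ • run.θ t ω) lam := by
  subst hΔ
  have h := run.solves t ht ω
  obtain ⟨lam, hlam⟩ := h.exists_trustRegionStep hc hσ (π.isSymmetric_hessBatch _ _)
  refine ⟨lam, ?_⟩
  have e : σ⁻¹ • run.θ (t + 1) ω - σ⁻¹ • run.θ t ω = σ⁻¹ • (-(run.α t ω 0) • run.g t ω
      + run.α t ω 1 • run.dir t ω) := by
    rw [← smul_sub, run.update t ht ω]
    congr 1
    rw [neg_smul]
    simp only [g, dir]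
    abel
  rw [e]
  exact hlam

include hπ

theorem scaled (hc : 0 < c) (hσ : 0 < σ) (hcσ : c * σ ^ 3 * M = 1)
    (hLip : ∀ θ₁ θ₂ : Param d, ‖π.hessJ H θ₁ - π.hessJ H θ₂‖ ≤ M * ‖θ₁ - θ₂‖) :
    LipschitzHessian 1 (fun y => c * π.J H (σ • y)) (fun y => (c * σ) • π.gradJ H (σ • y))
      (fun y => (c * σ ^ 2) • π.hessJ H (σ • y)) :=
  LipschitzHessian.scale hc hσ hcσ hπ.hasGradientAt hπ.hasFDerivAt_gradJ fun x y => hLip y x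

theorem iInf_J_le (θ : Param d) : ⨅ θ, π.J H θ ≤ π.J H θ :=
  ciInf_le ⟨-(1 / (1 - 𝔐.disc) * R), by
    rintro _ ⟨θ, rfl⟩; exact (abs_le.1 (hπ.abs_J_le θ)).1⟩ θ

theorem sum_norm_gradJ_le (hc : 0 < c) (hσ : 0 < σ) (hcσ : c * σ ^ 3 * M = 1) (hΔ : Δ = 2 * σ)
    (hLip : ∀ θ₁ θ₂ : Param d, ‖π.hessJ H θ₁ - π.hessJ H θ₂‖ ≤ M * ‖θ₁ - θ₂‖) (hC0 : 0 ≤ C)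
    {ω : Ω} (hC : ∀ t < T, ‖(π.hessJ H (run.θ t ω) - run.projHess t ω) (run.dir (t + 1) ω)‖
      ≤ M * C * ‖run.dir (t + 1) ω‖ ^ 2) :
    ∑ t ∈ Finset.range T, c * σ * ‖π.gradJ H (run.θ (t + 1) ω)‖
      ≤ T * (38 / 15 + 4 * C) + c * (π.J H θ₀ - ⨅ θ, π.J H θ) +
        ∑ t ∈ Finset.range T, ((3 * (c * σ * run.gradErr t ω) + 4 * (c * σ ^ 2 * run.hessErr t ω)) +
          if t + 1 < T then c * σ * run.gradErr (t + 1) ω + c * σ ^ 2 * run.hessErr (t + 1) ω / 2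
          else 1 / 6) := by
  have hstep := fun t (ht : t < T) => run.exists_step hc hσ hΔ ht ω
  choose! lam hlam using hstep
  have hback : ∀ x : Param d, σ • σ⁻¹ • x = x := fun x => by
    rw [smul_smul, mul_inv_cancel₀ hσ.ne', one_smul]
  have h := sum_norm_grad_le (scaled hπ hc hσ hcσ hLip) (fstar := c * ⨅ θ, π.J H θ)
    (fun y => mul_le_mul_of_nonneg_left (iInf_J_le hπ _) hc.le) (T := T)
    (θ := fun t => σ⁻¹ • run.θ t ω) hC0 hlam (fun t ht => ?_) fun t ht => ?_
  · simp only [hback, ← smul_sub, norm_smul, Real.norm_of_nonneg (mul_pos hc hσ).le,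
      Real.norm_of_nonneg (mul_pos hc (pow_pos hσ 2)).le, run.start, ← mul_sub] at h
    exact h
  · rw [← smul_sub]
    exact Submodule.smul_mem _ _ (Submodule.subset_span (by simp [dir, lastStep]))
  · simp only [hback]
    set P := (Submodule.span ℝ {run.g t ω, run.dir t ω}).starProjection
    have e : ((c * σ ^ 2) • π.hessJ H (run.θ t ω) - P ∘L ((c * σ ^ 2) • π.hessJ H (run.θ t ω)) ∘L P)
        (σ⁻¹ • run.θ (t + 1) ω - σ⁻¹ • run.θ t ω)
        = (c * σ) • ((π.hessJ H (run.θ t ω) - run.projHess t ω) (run.dir (t + 1) ω)) := by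
      have e1 : σ⁻¹ • run.θ (t + 1) ω - σ⁻¹ • run.θ t ω = σ⁻¹ • run.dir (t + 1) ω := by
        rw [← smul_sub]; rfl
      rw [e1]
      simp only [projHess, projected, _root_.sub_apply, ContinuousLinearMap.comp_apply,
        _root_.smul_apply, map_smul, smul_smul, smul_sub]
      have e2 : σ⁻¹ * (c * σ ^ 2) = c * σ := by field_simp
      simp only [e2, P]
    have e1 : σ⁻¹ • run.θ (t + 1) ω - σ⁻¹ • run.θ t ω = σ⁻¹ • run.dir (t + 1) ω := by
      rw [← smul_sub]; rfl
    rw [e, e1, norm_smul, norm_smul, Real.norm_of_nonneg (by positivity),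
      Real.norm_of_nonneg (by positivity)]
    calc _ ≤ c * σ * (M * C * ‖run.dir (t + 1) ω‖ ^ 2) := by gcongr; exact hC t ht
      _ = (c * σ ^ 3 * M) * (C * (σ⁻¹ * ‖run.dir (t + 1) ω‖) ^ 2) := by field_simp
      _ = _ := by rw [hcσ, one_mul]

theorem lambdaMin_projHess_of_step (hd : 0 < d) (hc : 0 < c) (hσ : 0 < σ) {t : ℕ} {ω : Ω} {lam : ℝ}
    (h : TrustRegionStep (Submodule.span ℝ {run.g t ω, run.dir t ω}) ((c * σ) • run.g t ω)
      ((c * σ ^ 2) • run.hess t ω) (σ⁻¹ • run.θ (t + 1) ω - σ⁻¹ • run.θ t ω) lam) :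
    -(c * σ ^ 2 * lambdaMin (run.projHess t ω)) ≤ lam + c * σ ^ 2 * run.hessErr t ω := by
  have hk : 0 < c * σ ^ 2 := by positivity
  have hlam := h.lam_nonneg
  have he : 0 ≤ run.hessErr t ω := norm_nonneg _
  have h1 := le_lambdaMin_projected hd (hπ.inner_hessJ_comm (run.θ t ω))
    (g := run.g t ω) (v := run.dir t ω) (b := lam / (c * σ ^ 2) + run.hessErr t ω) (by positivity)
    fun x hx => by
      have h2 := h.psd x hx
      rw [_root_.smul_apply, inner_smul_right] at h2
      have h3 := (noise_bounds x x (π.hessJ H (run.θ t ω) - run.hess t ω)).2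
      have h4 := (abs_le.1 h3).1
      rw [_root_.sub_apply, inner_sub_right] at h4
      change -(‖x‖ ^ 2 * run.hessErr t ω) ≤ _ at h4
      rw [real_inner_comm]
      have h5 : -(lam / (c * σ ^ 2)) * ‖x‖ ^ 2 ≤ inner ℝ x (run.hess t ω x) := by
        rw [neg_mul, div_mul_eq_mul_div, ← neg_div, div_le_iff₀ hk]
        linarith
      linarith
  have h2 : -(c * σ ^ 2 * lambdaMin (run.projHess t ω))
      ≤ c * σ ^ 2 * (lam / (c * σ ^ 2) + run.hessErr t ω) := by
    rw [← mul_neg]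
    refine mul_le_mul_of_nonneg_left ?_ hk.le
    have : -(lam / (c * σ ^ 2) + run.hessErr t ω) ≤ lambdaMin (run.projHess t ω) := h1
    linarith
  refine h2.trans (le_of_eq ?_)
  field_simp

/-- Needed at the final iterate, which has no multiplier. The bound concerns the full Hessian and
therefore every plane. -/
theorem lambdaMin_projHess_last (hd : 0 < d) (hc : 0 < c) (hσ : 0 < σ) (hcσ : c * σ ^ 3 * M = 1)
    (hLip : ∀ θ₁ θ₂ : Param d, ‖π.hessJ H θ₁ - π.hessJ H θ₂‖ ≤ M * ‖θ₁ - θ₂‖) (t : ℕ) (ω : Ω) :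
    -(c * σ ^ 2 * lambdaMin (run.projHess t ω))
      ≤ 2 / 3 + c * (π.J H (run.θ t ω) - ⨅ θ, π.J H θ) / 2 := by
  have hk : 0 < c * σ ^ 2 := by positivity
  set b := 2 / 3 + c * (π.J H (run.θ t ω) - ⨅ θ, π.J H θ) / 2 with hb
  have hb0 : 0 ≤ b := by
    have := iInf_J_le hπ (run.θ t ω)
    have : 0 ≤ π.J H (run.θ t ω) - ⨅ θ, π.J H θ := by linarith
    positivity
  have hback : σ • σ⁻¹ • run.θ t ω = run.θ t ω := by
    rw [smul_smul, mul_inv_cancel₀ hσ.ne', one_smul]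
  have h1 := le_lambdaMin_projected hd (hπ.inner_hessJ_comm (run.θ t ω))
    (g := run.g t ω) (v := run.dir t ω) (b := b / (c * σ ^ 2)) (by positivity) fun x _ => by
      rcases eq_or_ne x 0 with rfl | hx
      · simp
      have hn := norm_pos_iff.2 hx
      have h2 := neg_curvature_le (scaled hπ hc hσ hcσ hLip) (fstar := c * ⨅ θ, π.J H θ)
        (fun y => mul_le_mul_of_nonneg_left (iInf_J_le hπ _) hc.le) (σ⁻¹ • run.θ t ω)
        (w := ‖x‖⁻¹ • x) (by rw [norm_smul, norm_inv, norm_norm, inv_mul_cancel₀ hn.ne'])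
      simp only [hback, _root_.smul_apply, map_smul, inner_smul_left, inner_smul_right,
        conj_trivial, ← mul_sub] at h2
      rw [← hb] at h2
      have h3 : c * σ ^ 2 * (‖x‖⁻¹ * (‖x‖⁻¹ * inner ℝ (π.hessJ H (run.θ t ω) x) x))
          = c * σ ^ 2 * inner ℝ (π.hessJ H (run.θ t ω) x) x / ‖x‖ ^ 2 := by field_simp
      have h4 : -(c * σ ^ 2 * inner ℝ (π.hessJ H (run.θ t ω) x) x / ‖x‖ ^ 2) ≤ b := by
        rw [← h3]; linarith
      rw [← neg_div, div_le_iff₀ (by positivity)] at h4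
      rw [neg_mul, div_mul_eq_mul_div, ← neg_div, div_le_iff₀ hk]
      linarith
  have h2 : -(c * σ ^ 2 * lambdaMin (run.projHess t ω)) ≤ c * σ ^ 2 * (b / (c * σ ^ 2)) := by
    rw [← mul_neg]
    refine mul_le_mul_of_nonneg_left ?_ hk.le
    have : -(b / (c * σ ^ 2)) ≤ lambdaMin (run.projHess t ω) := h1
    linarith
  refine h2.trans (le_of_eq ?_)
  field_simp

theorem sum_lambdaMin_ge (hd : 0 < d) (hc : 0 < c) (hσ : 0 < σ) (hcσ : c * σ ^ 3 * M = 1)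
    (hΔ : Δ = 2 * σ)
    (hLip : ∀ θ₁ θ₂ : Param d, ‖π.hessJ H θ₁ - π.hessJ H θ₂‖ ≤ M * ‖θ₁ - θ₂‖) (hT : 0 < T)
    (ω : Ω) :
    ∑ t ∈ Finset.range T, -(c * σ ^ 2 * lambdaMin (run.projHess (t + 1) ω))
      ≤ c * (π.J H θ₀ - ⨅ θ, π.J H θ) / 2 + 2 / 3 +
        ∑ t ∈ Finset.range T,
          (2 / 3 + c * σ * run.gradErr t ω + 2 * (c * σ ^ 2 * run.hessErr t ω)) := by
  have hstep := fun t (ht : t < T) => run.exists_step hc hσ hΔ ht ω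
  choose! lam hlam using hstep
  have hback : ∀ x : Param d, σ • σ⁻¹ • x = x := fun x => by
    rw [smul_smul, mul_inv_cancel₀ hσ.ne', one_smul]
  have hmul := sum_multiplier_le (scaled hπ hc hσ hcσ hLip) (θ := fun t => σ⁻¹ • run.θ t ω) hlam
  simp only [hback, ← smul_sub, norm_smul, Real.norm_of_nonneg (mul_pos hc hσ).le,
    Real.norm_of_nonneg (mul_pos hc (pow_pos hσ 2)).le, run.start] at hmul
  change _ ≤ _ + ∑ t ∈ Finset.range T, (4 / 3 + 2 * (c * σ * run.gradErr t ω)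
    + 2 * (c * σ ^ 2 * run.hessErr t ω)) at hmul
  obtain ⟨n, rfl⟩ : ∃ n, T = n + 1 := ⟨T - 1, by omega⟩
  have hlast := run.lambdaMin_projHess_last hπ hd hc hσ hcσ hLip (n + 1) ω
  have hmid : ∑ t ∈ Finset.range n, -(c * σ ^ 2 * lambdaMin (run.projHess (t + 1) ω))
      ≤ ∑ t ∈ Finset.range (n + 1), (lam t + c * σ ^ 2 * run.hessErr t ω) := by
    -- The iterates `1, …, T - 1` correspond to the steps with the same indices. Step 0 is
    -- unmatched, and its nonnegative term is only added on the right.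
    rw [Finset.sum_range_succ']
    refine (Finset.sum_le_sum fun t ht => run.lambdaMin_projHess_of_step hπ hd hc hσ
      (hlam (t + 1) (by have := Finset.mem_range.1 ht; omega))).trans ?_
    have h0 := (hlam 0 (by omega)).lam_nonneg
    have : 0 ≤ run.hessErr 0 ω := norm_nonneg _
    have : 0 ≤ c * σ ^ 2 * run.hessErr 0 ω := by positivity
    linarith
  rw [Finset.sum_range_succ]
  simp only [Finset.sum_add_distrib, ← Finset.mul_sum] at hmid hmul ⊢
  simp only [Finset.sum_const] at hmul ⊢
  simp only [nsmul_eq_mul] at hmul ⊢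
  linarith

end Run

end PathwiseGuarantees

/-! ### Expectations and the random output index -/

section ExpectedGuarantees

/-- Expectation of a family of random variables at an independent uniform index. -/
theorem integral_uniform_index {Ω : Type*} {m mΩ : MeasurableSpace Ω} {μ : Measure Ω}
    [IsProbabilityMeasure μ] {T : ℕ} (hT : 0 < T) {tbar : Ω → ℕ}
    (htbar : Measurable tbar) (hunif : μ.map tbar = uniformOn (Set.Icc 1 T))
    (hindep : Indep (MeasurableSpace.comap tbar ⊤) m μ) {X : ℕ → Ω → ℝ}
    (hXm : ∀ t < T, Measurable[m] (X (t + 1))) (hXi : ∀ t < T, Integrable (X (t + 1)) μ) :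
    Integrable (fun ω => X (tbar ω) ω) μ ∧
      ∫ ω, X (tbar ω) ω ∂μ = (T : ℝ)⁻¹ * ∑ t ∈ Finset.range T, ∫ ω, X (t + 1) ω ∂μ := by
  have hfin : (Set.Icc 1 T).Finite := Set.finite_Icc 1 T
  have hne : (Set.Icc 1 T).Nonempty := ⟨1, by simp; omega⟩
  have hmem : ∀ᵐ ω ∂μ, tbar ω ∈ Set.Icc 1 T := by
    have h1 : ∀ᵐ t ∂(μ.map tbar), t ∈ Set.Icc 1 T := by
      rw [hunif, ae_iff]
      have := isProbabilityMeasure_uniformOn hfin hne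
      have h2 : uniformOn (Set.Icc 1 T) (Set.Icc 1 T) = 1 := uniformOn_self hfin hne
      exact (prob_compl_eq_zero_iff (measurableSet_Icc)).2 h2
    exact ae_of_ae_map htbar.aemeasurable h1
  have hprob : ∀ t < T, μ.real (tbar ⁻¹' {t + 1}) = (T : ℝ)⁻¹ := by
    intro t ht
    have h1 : μ (tbar ⁻¹' {t + 1}) = (T : ENNReal)⁻¹ := by
      rw [← Measure.map_apply htbar (measurableSet_singleton _), hunif, uniformOn,
        cond_apply measurableSet_Icc, Set.inter_eq_self_of_subset_right (by simp; omega),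
        Measure.count_singleton, mul_one, Measure.count_apply_finite _ hfin]
      simp
    rw [Measure.real, h1]
    simp
  set ind : ℕ → Ω → ℝ := fun t ω => Set.indicator {t} (fun _ => (1 : ℝ)) (tbar ω) with hind
  have hindm : ∀ t, Measurable (ind t) := fun t =>
    (measurable_const.indicator (measurableSet_singleton t)).comp htbar
  have hindbd : ∀ t ω, ‖ind t ω‖ ≤ 1 := fun t ω => by
    simp only [hind, Set.indicator]; split_ifs <;> simp
  have hindint : ∀ t < T, ∫ ω, ind (t + 1) ω ∂μ = (T : ℝ)⁻¹ := by
    intro t ht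
    have e : ind (t + 1) = (tbar ⁻¹' {t + 1}).indicator 1 := by
      ext ω; simp [hind, Set.indicator]
    rw [e, integral_indicator_one (htbar (measurableSet_singleton _)), hprob t ht]
  -- Splitting by the value of the index makes each summand a product of independent variables.
  have hdec : (fun ω => X (tbar ω) ω) =ᵐ[μ]
      fun ω => ∑ t ∈ Finset.range T, ind (t + 1) ω * X (t + 1) ω := by
    filter_upwards [hmem] with ω hω
    obtain ⟨n, hn⟩ : ∃ n, tbar ω = n + 1 := ⟨tbar ω - 1, by have := hω.1; omega⟩
    have hnT : n ∈ Finset.range T := by have := hω.2; simp; omega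
    rw [Finset.sum_eq_single_of_mem n hnT]
    · simp [hind, hn]
    · intro t _ htn
      have : n ≠ t := fun h => htn h.symm
      simp [hind, hn, this]
  have hterm : ∀ t < T, Integrable (fun ω => ind (t + 1) ω * X (t + 1) ω) μ := fun t ht =>
    (hXi t ht).bdd_mul (hindm _).aestronglyMeasurable (ae_of_all _ (hindbd _))
  refine ⟨(integrable_congr hdec).2 (integrable_finsetSum _ fun t ht =>
    hterm t (Finset.mem_range.1 ht)), ?_⟩
  rw [integral_congr_ae hdec, integral_finsetSum _ fun t ht => hterm t (Finset.mem_range.1 ht),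
    Finset.mul_sum]
  refine Finset.sum_congr rfl fun t ht => ?_
  have ht' := Finset.mem_range.1 ht
  have hI : IndepFun tbar (X (t + 1)) μ :=
    indep_of_indep_of_le_right hindep (hXm t ht').comap_le
  have hI' : IndepFun (ind (t + 1)) (X (t + 1)) μ :=
    hI.comp (φ := Set.indicator {t + 1} fun _ => (1 : ℝ)) (ψ := id)
      (measurable_const.indicator (measurableSet_singleton _)) measurable_id
  rw [← hindint t ht']
  exact hI'.integral_fun_mul_eq_mul_integral (hindm _).aestronglyMeasurable
    (hXi t ht').aestronglyMeasurable

variable {S A : Type*} [MeasurableSpace S] [MeasurableSpace A]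

theorem Policy.measurable_gradBatch_uncurry {𝔐 : MDP S A} {d : ℕ} (π : Policy 𝔐 d) {H : ℕ}
    [NeZero H] {n : ℕ} :
    Measurable fun z : Param d × (Fin n → Traj S A H) => π.gradBatch z.1 z.2 :=
  (stronglyMeasurable_uncurry_of_continuous_of_stronglyMeasurable
    (u := fun (θ : Param d) (ℳ : Fin n → Traj S A H) => π.gradBatch θ ℳ)
    (fun ℳ => π.continuous_gradBatch ℳ)
    fun θ => (π.measurable_gradBatch θ).stronglyMeasurable).measurable

namespace Run

variable {𝔐 : MDP S A} {d : ℕ} {π : Policy 𝔐 d} {H : ℕ} [NeZero H] {Ω : Type*}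
  [mΩ : MeasurableSpace Ω] {μ : Measure Ω} [IsProbabilityMeasure μ] {ℱ : Filtration ℕ mΩ}
  {θ₀ : Param d} {Δ : ℝ} {T Ng NH : ℕ} (run : Run π H μ ℱ θ₀ Δ T Ng NH)
  {R G L M C c σ : ℝ} (hπ : π.Bounds (H := H) R G L)

omit [IsProbabilityMeasure μ] in
theorem measurable_dir {t : ℕ} (ht : t ≤ T) : Measurable[ℱ t] (run.dir t) := by
  cases t with
  | zero => exact measurable_const
  | succ t =>
    exact (run.measurable_θ (t + 1) ht).sub
      ((run.measurable_θ t (by omega)).mono (ℱ.mono (by omega)) le_rfl)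

omit [IsProbabilityMeasure μ] in
theorem measurable_g {t : ℕ} (ht : t ≤ T) : Measurable[ℱ (t + 1)] (run.g t) := by
  have h1 : Measurable[ℱ (t + 1)] (run.θ t) :=
    (run.measurable_θ t ht).mono (ℱ.mono (Nat.le_succ t)) le_rfl
  have h2 := (π.measurable_gradBatch_uncurry (H := H) (n := Ng)).comp
    (h1.prodMk (run.measurable_batchG t ht))
  exact h2

include hπ

omit [IsProbabilityMeasure μ] in
theorem measurable_norm_gradJ {t : ℕ} (ht : t ≤ T) :
    Measurable[ℱ (T + 1)] fun ω => ‖π.gradJ H (run.θ t ω)‖ := by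
  have hgc : Continuous (π.gradJ H) := continuous_iff_continuousAt.2 fun θ =>
    (hπ.hasFDerivAt_gradJ θ).continuousAt
  exact (hgc.norm.measurable).comp ((run.measurable_θ t ht).mono (ℱ.mono (by omega)) le_rfl)

omit [IsProbabilityMeasure μ] in
theorem measurable_lambdaMin_projHess (hd : 0 < d) {t : ℕ} (ht : t ≤ T) :
    Measurable[ℱ (T + 1)] fun ω => lambdaMin (run.projHess t ω) := by
  have h1 : Measurable[ℱ (T + 1)] (run.θ t) :=
    (run.measurable_θ t ht).mono (ℱ.mono (by omega)) le_rfl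
  have h2 : Measurable[ℱ (T + 1)] (run.g t) :=
    (run.measurable_g ht).mono (ℱ.mono (by omega)) le_rfl
  have h3 : Measurable[ℱ (T + 1)] (run.dir t) :=
    (run.measurable_dir ht).mono (ℱ.mono (by omega)) le_rfl
  exact @measurable_lambdaMin_projected d hd Ω (ℱ (T + 1)) (run.g t) (run.dir t)
    (fun ω => π.hessJ H (run.θ t ω)) h2 h3 (hπ.continuous_hessJ.measurable.comp h1)
    fun ω => hπ.inner_hessJ_comm _

theorem integrable_norm_gradJ {t : ℕ} (ht : t ≤ T) :
    Integrable (fun ω => ‖π.gradJ H (run.θ t ω)‖) μ :=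
  Integrable.of_bound ((run.measurable_norm_gradJ hπ ht).mono (ℱ.le _) le_rfl).aestronglyMeasurable
    (Real.sqrt (gradVar G R 𝔐.disc)) (ae_of_all _ fun ω => by
      rw [norm_norm]; exact Real.le_sqrt_of_sq_le (hπ.norm_gradJ_sq_le _))

theorem integrable_lambdaMin_projHess (hd : 0 < d) {t : ℕ} (ht : t ≤ T) :
    Integrable (fun ω => lambdaMin (run.projHess t ω)) μ :=
  Integrable.of_bound
    ((run.measurable_lambdaMin_projHess hπ hd ht).mono (ℱ.le _) le_rfl).aestronglyMeasurable
    (Real.sqrt (hessVar H G L R 𝔐.disc)) (ae_of_all _ fun ω => by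
      rw [Real.norm_eq_abs]
      exact (lambdaMin_le_norm hd (isSymmetric_projected _ _ (hπ.inner_hessJ_comm _))).trans
        ((norm_projected_le _ _ _).trans (Real.le_sqrt_of_sq_le (hπ.norm_hessJ_sq_le _))))

theorem sum_integral_norm_gradJ_le (hc : 0 < c) (hσ : 0 < σ) (hcσ : c * σ ^ 3 * M = 1)
    (hΔ : Δ = 2 * σ)
    (hLip : ∀ θ₁ θ₂ : Param d, ‖π.hessJ H θ₁ - π.hessJ H θ₂‖ ≤ M * ‖θ₁ - θ₂‖) (hC0 : 0 ≤ C)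
    (hT : 0 < T) (hgap : c * (π.J H θ₀ - ⨅ θ, π.J H θ) ≤ T / 24)
    (hC : ∀ t < T, ∀ᵐ ω ∂μ, ‖(π.hessJ H (run.θ t ω) - run.projHess t ω) (run.dir (t + 1) ω)‖
      ≤ M * C * ‖run.dir (t + 1) ω‖ ^ 2)
    (hg : ∀ t ≤ T, Integrable (run.gradErr t) μ ∧ c * σ * ∫ ω, run.gradErr t ω ∂μ ≤ 1 / 12)
    (hh : ∀ t < T, Integrable (run.hessErr t) μ ∧ c * σ ^ 2 * ∫ ω, run.hessErr t ω ∂μ ≤ 1 / 24) :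
    c * σ * ∑ t ∈ Finset.range T, ∫ ω, ‖π.gradJ H (run.θ (t + 1) ω)‖ ∂μ
      ≤ T * (3 + 4 * (C + 1 / 24)) := by
  have hae : ∀ᵐ ω ∂μ, ∀ t < T,
      ‖(π.hessJ H (run.θ t ω) - run.projHess t ω) (run.dir (t + 1) ω)‖
        ≤ M * C * ‖run.dir (t + 1) ω‖ ^ 2 := by
    rw [ae_all_iff]
    intro t
    by_cases ht : t < T
    · filter_upwards [hC t ht] with ω hω _ using hω
    · exact ae_of_all _ fun ω h => absurd h ht
  set X : ℕ → Ω → ℝ := fun t ω =>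
    (3 * (c * σ * run.gradErr t ω) + 4 * (c * σ ^ 2 * run.hessErr t ω)) +
      if t + 1 < T then c * σ * run.gradErr (t + 1) ω + c * σ ^ 2 * run.hessErr (t + 1) ω / 2
      else 1 / 6 with hX
  have hXi : ∀ t < T, Integrable (X t) μ ∧
      -- With mean errors 1/12 and 1/24: `5/12 = 3/12 + 4/24` and `5/48 = 1/12 + 1/48`.
      ∫ ω, X t ω ∂μ ≤ 5 / 12 + if t + 1 < T then 5 / 48 else 1 / 6 := by
    intro t ht
    have i1 : Integrable (fun ω => 3 * (c * σ * run.gradErr t ω)) μ :=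
      ((hg t ht.le).1.const_mul _).const_mul _
    have i2 : Integrable (fun ω => 4 * (c * σ ^ 2 * run.hessErr t ω)) μ :=
      ((hh t ht).1.const_mul _).const_mul _
    have i3 : Integrable (fun ω => 3 * (c * σ * run.gradErr t ω)
        + 4 * (c * σ ^ 2 * run.hessErr t ω)) μ := i1.add i2
    have b1 := (hg t ht.le).2
    have b2 := (hh t ht).2
    simp only [hX]
    split_ifs with h
    · have j1 : Integrable (fun ω => c * σ * run.gradErr (t + 1) ω) μ :=
        (hg (t + 1) h.le).1.const_mul _
      have j2 : Integrable (fun ω => c * σ ^ 2 * run.hessErr (t + 1) ω / 2) μ :=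
        ((hh (t + 1) h).1.const_mul _).div_const _
      have j3 : Integrable (fun ω => c * σ * run.gradErr (t + 1) ω
        + c * σ ^ 2 * run.hessErr (t + 1) ω / 2) μ := j1.add j2
      have b3 := (hg (t + 1) h.le).2
      have b4 := (hh (t + 1) h).2
      refine ⟨i3.add j3, ?_⟩
      rw [integral_add i3 j3, integral_add i1 i2, integral_add j1 j2, integral_div]
      simp only [integral_const_mul]
      linarith
    · refine ⟨i3.add (integrable_const _), ?_⟩
      rw [integral_add i3 (integrable_const _), integral_add i1 i2]
      simp only [integral_const_mul, integral_const, probReal_univ, smul_eq_mul]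
      linarith
  have hlhs : ∀ t ∈ Finset.range T, Integrable
      (fun ω => c * σ * ‖π.gradJ H (run.θ (t + 1) ω)‖) μ := fun t ht =>
    (run.integrable_norm_gradJ hπ (by have := Finset.mem_range.1 ht; omega)).const_mul _
  have hXs : Integrable (fun ω => ∑ t ∈ Finset.range T, X t ω) μ :=
    integrable_finsetSum _ fun t ht => (hXi t (Finset.mem_range.1 ht)).1
  have hmain : ∫ ω, ∑ t ∈ Finset.range T, c * σ * ‖π.gradJ H (run.θ (t + 1) ω)‖ ∂μ
      ≤ ∫ ω, (T * (38 / 15 + 4 * C) + T / 24 + ∑ t ∈ Finset.range T, X t ω) ∂μ := by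
    refine integral_mono_ae (integrable_finsetSum _ hlhs) ((integrable_const _).add hXs) ?_
    filter_upwards [hae] with ω hω
    have h1 := run.sum_norm_gradJ_le hπ hc hσ hcσ hΔ hLip hC0 hω
    simp only [hX]
    linarith
  rw [integral_finsetSum _ hlhs, integral_add (integrable_const _) hXs,
    integral_finsetSum _ fun t ht => (hXi t (Finset.mem_range.1 ht)).1] at hmain
  simp only [integral_const_mul, ← Finset.mul_sum, integral_const, probReal_univ, smul_eq_mul,
    one_mul] at hmain
  refine hmain.trans ?_
  obtain ⟨n, rfl⟩ : ∃ n, T = n + 1 := ⟨T - 1, by omega⟩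
  -- Per iteration, 38/15 + 1/24 + 25/48 is below 3 + 1/6. The slack of a single iteration covers
  -- the larger last term, so `T = 1` is allowed.
  have hsum : ∑ t ∈ Finset.range (n + 1), ∫ ω, X t ω ∂μ ≤ n * (25 / 48) + 7 / 12 := by
    rw [Finset.sum_range_succ]
    have hlast := (hXi n (by omega)).2
    rw [if_neg (by omega)] at hlast
    have hinit : ∑ t ∈ Finset.range n, ∫ ω, X t ω ∂μ ≤ ∑ _t ∈ Finset.range n, (25 / 48 : ℝ) := by
      refine Finset.sum_le_sum fun t ht => ?_
      have htn := Finset.mem_range.1 ht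
      have := (hXi t (by omega)).2
      rw [if_pos (by omega)] at this
      linarith
    rw [Finset.sum_const, Finset.card_range, nsmul_eq_mul] at hinit
    linarith
  have hn : (0 : ℝ) ≤ n := Nat.cast_nonneg n
  push_cast
  nlinarith

theorem sum_integral_lambdaMin_ge (hd : 0 < d) (hc : 0 < c) (hσ : 0 < σ)
    (hcσ : c * σ ^ 3 * M = 1) (hΔ : Δ = 2 * σ)
    (hLip : ∀ θ₁ θ₂ : Param d, ‖π.hessJ H θ₁ - π.hessJ H θ₂‖ ≤ M * ‖θ₁ - θ₂‖)
    (hT : 0 < T) (hgap : c * (π.J H θ₀ - ⨅ θ, π.J H θ) ≤ T / 24)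
    (hg : ∀ t ≤ T, Integrable (run.gradErr t) μ ∧ c * σ * ∫ ω, run.gradErr t ω ∂μ ≤ 1 / 12)
    (hh : ∀ t < T, Integrable (run.hessErr t) μ ∧ c * σ ^ 2 * ∫ ω, run.hessErr t ω ∂μ ≤ 1 / 24) :
    -(3 * T) ≤ c * σ ^ 2 * ∑ t ∈ Finset.range T, ∫ ω, lambdaMin (run.projHess (t + 1) ω) ∂μ := by
  set X : ℕ → Ω → ℝ := fun t ω =>
    2 / 3 + c * σ * run.gradErr t ω + 2 * (c * σ ^ 2 * run.hessErr t ω) with hX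
  have hXi : ∀ t < T, Integrable (X t) μ ∧ ∫ ω, X t ω ∂μ ≤ 5 / 6 := by
    intro t ht
    have i1 : Integrable (fun ω => c * σ * run.gradErr t ω) μ := (hg t ht.le).1.const_mul _
    have i2 : Integrable (fun ω => 2 * (c * σ ^ 2 * run.hessErr t ω)) μ :=
      ((hh t ht).1.const_mul _).const_mul _
    have i3 : Integrable (fun ω => 2 / 3 + c * σ * run.gradErr t ω) μ := (integrable_const _).add i1
    have b1 := (hg t ht.le).2
    have b2 := (hh t ht).2
    refine ⟨i3.add i2, ?_⟩
    simp only [hX]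
    rw [integral_add i3 i2, integral_add (integrable_const _) i1]
    simp only [integral_const_mul, integral_const, probReal_univ, smul_eq_mul]
    linarith
  have hlhs : ∀ t ∈ Finset.range T, Integrable
      (fun ω => -(c * σ ^ 2 * lambdaMin (run.projHess (t + 1) ω))) μ := fun t ht =>
    ((run.integrable_lambdaMin_projHess hπ hd
      (by have := Finset.mem_range.1 ht; omega)).const_mul _).neg
  have hXs : Integrable (fun ω => ∑ t ∈ Finset.range T, X t ω) μ :=
    integrable_finsetSum _ fun t ht => (hXi t (Finset.mem_range.1 ht)).1
  have hmain : ∫ ω, ∑ t ∈ Finset.range T, -(c * σ ^ 2 * lambdaMin (run.projHess (t + 1) ω)) ∂μ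
      ≤ ∫ ω, (T / 24 / 2 + 2 / 3 + ∑ t ∈ Finset.range T, X t ω) ∂μ := by
    refine integral_mono (integrable_finsetSum _ hlhs) ((integrable_const _).add hXs) fun ω => ?_
    have h1 := run.sum_lambdaMin_ge hπ hd hc hσ hcσ hΔ hLip hT ω
    simp only [hX]
    linarith
  rw [integral_finsetSum _ hlhs, integral_add (integrable_const _) hXs,
    integral_finsetSum _ fun t ht => (hXi t (Finset.mem_range.1 ht)).1] at hmain
  simp only [integral_neg, integral_const_mul, Finset.sum_neg_distrib, ← Finset.mul_sum,
    integral_const, probReal_univ, smul_eq_mul, one_mul] at hmain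
  have hsum : ∑ t ∈ Finset.range T, ∫ ω, X t ω ∂μ ≤ ∑ _t ∈ Finset.range T, (5 / 6 : ℝ) :=
    Finset.sum_le_sum fun t ht => (hXi t (Finset.mem_range.1 ht)).2
  rw [Finset.sum_const, Finset.card_range, nsmul_eq_mul] at hsum
  have hT1 : (1 : ℝ) ≤ T := by exact_mod_cast hT
  linarith

end Run

end ExpectedGuarantees

/-! ### Parameter choices, query count and the final theorem -/

section Output

theorem rpow_three_halves {ε : ℝ} (hε : 0 < ε) : ε ^ (3 / 2 : ℝ) = Real.sqrt ε ^ 3 := by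
  rw [Real.sqrt_eq_rpow, ← Real.rpow_natCast, ← Real.rpow_mul hε.le]
  norm_num

theorem natCast_ceil_le_two_mul {x : ℝ} (hx : 1 ≤ x) : ((⌈x⌉₊ : ℕ) : ℝ) ≤ 2 * x := by
  have := (Nat.ceil_lt_add_one (by linarith : 0 ≤ x)).le
  linarith

theorem gradVar_pos {G R γ : ℝ} (hG : 0 < G) (hR : 0 < R) (hγ : γ < 1) : 0 < gradVar G R γ := by
  have : 0 < 1 - γ := by linarith
  rw [gradVar]; positivity

theorem hessVar_pos {H : ℕ} {G L R γ : ℝ} (hL : 0 < L) (hR : 0 < R) (hγ : γ < 1) :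
    0 < hessVar H G L R γ := by
  have : 0 < 1 - γ := by linarith
  rw [hessVar]; positivity

theorem totalQueries_le {d : ℕ} {M ΔJ Gg2 GH2 ε : ℝ} (hε : 0 < ε) (hΔJ : 0 < ΔJ)
    (hG : 0 ≤ Gg2) (h1 : 1 ≤ iterReal M ΔJ ε) (h2 : 1 ≤ gradSizeReal M Gg2 ε)
    (h3 : 1 ≤ hessSizeReal d GH2 ε) :
    (totalQueries d M ΔJ Gg2 GH2 ε : ℝ) ≤ 2433024 * (ΔJ * M ^ 4 * Gg2 / ε ^ (7 / 2 : ℝ) +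
      ΔJ * M ^ 2 * GH2 * Real.log d / ε ^ (5 / 2 : ℝ)) := by
  have hlog : 0 ≤ Real.log d := Real.log_natCast_nonneg d
  have e7 : ε ^ (7 / 2 : ℝ) = ε ^ (3 / 2 : ℝ) * ε ^ 2 := by
    rw [← Real.rpow_natCast, ← Real.rpow_add hε]; norm_num
  have e5 : ε ^ (5 / 2 : ℝ) = ε ^ (3 / 2 : ℝ) * ε := by
    nth_rewrite 3 [← Real.rpow_one ε]
    rw [← Real.rpow_add hε]; norm_num
  have hp : 0 < ε ^ (3 / 2 : ℝ) := Real.rpow_pos_of_pos hε _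
  have b1 := natCast_ceil_le_two_mul h1
  have b2 := natCast_ceil_le_two_mul h2
  have b3 := natCast_ceil_le_two_mul h3
  have exy : iterReal M ΔJ ε * gradSizeReal M Gg2 ε
      = 3456 * (ΔJ * M ^ 4 * Gg2 / ε ^ (7 / 2 : ℝ)) := by
    rw [iterReal, gradSizeReal, e7]; field_simp; ring
  have exz : iterReal M ΔJ ε * hessSizeReal d GH2 ε
      = 304128 * (ΔJ * M ^ 2 * GH2 * Real.log d / ε ^ (5 / 2 : ℝ)) := by
    rw [iterReal, hessSizeReal, e5]; field_simp; ring
  have hy0 : 0 ≤ ΔJ * M ^ 4 * Gg2 / ε ^ (7 / 2 : ℝ) := by positivity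
  rw [totalQueries, queryCount, Finset.sum_const, Finset.card_range, smul_eq_mul]
  push_cast
  set x := iterReal M ΔJ ε
  set y := gradSizeReal M Gg2 ε
  set z := hessSizeReal d GH2 ε
  calc ((⌈x⌉₊ : ℕ) : ℝ) * ((⌈y⌉₊ : ℕ) + 2 * (⌈z⌉₊ : ℕ)) + (⌈y⌉₊ : ℕ)
      ≤ 2 * x * (2 * y + 2 * (2 * z)) + 2 * y := by gcongr
    _ ≤ 2 * x * (2 * y + 2 * (2 * z)) + 2 * (x * y) := by
        -- Since `x ≥ 1`, the extra batch at the last iterate costs no more than one further product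
        -- `x * y`. The constant 2433024 is `8 * 304128`, from the Hessian term.
        have : y ≤ x * y := le_mul_of_one_le_left (by linarith) h1
        linarith
    _ = 6 * (x * y) + 8 * (x * z) := by ring
    _ ≤ _ := by rw [exy, exz]; linarith

theorem eventually_one_le_div_rpow {a p : ℝ} (ha : 0 < a) (hp : 0 < p) :
    ∀ᶠ ε : ℝ in 𝓝[>] 0, 1 ≤ a / ε ^ p := by
  have h1 : Tendsto (fun ε : ℝ => ε ^ p) (𝓝[>] 0) (𝓝 ((0 : ℝ) ^ p)) :=
    ((Real.continuous_rpow_const hp.le).tendsto 0).mono_left nhdsWithin_le_nhds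
  rw [Real.zero_rpow hp.ne'] at h1
  filter_upwards [h1.eventually_lt_const ha, self_mem_nhdsWithin] with ε h2 h3
  rw [le_div_iff₀ (Real.rpow_pos_of_pos h3 _), one_mul]
  exact h2.le

theorem isBigO_totalQueries {d : ℕ} {M ΔJ Gg2 GH2 : ℝ} (hd : 2 ≤ d) (hM : 0 < M) (hΔJ : 0 < ΔJ)
    (hG : 0 < Gg2) (hH : 0 < GH2) :
    (fun ε : ℝ => (totalQueries d M ΔJ Gg2 GH2 ε : ℝ)) =O[𝓝[>] 0]
      (fun ε : ℝ => ε ^ (-(7 / 2) : ℝ)) := by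
  have hlog : 0 < Real.log d := Real.log_pos (by exact_mod_cast hd)
  refine IsBigO.of_bound (2433024 * (ΔJ * M ^ 4 * Gg2 + ΔJ * M ^ 2 * GH2 * Real.log d)) ?_
  have ev1 := eventually_one_le_div_rpow (a := 24 * M ^ 2 * ΔJ) (p := 3 / 2)
    (by positivity) (by norm_num)
  have ev2 := eventually_one_le_div_rpow (a := 144 * M ^ 2 * Gg2) (p := (2 : ℕ))
    (by positivity) (by norm_num)
  have ev3 := eventually_one_le_div_rpow (a := 22 * 24 ^ 2 * GH2 * Real.log d) (p := 1)
    (by positivity) (by norm_num)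
  filter_upwards [ev1, ev2, ev3, self_mem_nhdsWithin,
    Ioo_mem_nhdsGT (zero_lt_one (α := ℝ))] with ε h1 h2 h3 hε hε1
  rw [Real.rpow_natCast] at h2
  rw [Real.rpow_one] at h3
  have hε : 0 < ε := hε
  rw [Real.norm_of_nonneg (Nat.cast_nonneg _), Real.norm_of_nonneg (Real.rpow_nonneg hε.le _)]
  have hp7 := Real.rpow_pos_of_pos hε (7 / 2 : ℝ)
  have hle : ε ^ (7 / 2 : ℝ) ≤ ε ^ (5 / 2 : ℝ) :=
    Real.rpow_le_rpow_of_exponent_ge hε hε1.2.le (by norm_num)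
  have key : ΔJ * M ^ 4 * Gg2 / ε ^ (7 / 2 : ℝ) + ΔJ * M ^ 2 * GH2 * Real.log d / ε ^ (5 / 2 : ℝ)
      ≤ (ΔJ * M ^ 4 * Gg2 + ΔJ * M ^ 2 * GH2 * Real.log d) * ε ^ (-(7 / 2) : ℝ) := by
    rw [Real.rpow_neg hε.le, add_mul, ← div_eq_mul_inv, ← div_eq_mul_inv]
    gcongr
  have := totalQueries_le hε hΔJ hG.le h1 h2 h3
  linarith

variable {S A : Type*} [MeasurableSpace S] [MeasurableSpace A]

/-- The guarantee for the iterate at a uniform random index. -/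
theorem Run.output_guarantee {𝔐 : MDP S A} {d : ℕ} (hd : 2 ≤ d) {π : Policy 𝔐 d} {H : ℕ}
    [NeZero H] {R G L M C ΔJ : ℝ} (hπ : π.Bounds (H := H) R G L) (hR : 0 < R) (hG : 0 < G)
    (hL : 0 < L) (hM : 0 < M) (hC : 0 ≤ C) (hΔJ : 0 < ΔJ) {θ₀ : Param d}
    (hLip : ∀ θ₁ θ₂ : Param d, ‖π.hessJ H θ₁ - π.hessJ H θ₂‖ ≤ M * ‖θ₁ - θ₂‖)
    (hgap : π.J H θ₀ - ⨅ θ, π.J H θ ≤ ΔJ) {ε : ℝ} (hε : 0 < ε) {T Ng NH : ℕ}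
    (hT : T = ⌈iterReal M ΔJ ε⌉₊) (hNg : Ng = ⌈gradSizeReal M (gradVar G R 𝔐.disc) ε⌉₊)
    (hNH : NH = ⌈hessSizeReal d (hessVar H G L R 𝔐.disc) ε⌉₊)
    {Ω : Type*} [mΩ : MeasurableSpace Ω] {μ : Measure Ω} [IsProbabilityMeasure μ]
    {ℱ : Filtration ℕ mΩ} (run : Run π H μ ℱ θ₀ (radius M ε) T Ng NH)
    (hproj : ∀ t < T, ∀ᵐ ω ∂μ,
      ‖(π.hessJ H (run.θ t ω) - run.projHess t ω) (run.dir (t + 1) ω)‖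
        ≤ M * C * ‖run.dir (t + 1) ω‖ ^ 2)
    {tbar : Ω → ℕ} (htbar : Measurable tbar) (hunif : μ.map tbar = uniformOn (Set.Icc 1 T))
    (hindep : Indep (MeasurableSpace.comap tbar ⊤) (ℱ (T + 1)) μ) :
    (Integrable (fun ω => ‖π.gradJ H (run.θ (tbar ω) ω)‖) μ ∧
      ∫ ω, ‖π.gradJ H (run.θ (tbar ω) ω)‖ ∂μ ≤ (3 + 4 * (C + 1 / 24)) / M * ε) ∧
    (Integrable (fun ω => lambdaMin (run.projHess (tbar ω) ω)) μ ∧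
      -3 * Real.sqrt ε ≤ ∫ ω, lambdaMin (run.projHess (tbar ω) ω) ∂μ) := by
  have hlog : 0 < Real.log d := Real.log_pos (by exact_mod_cast hd)
  have hGg := gradVar_pos hG hR 𝔐.disc_lt_one
  have hGH := hessVar_pos (H := H) (G := G) hL hR 𝔐.disc_lt_one
  set Gg := gradVar G R 𝔐.disc with hGgdef
  set GH := hessVar H G L R 𝔐.disc with hGHdef
  set η := Real.sqrt ε with hηdef
  have hη : 0 < η := Real.sqrt_pos.2 hε
  have hηε : η ^ 2 = ε := Real.sq_sqrt hε.le
  have hTreal : 24 * M ^ 2 * ΔJ / η ^ 3 ≤ T := by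
    rw [hT, hηdef, ← rpow_three_halves hε]; exact Nat.le_ceil _
  have hNgreal : 144 * M ^ 2 * Gg / ε ^ 2 ≤ Ng := by rw [hNg]; exact Nat.le_ceil _
  have hNHreal : 22 * 24 ^ 2 * GH * Real.log d / ε ≤ NH := by rw [hNH]; exact Nat.le_ceil _
  have hTpos : 0 < T := Nat.cast_pos.1 (lt_of_lt_of_le (by positivity) hTreal)
  have hNgpos : 0 < Ng := Nat.cast_pos.1 (lt_of_lt_of_le (by positivity) hNgreal)
  have hNHpos : 0 < NH := Nat.cast_pos.1 (lt_of_lt_of_le (by positivity) hNHreal)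
  have hT0 : (0 : ℝ) < T := Nat.cast_pos.2 hTpos
  have hNg0 : (0 : ℝ) < Ng := Nat.cast_pos.2 hNgpos
  have hNH0 : (0 : ℝ) < NH := Nat.cast_pos.2 hNHpos
  -- The unique scales with `c * σ ^ 3 * M = 1` and radius `2 * σ`. They give `c * σ = M / ε` and `c
  -- * σ ^ 2 = 1 / √ε`.
  set c := M ^ 2 / η ^ 3 with hcdef
  set σ := η / M with hσdef
  have hc : 0 < c := by positivity
  have hσ : 0 < σ := by positivity
  have hcσ : c * σ ^ 3 * M = 1 := by rw [hcdef, hσdef]; field_simp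
  have hc1 : c * σ = M / ε := by rw [hcdef, hσdef, ← hηε]; field_simp
  have hc2 : c * σ ^ 2 = 1 / η := by rw [hcdef, hσdef]; field_simp
  have hΔ : radius M ε = 2 * σ := by rw [radius, hσdef, ← hηdef]; ring
  have hgap' : c * (π.J H θ₀ - ⨅ θ, π.J H θ) ≤ T / 24 := by
    calc c * (π.J H θ₀ - ⨅ θ, π.J H θ) ≤ c * ΔJ := by gcongr
      _ = 24 * M ^ 2 * ΔJ / η ^ 3 / 24 := by rw [hcdef]; ring
      _ ≤ T / 24 := by gcongr
  have hg : ∀ t ≤ T, Integrable (run.gradErr t) μ ∧ c * σ * ∫ ω, run.gradErr t ω ∂μ ≤ 1 / 12 := by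
    intro t ht
    -- The factor 144 in the batch size is `12 ^ 2`, making the rescaled mean error 1/12; likewise
    -- `24 ^ 2` below for the Hessian, where the 22 cancels the constant of the concentration bound.
    have h := run.gradErr_le hπ hNgpos (c := ε / (12 * M)) (by positivity) (by
      rw [div_le_iff₀ (by positivity)] at hNgreal ⊢
      calc Gg = (144 * M ^ 2 * Gg) / (144 * M ^ 2) := by field_simp
        _ ≤ (Ng * ε ^ 2) / (144 * M ^ 2) := by gcongr
        _ = _ := by field_simp; norm_num) ht
    refine ⟨h.1, ?_⟩
    calc c * σ * ∫ ω, run.gradErr t ω ∂μ ≤ c * σ * (ε / (12 * M)) := by gcongr; exact h.2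
      _ = 1 / 12 := by rw [hc1]; field_simp
  have hh : ∀ t < T, Integrable (run.hessErr t) μ ∧
      c * σ ^ 2 * ∫ ω, run.hessErr t ω ∂μ ≤ 1 / 24 := by
    intro t ht
    have h := run.hessErr_le hπ hd hNHpos (c := η / 24) (by positivity) (by
      rw [div_pow, hηε]
      rw [div_le_iff₀ (by positivity)] at hNHreal ⊢
      linarith) ht
    refine ⟨h.1, ?_⟩
    calc c * σ ^ 2 * ∫ ω, run.hessErr t ω ∂μ ≤ c * σ ^ 2 * (η / 24) := by gcongr; exact h.2
      _ = 1 / 24 := by rw [hc2]; field_simp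
  have h1 := run.sum_integral_norm_gradJ_le hπ hc hσ hcσ hΔ hLip hC hTpos hgap' hproj hg hh
  have h2 := run.sum_integral_lambdaMin_ge hπ (by omega) hc hσ hcσ hΔ hLip hTpos hgap' hg hh
  obtain ⟨i1, e1⟩ := integral_uniform_index hTpos htbar hunif hindep
    (X := fun t ω => ‖π.gradJ H (run.θ t ω)‖) (fun t ht => run.measurable_norm_gradJ hπ ht)
    (fun t ht => run.integrable_norm_gradJ hπ ht)
  obtain ⟨i2, e2⟩ := integral_uniform_index hTpos htbar hunif hindep
    (X := fun t ω => lambdaMin (run.projHess t ω))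
    (fun t ht => run.measurable_lambdaMin_projHess hπ (by omega) ht)
    (fun t ht => run.integrable_lambdaMin_projHess hπ (by omega) ht)
  refine ⟨⟨i1, ?_⟩, i2, ?_⟩
  · rw [e1, inv_mul_le_iff₀ hT0]
    rw [hc1, div_mul_eq_mul_div, div_le_iff₀ hε] at h1
    rw [div_mul_eq_mul_div, mul_div_assoc', le_div_iff₀ hM]
    linarith
  · rw [e2, le_inv_mul_iff₀ hT0]
    rw [hc2, div_mul_eq_mul_div, one_mul, le_div_iff₀ hη] at h2
    linarith

end Output

end DRSOPO

end

theorem corollary3p7 :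
    -- the constant hidden in the complexity bound is universal
    ∃ K : ℝ, 0 < K ∧
    ∀ {S A : Type*} [MeasurableSpace S] [MeasurableSpace A] (𝔐 : MDP S A)
      (d : ℕ) (_hd : 2 ≤ d) (π : Policy 𝔐 d) (H : ℕ) [NeZero H]
      (R G L M C ΔJ : ℝ) (_hR : 0 < R) (_hG : 0 < G) (_hL : 0 < L) (_hM : 0 < M) (_hC : 0 < C)
      (_hΔJ : 0 < ΔJ) (θ₀ : Param d)
      -- bounded costs
      (_hcost : ∀ s a, |𝔐.cost s a| ≤ R)
      -- expected Lipschitzness and smoothness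
      (_hscore : ∀ (θ : Param d) (h : Fin H),
        ∫⁻ τ, ENNReal.ofReal (‖π.score θ (τ h).1 (τ h).2‖ ^ 4) ∂(π.law H θ)
          ≤ ENNReal.ofReal (G ^ 4))
      (_hscoreDeriv : ∀ (θ : Param d) (h : Fin H),
        ∫⁻ τ, ENNReal.ofReal (‖π.scoreDeriv θ (τ h).1 (τ h).2‖ ^ 2) ∂(π.law H θ)
          ≤ ENNReal.ofReal (L ^ 2))
      -- Lipschitz Hessian
      (_hLip : ∀ θ₁ θ₂ : Param d, ‖π.hessJ H θ₁ - π.hessJ H θ₂‖ ≤ M * ‖θ₁ - θ₂‖)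
      -- initial gap
      (_hgap : π.J H θ₀ - ⨅ θ, π.J H θ ≤ ΔJ),
      -- guarantee for the returned point
      (∀ (ε : ℝ) (_hε : 0 < ε) (T Ng NH : ℕ)
        (_hT : T = ⌈iterReal M ΔJ ε⌉₊)
        (_hNg : Ng = ⌈gradSizeReal M (gradVar G R 𝔐.disc) ε⌉₊)
        (_hNH : NH = ⌈hessSizeReal d (hessVar H G L R 𝔐.disc) ε⌉₊)
        {Ω : Type*} [mΩ : MeasurableSpace Ω] (μ : Measure Ω) [IsProbabilityMeasure μ]
        (ℱ : Filtration ℕ mΩ) (run : Run π H μ ℱ θ₀ (radius M ε) T Ng NH)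
        -- accuracy of the projected Hessian along the steps taken
        (_hproj : ∀ t < T, ∀ᵐ ω ∂μ,
          ‖(π.hessJ H (run.θ t ω) - run.projHess t ω) (run.dir (t + 1) ω)‖
            ≤ M * C * ‖run.dir (t + 1) ω‖ ^ 2)
        -- the index of the returned iterate: uniform on `{1, …, T}`, independent of the run
        (tbar : Ω → ℕ) (_htbar : Measurable tbar)
        (_hunif : μ.map tbar = uniformOn (Set.Icc 1 T))
        (_hindep : Indep (MeasurableSpace.comap tbar ⊤) (ℱ (T + 1)) μ),
        (Integrable (fun ω => ‖π.gradJ H (run.θ (tbar ω) ω)‖) μ ∧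
          ∫ ω, ‖π.gradJ H (run.θ (tbar ω) ω)‖ ∂μ ≤ (3 + 4 * (C + 1 / 24)) / M * ε) ∧
        (Integrable (fun ω => lambdaMin (run.projHess (tbar ω) ω)) μ ∧
          -3 * Real.sqrt ε ≤ ∫ ω, lambdaMin (run.projHess (tbar ω) ω) ∂μ)) ∧
      -- query complexity, for all `ε` so small that rounding up at most doubles the parameters
      (∀ ε : ℝ, 0 < ε → 1 ≤ iterReal M ΔJ ε →
        1 ≤ gradSizeReal M (gradVar G R 𝔐.disc) ε →
        1 ≤ hessSizeReal d (hessVar H G L R 𝔐.disc) ε →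
        (totalQueries d M ΔJ (gradVar G R 𝔐.disc) (hessVar H G L R 𝔐.disc) ε : ℝ) ≤
          K * (ΔJ * M ^ 4 * gradVar G R 𝔐.disc / ε ^ (7 / 2 : ℝ) +
            ΔJ * M ^ 2 * hessVar H G L R 𝔐.disc * Real.log d / ε ^ (5 / 2 : ℝ))) ∧
      (fun ε : ℝ =>
          (totalQueries d M ΔJ (gradVar G R 𝔐.disc) (hessVar H G L R 𝔐.disc) ε : ℝ))
        =O[𝓝[>] 0] (fun ε : ℝ => ε ^ (-(7 / 2) : ℝ)) := by
  refine ⟨2433024, by norm_num, ?_⟩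
  intro S A _ _ 𝔐 d hd π H _ R G L M C ΔJ hR hG hL hM hC hΔJ θ₀ hcost hscore hscoreDeriv hLip hgap
  have hπ : π.Bounds (H := H) R G L := ⟨hR.le, hcost, hscore, hscoreDeriv⟩
  have hGg := gradVar_pos hG hR 𝔐.disc_lt_one
  have hGH := hessVar_pos (H := H) (G := G) hL hR 𝔐.disc_lt_one
  refine ⟨?_, fun ε hε h1 h2 h3 => totalQueries_le hε hΔJ hGg.le h1 h2 h3,
    isBigO_totalQueries hd hM hΔJ hGg hGH⟩
  intro ε hε T Ng NH hT hNg hNH Ω mΩ μ _ ℱ run hproj tbar htbar hunif hindep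
  exact run.output_guarantee hd hπ hR hG hL hM hC.le hΔJ hLip hgap hε hT hNg hNH hproj htbar
    hunif hindep
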